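/- Let $k$ be a field. Let $\mathbf{2Cob}^{\mathrm{ext}}$ be the category of open-closed cobordisms, i.e. the symmetric monoidal category freely generated by a knowledgeable Frobenius algebra object $(A,C,\imath,\imath^*)$ ($A$ the arc, a symmetric Frobenius algebra; $C$ the circle, a commutative Frobenius algebra; $\imath\colon C\to A$ an algebra homomorphism and $\imath^*\colon A\to C$ such that $\mu_A(\imath\otimes\mathrm{id})=\mu_A\tau(\imath\otimes\mathrm{id})$, $\epsilon_C\mu_C(\mathrm{id}\otimes\imath^*)=\epsilon_A\mu_A(\imath\otimes\mathrm{id})$ and $\mu_A\tau\Delta_A=\imath\imath^*$); its objects are finite families of circles and arcs. An open-closed TQFT is a symmetric monoidal functor $Z\colon\mathbf{2Cob}^{\mathrm{ext}}\to\mathbf{Vect}_k$; we again write $A$ for the $k$-algebra that is the value of $Z$ on the arc. Let $T$ be a plane diagram of an oriented tangle with $p$ source points and $q$ target points, with crossings numbered $1,\dots,n$, $n_-$ of them negative. For $\varepsilon\in\{\pm1\}$ colour the regions of $T$ in checkerboard fashion such that the region to the left of the first strand is shaded if $\varepsilon=1$ and unshaded if $\varepsilon=-1$. For a set $\alpha$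 of crossings let $D_\alpha$ be the diagram in which the crossings in $\alpha$ are replaced by their $1$-smoothings and the others by their $0$-smoothings, oriented counter-clockwise around the shaded regions (the $0$-smoothing of a crossing joins the two regions swept out when the upper strand is turned counter-clockwise to the lower one). Number the components of each $D_\alpha$ arbitrarily and let $m^{(\alpha)}\in\{0,1\}^{k_\alpha}$ have entry $1$ at the arcs and $0$ at the circles. For $j\notin\alpha$ let $S_{(\alpha,j)}\colon m^{(\alpha)}\to m^{(\alpha\sqcup\{j\})}$ be the open-closed cobordism that is a saddle near the crossing $j$ and a cylinder elsewhere. The tangle complex has the terms $$C^i=\bigoplus_{|\alpha|=i+n_-}Z(m^{(\alpha)}),\qquad d^i|_{Z(m^{(\alpha)})}=(-1)^{n_-}\sum_{j\notin\alpha}(-1)^{|\{l\in\alpha\,:\,l<j\}|}Z(S_{(\alpha,j)}).$$ Then $d^{i+1}\circ d^i=0$ for all $i$; the number $p+q$ is even, say $p+q=2r$; and exactly $r$ of the boundary points of $T$ are tails ($-$), the other $r$ are heads ($+$), of the oriented arcs of the smoothings $D_\alpha$ (which points are tails depends on $\varepsilon$ only, not on $\alpha$). For any numberings of the tails and of the heads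 by $1,\dots,r$, every $C^i$ is an $(A^{\otimes r},A^{\otimes r})$-bimodule (with both actions $k$-linear) such that, on each summand $Z(m^{(\alpha)})$, the $j$-th tensor factor of the left $A^{\otimes r}$ acts by left multiplication on the tensor factor $A$ of the arc of $D_\alpha$ that starts at the $j$-th tail, and the $j$-th tensor factor of the right $A^{\otimes r}$ acts by right multiplication on the tensor factor $A$ of the arc that ends at the $j$-th head. All differentials $d^i$ are homomorphisms of $(A^{\otimes r},A^{\otimes r})$-bimodules. Thus there is one action of $A$ for each boundary point of $T$, and the tangle complex is a complex of $(A^{\otimes r},A^{\otimes r})$-bimodules. -/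

import Mathlib

open CategoryTheory MonoidalCategory
open scoped TensorProduct DirectSum

universe u

/-! ### The category of open-closed cobordisms -/

namespace OpenClosed

/-- A finite family of circles (`isArc i = false`, the entry `0`) and arcs (`isArc i = true`, the
entry `1`).  A sequence in `{0,1}^k` is the case `ι = Fin k`, and every family is isomorphic to a
sequence by a numbering. -/
structure Ob : Type 1 where
  ι : Type
  [finite : Finite ι]
  isArc : ι → Bool

attribute [instance] Ob.finite

/-- A single arc (`s = true`) or a single circle (`s = false`). -/
abbrev single (s : Bool) : Ob := ⟨Unit, fun _ => s⟩

/-- The empty family. -/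
abbrev empty : Ob := ⟨Empty, fun i => i.elim⟩

/-- Disjoint union. -/
abbrev union (X Y : Ob) : Ob := ⟨X.ι ⊕ Y.ι, Sum.elim X.isArc Y.isArc⟩

theorem sumCongr_isArc {X Y X' Y' : Ob} (e : X.ι ≃ Y.ι) (e' : X'.ι ≃ Y'.ι)
    (h : ∀ i, Y.isArc (e i) = X.isArc i) (h' : ∀ i, Y'.isArc (e' i) = X'.isArc i) :
    ∀ i, (union Y Y').isArc (Equiv.sumCongr e e' i) = (union X X').isArc i := by
  rintro (i | i)
  exacts [h i, h' i]

theorem trans_isArc {X Y W : Ob} (e : X.ι ≃ Y.ι) (e' : Y.ι ≃ W.ι)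
    (h : ∀ i, Y.isArc (e i) = X.isArc i) (h' : ∀ i, W.isArc (e' i) = Y.isArc i) :
    ∀ i, W.isArc (e.trans e' i) = X.isArc i :=
  fun i => (h' (e i)).trans (h i)

theorem refl_isArc (X : Ob) (i : X.ι) : X.isArc (Equiv.refl X.ι i) = X.isArc i := rfl

/-- Formal composites and disjoint unions of the generating open-closed cobordisms.  `relabel` is a
disjoint union of cylinders, read as a bijection between the components of source and target.
The generators `mul s`, `unit s`, `comul s`, `counit s` are those of the arc for `s = true` and
those of the circle for `s = false`; `zip` is `ı : C → A` and `cozip` is `ı* : A → C`. -/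
inductive PreCob : Ob → Ob → Type 1
  | relabel {X Y : Ob} (e : X.ι ≃ Y.ι) (h : ∀ i, Y.isArc (e i) = X.isArc i) : PreCob X Y
  | comp {X Y W : Ob} (f : PreCob X Y) (g : PreCob Y W) : PreCob X W
  | tensor {X Y X' Y' : Ob} (f : PreCob X Y) (g : PreCob X' Y') : PreCob (union X X') (union Y Y')
  | mul (s : Bool) : PreCob (union (single s) (single s)) (single s)
  | unit (s : Bool) : PreCob empty (single s)
  | comul (s : Bool) : PreCob (single s) (union (single s) (single s))
  | counit (s : Bool) : PreCob (single s) empty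
  | zip : PreCob (single false) (single true)
  | cozip : PreCob (single true) (single false)

namespace PreCob

/-- The identity cylinder. -/
def id (X : Ob) : PreCob X X := relabel (Equiv.refl X.ι) (refl_isArc X)

/-- `(X ⊔ Y) ⊔ W → X ⊔ (Y ⊔ W)`. -/
def assoc (X Y W : Ob) : PreCob (union (union X Y) W) (union X (union Y W)) :=
  relabel (Equiv.sumAssoc X.ι Y.ι W.ι) (by rintro ((i | i) | i) <;> rfl)

/-- `X ⊔ (Y ⊔ W) → (X ⊔ Y) ⊔ W`. -/
def assocInv (X Y W : Ob) : PreCob (union X (union Y W)) (union (union X Y) W) :=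
  relabel (Equiv.sumAssoc X.ι Y.ι W.ι).symm (by rintro (i | i | i) <;> rfl)

/-- `∅ ⊔ X → X`. -/
def leftUnit (X : Ob) : PreCob (union empty X) X :=
  relabel (Equiv.emptySum Empty X.ι) (by rintro (i | i); exacts [i.elim, rfl])

/-- `X → ∅ ⊔ X`. -/
def leftUnitInv (X : Ob) : PreCob X (union empty X) :=
  relabel (Equiv.emptySum Empty X.ι).symm (fun _ => rfl)

/-- `X ⊔ ∅ → X`. -/
def rightUnit (X : Ob) : PreCob (union X empty) X :=
  relabel (Equiv.sumEmpty X.ι Empty) (by rintro (i | i); exacts [rfl, i.elim])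

/-- `X → X ⊔ ∅`. -/
def rightUnitInv (X : Ob) : PreCob X (union X empty) :=
  relabel (Equiv.sumEmpty X.ι Empty).symm (fun _ => rfl)

/-- The flip `X ⊔ Y → Y ⊔ X`. -/
def flip (X Y : Ob) : PreCob (union X Y) (union Y X) :=
  relabel (Equiv.sumComm X.ι Y.ι) (by rintro (i | i) <;> rfl)

end PreCob

local infixr:80 " ⋆ " => PreCob.comp
local infixr:90 " ⊠ " => PreCob.tensor

open PreCob in
/-- The relations between formal cobordisms: the axioms of a symmetric monoidal category whose
coherence isomorphisms are the relabellings, and the axioms of a knowledgeable Frobenius algebra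
(composites are written from left to right). -/
inductive Rel : ∀ {X Y : Ob}, PreCob X Y → PreCob X Y → Prop
  | refl {X Y : Ob} (f : PreCob X Y) : Rel f f
  | symm {X Y : Ob} {f g : PreCob X Y} : Rel f g → Rel g f
  | trans {X Y : Ob} {f g h : PreCob X Y} : Rel f g → Rel g h → Rel f h
  | comp_congr {X Y W : Ob} {f f' : PreCob X Y} {g g' : PreCob Y W} :
      Rel f f' → Rel g g' → Rel (f ⋆ g) (f' ⋆ g')
  | tensor_congr {X Y X' Y' : Ob} {f f' : PreCob X Y} {g g' : PreCob X' Y'} :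
      Rel f f' → Rel g g' → Rel (f ⊠ g) (f' ⊠ g')
  -- category
  | id_comp {X Y : Ob} (f : PreCob X Y) : Rel (id X ⋆ f) f
  | comp_id {X Y : Ob} (f : PreCob X Y) : Rel (f ⋆ id Y) f
  | comp_assoc {X Y W V : Ob} (f : PreCob X Y) (g : PreCob Y W) (h : PreCob W V) :
      Rel ((f ⋆ g) ⋆ h) (f ⋆ g ⋆ h)
  -- relabellings form a functor that respects disjoint unions
  | relabel_comp {X Y W : Ob} (e : X.ι ≃ Y.ι) (e' : Y.ι ≃ W.ι)
      (h : ∀ i, Y.isArc (e i) = X.isArc i) (h' : ∀ i, W.isArc (e' i) = Y.isArc i) :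
      Rel (relabel e h ⋆ relabel e' h') (relabel (e.trans e') (trans_isArc e e' h h'))
  | relabel_tensor {X Y X' Y' : Ob} (e : X.ι ≃ Y.ι) (e' : X'.ι ≃ Y'.ι)
      (h : ∀ i, Y.isArc (e i) = X.isArc i) (h' : ∀ i, Y'.isArc (e' i) = X'.isArc i) :
      Rel (relabel e h ⊠ relabel e' h')
        (relabel (X := union X X') (Y := union Y Y') (Equiv.sumCongr e e')
        (sumCongr_isArc e e' h h'))
  -- symmetric monoidal category
  | tensor_comp {X Y W X' Y' W' : Ob} (f : PreCob X Y) (g : PreCob Y W)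
      (f' : PreCob X' Y') (g' : PreCob Y' W') :
      Rel ((f ⋆ g) ⊠ (f' ⋆ g')) ((f ⊠ f') ⋆ (g ⊠ g'))
  | assoc_natural {X₁ X₂ X₃ Y₁ Y₂ Y₃ : Ob} (f : PreCob X₁ Y₁) (g : PreCob X₂ Y₂)
      (h : PreCob X₃ Y₃) :
      Rel (((f ⊠ g) ⊠ h) ⋆ assoc Y₁ Y₂ Y₃) (assoc X₁ X₂ X₃ ⋆ (f ⊠ (g ⊠ h)))
  | leftUnit_natural {X Y : Ob} (f : PreCob X Y) :
      Rel ((id empty ⊠ f) ⋆ leftUnit Y) (leftUnit X ⋆ f)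
  | rightUnit_natural {X Y : Ob} (f : PreCob X Y) :
      Rel ((f ⊠ id empty) ⋆ rightUnit Y) (rightUnit X ⋆ f)
  | flip_natural {X Y X' Y' : Ob} (f : PreCob X Y) (g : PreCob X' Y') :
      Rel ((f ⊠ g) ⋆ flip Y Y') (flip X X' ⋆ (g ⊠ f))
  -- arc and circle are Frobenius algebras
  | unit_mul (s : Bool) : Rel ((unit s ⊠ id (single s)) ⋆ mul s) (leftUnit (single s))
  | mul_unit (s : Bool) : Rel ((id (single s) ⊠ unit s) ⋆ mul s) (rightUnit (single s))
  | mul_assoc (s : Bool) : Rel ((mul s ⊠ id (single s)) ⋆ mul s)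
      (assoc (single s) (single s) (single s) ⋆ (id (single s) ⊠ mul s) ⋆ mul s)
  | comul_counit_left (s : Bool) :
      Rel (comul s ⋆ (counit s ⊠ id (single s))) (leftUnitInv (single s))
  | comul_counit_right (s : Bool) :
      Rel (comul s ⋆ (id (single s) ⊠ counit s)) (rightUnitInv (single s))
  | comul_coassoc (s : Bool) :
      Rel (comul s ⋆ (comul s ⊠ id (single s)) ⋆ assoc (single s) (single s) (single s))
        (comul s ⋆ (id (single s) ⊠ comul s))
  | frobenius_left (s : Bool) :
      Rel ((comul s ⊠ id (single s)) ⋆ assoc (single s) (single s) (single s) ⋆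
        (id (single s) ⊠ mul s)) (mul s ⋆ comul s)
  | frobenius_right (s : Bool) :
      Rel ((id (single s) ⊠ comul s) ⋆ assocInv (single s) (single s) (single s) ⋆
        (mul s ⊠ id (single s))) (mul s ⋆ comul s)
  -- the arc is symmetric, the circle is commutative
  | arc_symmetric :
      Rel (flip (single true) (single true) ⋆ mul true ⋆ counit true) (mul true ⋆ counit true)
  | circle_commutative : Rel (flip (single false) (single false) ⋆ mul false) (mul false)
  -- `zip` is a homomorphism of algebras
  | zip_mul : Rel ((zip ⊠ zip) ⋆ mul true) (mul false ⋆ zip)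
  | zip_unit : Rel (unit false ⋆ zip) (unit true)
  -- knowledge, duality, Cardy condition
  | knowledge : Rel ((zip ⊠ id (single true)) ⋆ mul true)
      ((zip ⊠ id (single true)) ⋆ flip (single true) (single true) ⋆ mul true)
  | duality : Rel ((id (single false) ⊠ cozip) ⋆ mul false ⋆ counit false)
      ((zip ⊠ id (single true)) ⋆ mul true ⋆ counit true)
  | cardy : Rel (comul true ⋆ flip (single true) (single true) ⋆ mul true) (cozip ⋆ zip)

/-- Formal cobordisms up to the relations. -/
instance cobSetoid (X Y : Ob) : Setoid (PreCob X Y) := ⟨Rel, ⟨Rel.refl, Rel.symm, Rel.trans⟩⟩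

/-- The category of open-closed cobordisms: the symmetric monoidal category freely generated by a
knowledgeable Frobenius algebra object. -/
instance : Category Ob where
  Hom X Y := Quotient (cobSetoid X Y)
  id X := ⟦PreCob.id X⟧
  comp := Quotient.map₂ PreCob.comp (fun _ _ h _ _ h' => Rel.comp_congr h h')
  id_comp := by rintro X Y ⟨f⟩; exact Quotient.sound (Rel.id_comp f)
  comp_id := by rintro X Y ⟨f⟩; exact Quotient.sound (Rel.comp_id f)
  assoc := by rintro X Y W V ⟨f⟩ ⟨g⟩ ⟨h⟩; exact Quotient.sound (Rel.comp_assoc f g h)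

/-- The cobordism represented by a formal one. -/
def cob {X Y : Ob} (f : PreCob X Y) : X ⟶ Y := Quotient.mk (cobSetoid X Y) f

theorem cob_surjective {X Y : Ob} (f : X ⟶ Y) : ∃ g : PreCob X Y, cob g = f :=
  Quotient.exists_rep f

theorem cob_sound {X Y : Ob} {f g : PreCob X Y} (h : Rel f g) : cob f = cob g := Quotient.sound h

theorem cob_id (X : Ob) : cob (PreCob.id X) = 𝟙 X := rfl

theorem cob_comp {X Y W : Ob} (f : PreCob X Y) (g : PreCob Y W) :
    cob (f ⋆ g) = cob f ≫ cob g := rfl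

/-- The cylinder over a bijection of components. -/
def relabel {X Y : Ob} (e : X.ι ≃ Y.ι) (h : ∀ i, Y.isArc (e i) = X.isArc i) : X ⟶ Y :=
  cob (PreCob.relabel e h)

theorem relabel_comp {X Y W : Ob} (e : X.ι ≃ Y.ι) (e' : Y.ι ≃ W.ι)
    (h : ∀ i, Y.isArc (e i) = X.isArc i) (h' : ∀ i, W.isArc (e' i) = Y.isArc i) :
    relabel e h ≫ relabel e' h' =
      relabel (e.trans e') (trans_isArc e e' h h') :=
  cob_sound (Rel.relabel_comp e e' h h')

theorem relabel_refl (X : Ob) (h : ∀ i, X.isArc (Equiv.refl X.ι i) = X.isArc i) :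
    relabel (Equiv.refl X.ι) h = 𝟙 X := rfl

/-- A relabelling is an isomorphism. -/
def relabelIso {X Y : Ob} (e : X.ι ≃ Y.ι) (h : ∀ i, Y.isArc (e i) = X.isArc i) : X ≅ Y where
  hom := relabel e h
  inv := relabel e.symm (fun i => by rw [← h, e.apply_symm_apply])
  hom_inv_id := by
    rw [relabel_comp, ← relabel_refl X (fun _ => rfl)]
    congr 1
    exact e.self_trans_symm
  inv_hom_id := by
    rw [relabel_comp, ← relabel_refl Y (fun _ => rfl)]
    congr 1
    exact e.symm_trans_self

/-- Disjoint union of cobordisms. -/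
def tensor {X Y X' Y' : Ob} (f : X ⟶ Y) (g : X' ⟶ Y') : union X X' ⟶ union Y Y' :=
  Quotient.map₂ PreCob.tensor (fun _ _ h _ _ h' => Rel.tensor_congr h h') f g

theorem cob_tensor {X Y X' Y' : Ob} (f : PreCob X Y) (g : PreCob X' Y') :
    tensor (cob f) (cob g) = cob (f ⊠ g) := rfl

theorem relabel_tensor {X Y X' Y' : Ob} (e : X.ι ≃ Y.ι) (e' : X'.ι ≃ Y'.ι)
    (h : ∀ i, Y.isArc (e i) = X.isArc i) (h' : ∀ i, Y'.isArc (e' i) = X'.isArc i) :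
    tensor (relabel e h) (relabel e' h') =
      relabel (X := union X X') (Y := union Y Y') (Equiv.sumCongr e e')
        (sumCongr_isArc e e' h h') :=
  cob_sound (Rel.relabel_tensor e e' h h')

theorem relabel_congr {X Y : Ob} {e e' : X.ι ≃ Y.ι} (h : ∀ i, Y.isArc (e i) = X.isArc i)
    (h' : ∀ i, Y.isArc (e' i) = X.isArc i) (he : ∀ i, e i = e' i) : relabel e h = relabel e' h' := by
  obtain rfl : e = e' := Equiv.ext he
  rfl

instance : MonoidalCategoryStruct Ob where
  tensorObj := union
  tensorUnit := empty
  tensorHom := tensor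
  whiskerLeft X _ _ f := tensor (𝟙 X) f
  whiskerRight f X := tensor f (𝟙 X)
  associator X Y W := relabelIso (X := union (union X Y) W) (Y := union X (union Y W))
    (Equiv.sumAssoc X.ι Y.ι W.ι) (by rintro ((i | i) | i) <;> rfl)
  leftUnitor X := relabelIso (X := union empty X)
    (Equiv.emptySum Empty X.ι) (by rintro (i | i); exacts [i.elim, rfl])
  rightUnitor X := relabelIso (X := union X empty)
    (Equiv.sumEmpty X.ι Empty) (by rintro (i | i); exacts [rfl, i.elim])

theorem id_eq (X : Ob) : 𝟙 X = relabel (Equiv.refl X.ι) (refl_isArc X) := rfl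

instance : MonoidalCategory Ob :=
  MonoidalCategory.ofTensorHom
    (id_tensorHom_id := fun X Y => by
      change tensor (𝟙 X) (𝟙 Y) = 𝟙 (union X Y)
      rw [id_eq, id_eq, id_eq, relabel_tensor]
      exact relabel_congr _ _ (by rintro (i | i) <;> rfl))
    (id_tensorHom := fun _ _ _ _ => rfl)
    (tensorHom_id := fun _ _ => rfl)
    (tensorHom_comp_tensorHom := by
      rintro X Y W X' Y' W' ⟨f⟩ ⟨f'⟩ ⟨g⟩ ⟨g'⟩
      exact (cob_sound (Rel.tensor_comp f g f' g')).symm)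
    (associator_naturality := by
      rintro X₁ X₂ X₃ Y₁ Y₂ Y₃ ⟨f⟩ ⟨g⟩ ⟨h⟩
      exact cob_sound (Rel.assoc_natural f g h))
    (leftUnitor_naturality := by
      rintro X Y ⟨f⟩
      exact cob_sound (Rel.leftUnit_natural f))
    (rightUnitor_naturality := by
      rintro X Y ⟨f⟩
      exact cob_sound (Rel.rightUnit_natural f))
    (pentagon := fun W X Y V => by
      change tensor (relabel _ _) (𝟙 V) ≫ relabel _ _ ≫ tensor (𝟙 W) (relabel _ _) =
        relabel _ _ ≫ relabel _ _
      rw [id_eq, id_eq, relabel_tensor, relabel_tensor, relabel_comp, relabel_comp, relabel_comp]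
      exact relabel_congr _ _ (by rintro (((i | i) | i) | i) <;> rfl))
    (triangle := fun X Y => by
      change relabel _ _ ≫ tensor (𝟙 X) (relabel _ _) = tensor (relabel _ _) (𝟙 Y)
      rw [id_eq, id_eq, relabel_tensor, relabel_tensor, relabel_comp]
      exact relabel_congr _ _ (by rintro ((i | i) | i); exacts [rfl, i.elim, rfl]))

instance : SymmetricCategory Ob where
  braiding X Y := relabelIso (X := union X Y) (Y := union Y X)
    (Equiv.sumComm X.ι Y.ι) (by rintro (i | i) <;> rfl)
  braiding_naturality_right := by
    rintro X Y W ⟨f⟩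
    exact cob_sound (Rel.flip_natural (PreCob.id X) f)
  braiding_naturality_left := by
    rintro X Y ⟨f⟩ W
    exact cob_sound (Rel.flip_natural f (PreCob.id W))
  hexagon_forward := fun X Y W => by
    change relabel _ _ ≫ relabel _ _ ≫ relabel _ _ =
      tensor (relabel _ _) (𝟙 W) ≫ relabel _ _ ≫ tensor (𝟙 Y) (relabel _ _)
    rw [id_eq, id_eq, relabel_tensor, relabel_tensor]
    rw [relabel_comp, relabel_comp, relabel_comp, relabel_comp]
    exact relabel_congr _ _ (by rintro ((i | i) | i) <;> rfl)
  hexagon_reverse := fun X Y W => by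
    change relabel _ _ ≫ relabel _ _ ≫ relabel _ _ =
      tensor (𝟙 X) (relabel _ _) ≫ relabel _ _ ≫ tensor (relabel _ _) (𝟙 Y)
    rw [id_eq, id_eq, relabel_tensor, relabel_tensor]
    rw [relabel_comp, relabel_comp, relabel_comp, relabel_comp]
    exact relabel_congr _ _ (by rintro (i | i | i) <;> rfl)
  symmetry := fun X Y => by
    change relabel _ _ ≫ relabel _ _ = 𝟙 (union X Y)
    rw [id_eq, relabel_comp]
    exact relabel_congr _ _ (by rintro (i | i) <;> rfl)

/-- Multiplication makes the arc a monoid object. -/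
instance : MonObj (single true) where
  one := cob (PreCob.unit true)
  mul := cob (PreCob.mul true)
  one_mul := cob_sound (Rel.unit_mul true)
  mul_one := cob_sound (Rel.mul_unit true)
  mul_assoc := cob_sound (Rel.mul_assoc true)

/-! ### Saddles and actions between families of components -/

/-- Exhibit one chosen element of a type. -/
noncomputable def singleEquiv {I : Type} (x : I) : Unit ⊕ {z : I // z ≠ x} ≃ I :=
  Equiv.ofBijective (Sum.elim (fun _ => x) Subtype.val) <| by
    constructor
    · rintro (a | a) (b | b) h
      · rfl
      · exact absurd h.symm b.2
      · exact absurd h a.2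
      · exact congrArg Sum.inr (Subtype.ext h)
    · intro z
      by_cases hz : z = x
      · exact ⟨Sum.inl (), hz.symm⟩
      · exact ⟨Sum.inr ⟨z, hz⟩, rfl⟩

/-- The elements of a type different from two given ones. -/
abbrev Away {I : Type} (x y : I) : Type := {z : I // z ≠ x ∧ z ≠ y}

/-- Exhibit two different chosen elements of a type. -/
noncomputable def pairEquiv {I : Type} (x y : I) (h : x ≠ y) : (Unit ⊕ Unit) ⊕ Away x y ≃ I :=
  Equiv.ofBijective (Sum.elim (Sum.elim (fun _ => x) (fun _ => y)) Subtype.val) <| by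
    constructor
    · rintro ((a | a) | a) ((b | b) | b) hab
      · rfl
      · exact absurd hab h
      · exact absurd hab.symm b.2.1
      · exact absurd hab.symm h
      · rfl
      · exact absurd hab.symm b.2.2
      · exact absurd hab a.2.1
      · exact absurd hab a.2.2
      · exact congrArg Sum.inr (Subtype.ext hab)
    · intro z
      by_cases hx : z = x
      · exact ⟨Sum.inl (Sum.inl ()), hx.symm⟩
      · by_cases hy : z = y
        · exact ⟨Sum.inl (Sum.inr ()), hy.symm⟩
        · exact ⟨Sum.inr ⟨z, hx, hy⟩, rfl⟩

/-- Exhibit one chosen element of a type, which is given twice. -/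
noncomputable def onceEquiv {I : Type} (x y : I) (h : x = y) : Unit ⊕ Away x y ≃ I :=
  (Equiv.sumCongr (Equiv.refl Unit)
    (Equiv.subtypeEquivRight (fun z => by rw [← h, and_self]))).trans (singleEquiv x)

/-- The family of all components other than `x` and `y`. -/
abbrev away (X : Ob) (x y : X.ι) : Ob := ⟨Away x y, fun z => X.isArc z.1⟩

/-- Split off two different components. -/
noncomputable def pairIso (X : Ob) (x y : X.ι) (h : x ≠ y) :
    (single (X.isArc x) ⊗ single (X.isArc y)) ⊗ away X x y ≅ X :=
  relabelIso (X := union (union (single (X.isArc x)) (single (X.isArc y))) (away X x y))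
    (pairEquiv x y h) (by rintro ((i | i) | i) <;> rfl)

/-- Split off one component, which is given twice. -/
noncomputable def onceIso (X : Ob) (x y : X.ι) (h : x = y) :
    single (X.isArc x) ⊗ away X x y ≅ X :=
  relabelIso (X := union (single (X.isArc x)) (away X x y))
    (onceEquiv x y h) (by rintro (i | i) <;> rfl)

/-- The cobordisms `ı` and `ı*` and cylinders, by the kinds of source and target. -/
def convert : ∀ s t : Bool, single s ⟶ single t
  | false, true => cob PreCob.zip
  | true, false => cob PreCob.cozip
  | true, true => 𝟙 _
  | false, false => 𝟙 _

/-- Two components merge into one: `μ_C`, or `μ_A ∘ (ı ⊗ id)`, or `μ_A ∘ (id ⊗ ı)`. -/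
def merge (s t w : Bool) : single s ⊗ single t ⟶ single w :=
  (convert s w ⊗ₘ convert t w) ≫ cob (PreCob.mul w)

/-- One component splits into two: `Δ_C`, or `(ı* ⊗ id) ∘ Δ_A`, or `(id ⊗ ı*) ∘ Δ_A`. -/
def split (w s t : Bool) : single w ⟶ single s ⊗ single t :=
  cob (PreCob.comul w) ≫ (convert w s ⊗ₘ convert w t)

/-- The saddle between two arcs and two arcs,
`(μ_A ⊗ id) ∘ (id ⊗ τ) ∘ (Δ_A ⊗ id) : A ⊗ A → A ⊗ A`.  The left end of each arc of the target is
the left end of the arc of the source with the same number, while the right ends are exchanged. -/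
def arcSaddle : single true ⊗ single true ⟶ single true ⊗ single true :=
  (cob (PreCob.comul true) ▷ single true) ≫ (α_ _ _ _).hom ≫
    (single true ◁ (β_ (single true) (single true)).hom) ≫ (α_ _ _ _).inv ≫
      (cob (PreCob.mul true) ▷ single true)

/-- The saddle cobordism `X → Y` in which (only) the components `x₁`, `x₂` of the source and `y₁`,
`y₂` of the target touch the saddle; `ρ` identifies all other components, which carry cylinders.
Here `x₁` and `y₁` contain one of the two strands that run into the saddle, `x₂` and `y₂` the other.
For a saddle between oriented `1`-manifolds the following cases occur.
* `x₁ ≠ x₂`, `y₁ ≠ y₂`: all four components are arcs.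
* `x₁ ≠ x₂`, `y₁ = y₂`: an arc and a circle merge into an arc, or two circles into a circle.
* `x₁ = x₂`, `y₁ ≠ y₂`: an arc splits into an arc and a circle, or a circle into two circles.
The remaining values of the function are irrelevant. -/
noncomputable def saddle (X Y : Ob) (x₁ x₂ : X.ι) (y₁ y₂ : Y.ι) (ρ : away X x₁ x₂ ≅ away Y y₁ y₂) :
    X ⟶ Y :=
  open Classical in
  if hx : x₁ = x₂ then
    if hy : y₁ = y₂ then
      (onceIso X x₁ x₂ hx).inv ≫ (convert (X.isArc x₁) (Y.isArc y₁) ⊗ₘ ρ.hom) ≫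
        (onceIso Y y₁ y₂ hy).hom
    else
      (onceIso X x₁ x₂ hx).inv ≫
        (split (X.isArc x₁) (Y.isArc y₁) (Y.isArc y₂) ⊗ₘ ρ.hom) ≫ (pairIso Y y₁ y₂ hy).hom
  else
    if hy : y₁ = y₂ then
      (pairIso X x₁ x₂ hx).inv ≫
        (merge (X.isArc x₁) (X.isArc x₂) (Y.isArc y₁) ⊗ₘ ρ.hom) ≫ (onceIso Y y₁ y₂ hy).hom
    else
      (pairIso X x₁ x₂ hx).inv ≫
        (((convert (X.isArc x₁) true ⊗ₘ convert (X.isArc x₂) true) ≫ arcSaddle ≫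
          (convert true (Y.isArc y₁) ⊗ₘ convert true (Y.isArc y₂))) ⊗ₘ ρ.hom) ≫
        (pairIso Y y₁ y₂ hy).hom

/-- Split off an arc. -/
noncomputable def arcIso (X : Ob) (x : X.ι) (h : X.isArc x = true) :
    single true ⊗ (⟨{z // z ≠ x}, fun z => X.isArc z.1⟩ : Ob) ≅ X :=
  relabelIso (X := union (single true) ⟨{z // z ≠ x}, fun z => X.isArc z.1⟩)
    (singleEquiv x) (by rintro (i | i); exacts [h, rfl])

/-- Multiplication of an additional arc from the left onto the arc `x` of `X`. -/
noncomputable def mulLeft (X : Ob) (x : X.ι) (h : X.isArc x = true) : single true ⊗ X ⟶ X :=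
  (single true ◁ (arcIso X x h).inv) ≫ (α_ _ _ _).inv ≫ (cob (PreCob.mul true) ▷ _) ≫
    (arcIso X x h).hom

/-- Multiplication of an additional arc from the right onto the arc `x` of `X`. -/
noncomputable def mulRight (X : Ob) (x : X.ι) (h : X.isArc x = true) : X ⊗ single true ⟶ X :=
  ((arcIso X x h).inv ▷ single true) ≫ (α_ _ _ _).hom ≫ (_ ◁ (β_ _ _).hom) ≫ (α_ _ _ _).inv ≫
    (cob (PreCob.mul true) ▷ _) ≫ (arcIso X x h).hom

end OpenClosed

open OpenClosed

/-- An open-closed topological quantum field theory: a symmetric monoidal functor from open-closed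
cobordisms to vector spaces. -/
structure OpenClosedTQFT (k : Type u) [Field k] where
  functor : Ob ⥤ ModuleCat.{u} k
  [braided : functor.Braided]

attribute [instance] OpenClosedTQFT.braided

namespace OpenClosedTQFT

variable {k : Type u} [Field k] (Z : OpenClosedTQFT k)

/-- The vector space `A` of the arc. -/
abbrev A : ModuleCat.{u} k := Z.functor.obj (single true)

/-- `A` is a monoid object, with multiplication `Z(μ_A)` and unit `Z(η_A)`. -/
noncomputable instance monObjA : MonObj Z.A := Z.functor.monObjObj (single true)

/-- The ring structure of `A`. -/
noncomputable instance ringA : Ring Z.A := ModuleCat.MonModuleEquivalenceAlgebra.MonObj.toRing Z.A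

/-- The algebra structure of `A`. -/
noncomputable instance algebraA : Algebra k Z.A := ModuleCat.MonModuleEquivalenceAlgebra.Algebra_of_Mon_ Z.A

/-- The operator on `Z(X)` by which `a ∈ A` acts from the left on the tensor factor `x`. -/
noncomputable def actLeft (X : Ob) (x : X.ι) (h : X.isArc x = true) (a : Z.A) :
    Module.End k (Z.functor.obj X) :=
  (Functor.LaxMonoidal.μ Z.functor (single true) X ≫ Z.functor.map (mulLeft X x h)).hom ∘ₗ
    TensorProduct.mk k Z.A (Z.functor.obj X) a

/-- The operator on `Z(X)` by which `a ∈ A` acts from the right on the tensor factor `x`. -/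
noncomputable def actRight (X : Ob) (x : X.ι) (h : X.isArc x = true) (a : Z.A) :
    Module.End k (Z.functor.obj X) :=
  (Functor.LaxMonoidal.μ Z.functor X (single true) ≫ Z.functor.map (mulRight X x h)).hom ∘ₗ
    (TensorProduct.mk k (Z.functor.obj X) Z.A).flip a

end OpenClosedTQFT

/-! ### Local changes of a relation -/

/-- The relations `r`, `r'` differ only in a set `K` of points, each of which is equivalent
to `x₁` or `x₂` under both relations. -/
structure LocalChange {P : Type} (r r' : P → P → Prop) (x₁ x₂ : P) (K : Set P) : Prop where
  fwd : ∀ p q, r p q → r' p q ∨ (p ∈ K ∧ q ∈ K)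
  bwd : ∀ p q, r' p q → r p q ∨ (p ∈ K ∧ q ∈ K)
  src : ∀ p ∈ K, Quot.mk r p = Quot.mk r x₁ ∨ Quot.mk r p = Quot.mk r x₂
  tgt : ∀ p ∈ K, Quot.mk r' p = Quot.mk r' x₁ ∨ Quot.mk r' p = Quot.mk r' x₂

namespace LocalChange

variable {P : Type} {r r' : P → P → Prop} {x₁ x₂ : P} {K : Set P}

theorem symm (H : LocalChange r r' x₁ x₂ K) : LocalChange r' r x₁ x₂ K :=
  ⟨H.bwd, H.fwd, H.tgt, H.src⟩

theorem step (H : LocalChange r r' x₁ x₂ K) {p q : P} (h : Relation.EqvGen r p q) :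
    ((Quot.mk r' p = Quot.mk r' x₁ ∨ Quot.mk r' p = Quot.mk r' x₂) ↔
      (Quot.mk r' q = Quot.mk r' x₁ ∨ Quot.mk r' q = Quot.mk r' x₂)) ∧
    (Quot.mk r' p = Quot.mk r' q ∨
      (Quot.mk r' q = Quot.mk r' x₁ ∨ Quot.mk r' q = Quot.mk r' x₂)) := by
  induction h with
  | rel p q h =>
    rcases H.fwd p q h with h | ⟨hp, hq⟩
    · rw [Quot.sound h]
      exact ⟨Iff.rfl, Or.inl rfl⟩
    · exact ⟨iff_of_true (H.tgt p hp) (H.tgt q hq), Or.inr (H.tgt q hq)⟩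
  | refl p => exact ⟨Iff.rfl, Or.inl rfl⟩
  | symm p q _ ih => exact ⟨ih.1.symm, ih.2.imp Eq.symm ih.1.2⟩
  | trans p q s _ _ ih₁ ih₂ =>
    refine ⟨ih₁.1.trans ih₂.1, ?_⟩
    rcases ih₂.2 with h | h
    · rw [← h]; exact ih₁.2
    · exact Or.inr h

theorem touch (H : LocalChange r r' x₁ x₂ K) {p : P}
    (h : Quot.mk r p = Quot.mk r x₁ ∨ Quot.mk r p = Quot.mk r x₂) :
    Quot.mk r' p = Quot.mk r' x₁ ∨ Quot.mk r' p = Quot.mk r' x₂ := by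
  rcases h with h | h
  · exact (H.step (Quot.eqvGen_exact h)).1.2 (Or.inl rfl)
  · exact (H.step (Quot.eqvGen_exact h)).1.2 (Or.inr rfl)

/-- A class of `r` away from `x₁`, `x₂` is a class of `r'`. -/
noncomputable def map (H : LocalChange r r' x₁ x₂ K) (c : Away (Quot.mk r x₁) (Quot.mk r x₂)) :
    Away (Quot.mk r' x₁) (Quot.mk r' x₂) :=
  ⟨Quot.mk r' c.1.out, by
    have h : ¬ (Quot.mk r' c.1.out = Quot.mk r' x₁ ∨ Quot.mk r' c.1.out = Quot.mk r' x₂) := by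
      intro h
      have h' := H.symm.touch h
      rw [Quot.out_eq] at h'
      exact h'.elim c.2.1 c.2.2
    exact not_or.1 h⟩

theorem map_mk (H : LocalChange r r' x₁ x₂ K) (c : Away (Quot.mk r x₁) (Quot.mk r x₂)) {p : P}
    (hp : Quot.mk r p = c.1) : Quot.mk r' p = (H.map c).1 := by
  have h : Quot.mk r p = Quot.mk r c.1.out := by rw [hp, Quot.out_eq]
  exact (H.step (Quot.eqvGen_exact h)).2.resolve_right (not_or.2 (H.map c).2)

/-- The classes away from `x₁`, `x₂` are the same for both relations. -/
noncomputable def equiv (H : LocalChange r r' x₁ x₂ K) :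
    Away (Quot.mk r x₁) (Quot.mk r x₂) ≃ Away (Quot.mk r' x₁) (Quot.mk r' x₂) where
  toFun := H.map
  invFun := H.symm.map
  left_inv c := Subtype.ext ((H.symm.map_mk (H.map c) rfl).symm.trans (Quot.out_eq c.1))
  right_inv c := Subtype.ext ((H.map_mk (H.symm.map c) rfl).symm.trans (Quot.out_eq c.1))

end LocalChange

/-! ### Plane diagrams of oriented tangles -/

/-- The kinds of elementary pieces of a tangle diagram. `cross true` is a crossing in which the
strand from the bottom left to the top right runs above the other one, `cross false` a crossing in
which it runs below. -/
inductive PieceKind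
  | cup
  | cap
  | cross (slashOver : Bool)

/-- A horizontal layer of a tangle diagram: one elementary piece between vertical strands,
of which `pos` are to the left of the piece. -/
structure Layer where
  kind : PieceKind
  pos : ℕ

namespace Layer

/-- The layer has `m` ends at the bottom and `m'` ends at the top. -/
def Fits (L : Layer) (m m' : ℕ) : Prop :=
  match L.kind with
  | .cup => L.pos ≤ m ∧ m' = m + 2
  | .cap => L.pos ≤ m' ∧ m = m' + 2
  | .cross _ => L.pos + 2 ≤ m ∧ m' = m

/-- The layer contains a crossing. -/
def IsCrossing (L : Layer) : Prop := ∃ b, L.kind = .cross b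

/-- The strands of a layer other than those of a crossing. Bottom ends are `Sum.inl`, top ends
`Sum.inr`, numbered from left to right starting with `0`. -/
inductive Strand (L : Layer) : ℕ ⊕ ℕ → ℕ ⊕ ℕ → Prop
  | left (i : ℕ) (h : i < L.pos) : Strand L (.inl i) (.inr i)
  | cup_right (i : ℕ) (hL : L.kind = .cup) (h : L.pos ≤ i) : Strand L (.inl i) (.inr (i + 2))
  | cup_turn (hL : L.kind = .cup) : Strand L (.inr L.pos) (.inr (L.pos + 1))
  | cap_right (i : ℕ) (hL : L.kind = .cap) (h : L.pos ≤ i) : Strand L (.inl (i + 2)) (.inr i)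
  | cap_turn (hL : L.kind = .cap) : Strand L (.inl L.pos) (.inl (L.pos + 1))
  | cross_right (i : ℕ) (b : Bool) (hL : L.kind = .cross b) (h : L.pos + 2 ≤ i) :
      Strand L (.inl i) (.inr i)

/-- All strands of a layer; at a crossing they go from the bottom left to the top right and from
the bottom right to the top left. -/
inductive FullStrand (L : Layer) : ℕ ⊕ ℕ → ℕ ⊕ ℕ → Prop
  | strand {x y : ℕ ⊕ ℕ} (h : Strand L x y) : FullStrand L x y
  | slash (b : Bool) (hL : L.kind = .cross b) : FullStrand L (.inl L.pos) (.inr (L.pos + 1))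
  | backslash (b : Bool) (hL : L.kind = .cross b) : FullStrand L (.inl (L.pos + 1)) (.inr L.pos)

/-- All strands of a layer whose crossing, if any, has been replaced by two vertical strands or by
two horizontal strands. The `0`-smoothing (`one` is false) is vertical if and only if the strand
from the bottom left to the top right is the upper one. -/
inductive SmoothStrand (L : Layer) (one : Prop) : ℕ ⊕ ℕ → ℕ ⊕ ℕ → Prop
  | strand {x y : ℕ ⊕ ℕ} (h : Strand L x y) : SmoothStrand L one x y
  | vertical_left (b : Bool) (hL : L.kind = .cross b) (h : b = true ↔ ¬ one) :
      SmoothStrand L one (.inl L.pos) (.inr L.pos)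
  | vertical_right (b : Bool) (hL : L.kind = .cross b) (h : b = true ↔ ¬ one) :
      SmoothStrand L one (.inl (L.pos + 1)) (.inr (L.pos + 1))
  | horizontal_bottom (b : Bool) (hL : L.kind = .cross b) (h : b = true ↔ one) :
      SmoothStrand L one (.inl L.pos) (.inl (L.pos + 1))
  | horizontal_top (b : Bool) (hL : L.kind = .cross b) (h : b = true ↔ one) :
      SmoothStrand L one (.inr L.pos) (.inr (L.pos + 1))

end Layer

/-- A generic plane diagram of an oriented `(p,q)`-tangle, in the strip between `p` source points
at the bottom and `q` target points at the top: a stack of `height` layers, each of which has one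
elementary piece (cup, cap or crossing). There are `width ℓ` points at level `ℓ`, and `up` is
the orientation of the tangle (`true` for upwards). Every plane diagram is of this
form up to plane isotopy. -/
structure TangleDiagram (p q : ℕ) where
  height : ℕ
  width : Fin (height + 1) → ℕ
  layer : Fin height → Layer
  fits : ∀ l, (layer l).Fits (width l.castSucc) (width l.succ)
  width_source : width 0 = p
  width_target : width (Fin.last height) = q
  up : ∀ l : Fin (height + 1), Fin (width l) → Bool
  /-- The direction is preserved along strands that join bottom and top, and reversed at turns. -/
  oriented : ∀ (l : Fin height) (x y : ℕ ⊕ ℕ), (layer l).FullStrand x y →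
    ∀ (P Q : Σ l : Fin (height + 1), Fin (width l)),
      Sum.elim (fun i => P.1 = l.castSucc ∧ P.2.1 = i) (fun i => P.1 = l.succ ∧ P.2.1 = i) x →
      Sum.elim (fun i => Q.1 = l.castSucc ∧ Q.2.1 = i) (fun i => Q.1 = l.succ ∧ Q.2.1 = i) y →
      (up P.1 P.2 = up Q.1 Q.2 ↔ x.isLeft ≠ y.isLeft)

namespace TangleDiagram

variable {p q : ℕ} (T : TangleDiagram p q)

/-- The points of the diagram at all levels: the point `⟨l, i⟩` is the `i`-th one from the
left at level `l`, starting with `0`. -/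
abbrev Point : Type := Σ l : Fin (T.height + 1), Fin (T.width l)

/-- `P` is the end `x` of the layer `l`. -/
def IsEnd (l : Fin T.height) (x : ℕ ⊕ ℕ) (P : T.Point) : Prop :=
  Sum.elim (fun i => P.1 = l.castSucc ∧ P.2.1 = i) (fun i => P.1 = l.succ ∧ P.2.1 = i) x

/-- The crossings of the diagram. -/
abbrev Crossing : Type := {l : Fin T.height // (T.layer l).IsCrossing}

/-- Two points are joined by a strand in one of the layers of the smoothing `D_α`. -/
def Joined (α : Finset T.Crossing) (P Q : T.Point) : Prop :=
  ∃ (l : Fin T.height) (x y : ℕ ⊕ ℕ),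
    (T.layer l).SmoothStrand (∃ h : (T.layer l).IsCrossing, (⟨l, h⟩ : T.Crossing) ∈ α) x y ∧
      T.IsEnd l x P ∧ T.IsEnd l y Q

/-- The components of the smoothing `D_α`. -/
abbrev Component (α : Finset T.Crossing) : Type := Quot (T.Joined α)

/-- The boundary points of the diagram, at the source or the target. -/
def boundary : Fin p ⊕ Fin q → T.Point
  | .inl i => ⟨0, i.cast T.width_source.symm⟩
  | .inr i => ⟨Fin.last T.height, i.cast T.width_target.symm⟩

/-- The components of `D_α` as an object of the category of open-closed cobordisms:
a component is an arc if and only if it contains a boundary point. -/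
noncomputable def family (α : Finset T.Crossing) : Ob :=
  open Classical in ⟨T.Component α, fun c => decide (∃ b, Quot.mk _ (T.boundary b) = c)⟩

/-- The direction (`True` for upwards) at the `i`-th point of any level, given by the orientation
of the smoothings that is induced by the checkerboard colouring `ε`. The region to the left of the
`i`-th point is shaded if and only if `(-1)^i = ε` (for `ε = 1` the leftmost region is shaded),
and the smoothings are oriented counter-clockwise around the shaded regions. -/
def ShadedUp (ε : ℤˣ) (i : ℕ) : Prop := (-1) ^ i = ε

/-- The `-`-boundary points, i.e. the tails of the oriented arcs of the smoothings. -/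
def Tail (_T : TangleDiagram p q) (ε : ℤˣ) : Type :=
  {b : Fin p ⊕ Fin q // Sum.elim (fun i => ShadedUp ε i.1) (fun i => ¬ ShadedUp ε i.1) b}

/-- The `+`-boundary points, i.e. the heads of the oriented arcs of the smoothings. -/
def Head (_T : TangleDiagram p q) (ε : ℤˣ) : Type :=
  {b : Fin p ⊕ Fin q // Sum.elim (fun i => ¬ ShadedUp ε i.1) (fun i => ShadedUp ε i.1) b}

theorem crossing_fits (j : T.Crossing) :
    (T.layer j.1).pos + 2 ≤ T.width j.1.castSucc ∧ T.width j.1.succ = T.width j.1.castSucc := by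
  obtain ⟨l, b, hb⟩ := j
  have h := T.fits l
  rw [Layer.Fits, hb] at h
  exact h

/-- The bottom end of the crossing `j` on the left (`d = 0`) or right (`d = 1`). -/
def bottom (j : T.Crossing) (d : Fin 2) : T.Point :=
  ⟨j.1.castSucc, (T.layer j.1).pos + d.1, by have := T.crossing_fits j; omega⟩

/-- The top end of the crossing `j` on the left (`d = 0`) or right (`d = 1`). -/
def top (j : T.Crossing) (d : Fin 2) : T.Point :=
  ⟨j.1.succ, (T.layer j.1).pos + d.1, by have := T.crossing_fits j; omega⟩

open Classical in
/-- One of the two ends at which the smoothings run into the crossing `j`. -/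
noncomputable def in₁ (ε : ℤˣ) (j : T.Crossing) : T.Point :=
  if ShadedUp ε (T.layer j.1).pos then T.bottom j 0 else T.bottom j 1

open Classical in
/-- The other one of the two ends at which the smoothings run into the crossing `j`. -/
noncomputable def in₂ (ε : ℤˣ) (j : T.Crossing) : T.Point :=
  if ShadedUp ε (T.layer j.1).pos then T.top j 1 else T.top j 0

end TangleDiagram

namespace TangleDiagram

variable {p q : ℕ} (T : TangleDiagram p q)

/-- The four ends of a crossing. -/
def corners (j : T.Crossing) : Set T.Point := {P | ∃ d, P = T.bottom j d ∨ P = T.top j d}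

theorem bottom_isEnd (j : T.Crossing) (d : Fin 2) :
    T.IsEnd j.1 (.inl ((T.layer j.1).pos + d.1)) (T.bottom j d) := ⟨rfl, rfl⟩

theorem top_isEnd (j : T.Crossing) (d : Fin 2) :
    T.IsEnd j.1 (.inr ((T.layer j.1).pos + d.1)) (T.top j d) := ⟨rfl, rfl⟩

theorem eq_bottom {j : T.Crossing} {P : T.Point} (d : Fin 2)
    (h : T.IsEnd j.1 (.inl ((T.layer j.1).pos + d.1)) P) : P = T.bottom j d := by
  obtain ⟨l, i⟩ := P
  obtain ⟨h₁, h₂⟩ := h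
  dsimp only at h₁ h₂
  subst h₁
  exact congrArg (Sigma.mk _) (Fin.ext h₂)

theorem eq_top {j : T.Crossing} {P : T.Point} (d : Fin 2)
    (h : T.IsEnd j.1 (.inr ((T.layer j.1).pos + d.1)) P) : P = T.top j d := by
  obtain ⟨l, i⟩ := P
  obtain ⟨h₁, h₂⟩ := h
  dsimp only at h₁ h₂
  subst h₁
  exact congrArg (Sigma.mk _) (Fin.ext h₂)

/-- Two smoothings that agree away from the crossing `j` have the same strands away from it. -/
theorem joined_of_agree {α β : Finset T.Crossing} {j : T.Crossing}
    (h : ∀ i, i ≠ j → (i ∈ α ↔ i ∈ β)) {P Q : T.Point} (hPQ : T.Joined α P Q) :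
    T.Joined β P Q ∨ (P ∈ T.corners j ∧ Q ∈ T.corners j) := by
  obtain ⟨l, x, y, hs, hP, hQ⟩ := hPQ
  by_cases hl : l = j.1
  · subst hl
    cases hs with
    | strand h => exact Or.inl ⟨_, _, _, .strand h, hP, hQ⟩
    | vertical_left b hL h =>
      exact Or.inr ⟨⟨0, Or.inl (T.eq_bottom 0 hP)⟩, ⟨0, Or.inr (T.eq_top 0 hQ)⟩⟩
    | vertical_right b hL h =>
      exact Or.inr ⟨⟨1, Or.inl (T.eq_bottom 1 hP)⟩, ⟨1, Or.inr (T.eq_top 1 hQ)⟩⟩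
    | horizontal_bottom b hL h =>
      exact Or.inr ⟨⟨0, Or.inl (T.eq_bottom 0 hP)⟩, ⟨1, Or.inl (T.eq_bottom 1 hQ)⟩⟩
    | horizontal_top b hL h =>
      exact Or.inr ⟨⟨0, Or.inr (T.eq_top 0 hP)⟩, ⟨1, Or.inr (T.eq_top 1 hQ)⟩⟩
  · have e : (∃ h : (T.layer l).IsCrossing, (⟨l, h⟩ : T.Crossing) ∈ α) ↔
        (∃ h : (T.layer l).IsCrossing, (⟨l, h⟩ : T.Crossing) ∈ β) :=
      exists_congr fun hc => h ⟨l, hc⟩ (fun h' => hl (congrArg Subtype.val h'))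
    exact Or.inl ⟨l, x, y, propext e ▸ hs, hP, hQ⟩

/-- Each end of a crossing lies on the same component as one of the two incoming ends. -/
theorem corner_mem (ε : ℤˣ) (α : Finset T.Crossing) (j : T.Crossing) :
    ∀ P ∈ T.corners j, Quot.mk (T.Joined α) P = Quot.mk _ (T.in₁ ε j) ∨
      Quot.mk (T.Joined α) P = Quot.mk _ (T.in₂ ε j) := by
  obtain ⟨b, hb⟩ := j.2
  have key : (Quot.mk (T.Joined α) (T.bottom j 0) = Quot.mk _ (T.top j 0) ∧
      Quot.mk (T.Joined α) (T.bottom j 1) = Quot.mk _ (T.top j 1)) ∨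
      (Quot.mk (T.Joined α) (T.bottom j 0) = Quot.mk _ (T.bottom j 1) ∧
      Quot.mk (T.Joined α) (T.top j 0) = Quot.mk _ (T.top j 1)) := by
    by_cases hv : b = true ↔ ¬ ∃ h : (T.layer j.1).IsCrossing, (⟨j.1, h⟩ : T.Crossing) ∈ α
    · exact Or.inl ⟨Quot.sound ⟨j.1, _, _, .vertical_left b hb hv, T.bottom_isEnd j 0,
        T.top_isEnd j 0⟩, Quot.sound ⟨j.1, _, _, .vertical_right b hb hv, T.bottom_isEnd j 1,
        T.top_isEnd j 1⟩⟩
    · have hv' : b = true ↔ ∃ h : (T.layer j.1).IsCrossing, (⟨j.1, h⟩ : T.Crossing) ∈ α := by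
        tauto
      exact Or.inr ⟨Quot.sound ⟨j.1, _, _, .horizontal_bottom b hb hv', T.bottom_isEnd j 0,
        T.bottom_isEnd j 1⟩, Quot.sound ⟨j.1, _, _, .horizontal_top b hb hv', T.top_isEnd j 0,
        T.top_isEnd j 1⟩⟩
  rintro P ⟨d, rfl | rfl⟩ <;> fin_cases d <;>
    by_cases hu : ShadedUp ε (T.layer j.1).pos <;>
    simp only [in₁, in₂, hu, if_true, if_false, Fin.zero_eta, Fin.mk_one, Fin.isValue] <;>
    rcases key with ⟨h₁, h₂⟩ | ⟨h₁, h₂⟩ <;>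
    simp only [h₁, h₂, true_or, or_true]

open Classical in
/-- The smoothings `D_α` and `D_{α ⊔ {j}}` differ only at the crossing `j`. -/
theorem localChange (ε : ℤˣ) (α : Finset T.Crossing) (j : T.Crossing) :
    LocalChange (T.Joined α) (T.Joined (insert j α)) (T.in₁ ε j) (T.in₂ ε j) (T.corners j) where
  fwd _ _ h := T.joined_of_agree (fun i hi => by simp [hi]) h
  bwd _ _ h := T.joined_of_agree (fun i hi => by simp [hi]) h
  src := T.corner_mem ε α j
  tgt := T.corner_mem ε (insert j α) j

/-- A numbering of the components of all smoothings. -/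
structure Numbering where
  count : Finset T.Crossing → ℕ
  number : ∀ α, Fin (count α) ≃ T.Component α

variable {T}

open Classical in
/-- The cylinders over the components away from the crossing `j`. -/
noncomputable def awayIso (ε : ℤˣ) (α : Finset T.Crossing) (j : T.Crossing) :
    away (T.family α) (Quot.mk _ (T.in₁ ε j)) (Quot.mk _ (T.in₂ ε j)) ≅
      away (T.family (insert j α)) (Quot.mk _ (T.in₁ ε j)) (Quot.mk _ (T.in₂ ε j)) :=
  relabelIso (T.localChange ε α j).equiv (fun c => by
    refine decide_eq_decide.2 ⟨?_, ?_⟩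
    · rintro ⟨b, hb⟩
      refine ⟨b, ?_⟩
      have h := (T.localChange ε α j).symm.map_mk ((T.localChange ε α j).equiv c) hb
      exact h.trans (congrArg Subtype.val ((T.localChange ε α j).equiv.left_inv c))
    · rintro ⟨b, hb⟩
      exact ⟨b, (T.localChange ε α j).map_mk c hb⟩)

/-- The sequence `m^(α)` in `{0,1}` of the kinds of the numbered components of `D_α`. -/
noncomputable def vertex (N : T.Numbering) (α : Finset T.Crossing) : Ob :=
  ⟨Fin (N.count α), fun i => (T.family α).isArc (N.number α i)⟩

/-- The numbering as an isomorphism. -/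
noncomputable def numberIso (N : T.Numbering) (α : Finset T.Crossing) :
    vertex N α ≅ T.family α :=
  relabelIso (N.number α) (fun _ => rfl)

open Classical in
/-- The cobordism `S_(α,j) : D_α → D_{α ⊔ {j}}` which is a saddle near the crossing `j` and a
cylinder elsewhere. -/
noncomputable def edge (N : T.Numbering) (ε : ℤˣ) (α : Finset T.Crossing) (j : T.Crossing) :
    vertex N α ⟶ vertex N (insert j α) :=
  (numberIso N α).hom ≫
    saddle (T.family α) (T.family (insert j α)) (Quot.mk _ (T.in₁ ε j)) (Quot.mk _ (T.in₂ ε j))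
      (Quot.mk _ (T.in₁ ε j)) (Quot.mk _ (T.in₂ ε j)) (awayIso ε α j) ≫
    (numberIso N (insert j α)).inv

/-- The number of the component of `D_α` that contains the boundary point `b`. -/
noncomputable def position (N : T.Numbering) (α : Finset T.Crossing) (b : Fin p ⊕ Fin q) :
    (vertex N α).ι :=
  (N.number α).symm (Quot.mk _ (T.boundary b))

theorem position_isArc (N : T.Numbering) (α : Finset T.Crossing) (b : Fin p ⊕ Fin q) :
    (vertex N α).isArc (position N α b) = true := by
  classical
  exact decide_eq_true ⟨b, ((N.number α).apply_symm_apply _).symm⟩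

/-- A crossing is positive if `(o, u)` is a positively oriented basis of the plane, where `o` and
`u` are the directions of the upper and of the lower strand, and negative otherwise. The strand
through the bottom left end is the upper one for `cross true`, so the crossing is positive if and
only if either this strand is the upper one and both strands have the same vertical direction, or it
is the lower one and they have opposite directions. -/
def IsNegative (T : TangleDiagram p q) (j : T.Crossing) : Prop :=
  ∃ b, (T.layer j.1).kind = .cross b ∧
    (b = true ↔ T.up (T.bottom j 0).1 (T.bottom j 0).2 ≠ T.up (T.bottom j 1).1 (T.bottom j 1).2)

/-- The number `n_-` of negative crossings. -/
noncomputable def negatives (T : TangleDiagram p q) : ℕ :=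
  Nat.card {j : T.Crossing // T.IsNegative j}

variable {k : Type u} [Field k] {n : ℕ}

/-- The subsets `α` of the crossings that contribute to degree `i`, i.e. `|α| = i + n_-`. -/
abbrev Height (T : TangleDiagram p q) (i : ℤ) : Type :=
  {α : Finset T.Crossing // (α.card : ℤ) = i + T.negatives}

/-- The term of degree `i` of the tangle complex. -/
abbrev term (N : T.Numbering) (Z : OpenClosedTQFT k) (i : ℤ) : Type u :=
  ⨁ α : T.Height i, Z.functor.obj (vertex N α.1)

open Classical in
/-- The differential of the tangle complex. -/
noncomputable def d (ν : T.Crossing ≃ Fin n) (N : T.Numbering) (ε : ℤˣ) (Z : OpenClosedTQFT k)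
    (i : ℤ) : term N Z i →ₗ[k] term N Z (i + 1) :=
  DirectSum.toModule k _ _ fun α =>
    ((-1 : k) ^ T.negatives) •
    ∑ j : {j : T.Crossing // j ∉ α.1},
      ((-1 : k) ^ (α.1.filter fun l => ν l < ν j.1).card) •
        (DirectSum.lof k (T.Height (i + 1)) (fun β => Z.functor.obj (vertex N β.1))
            ⟨insert j.1 α.1, by
              have h := α.2
              rw [Finset.card_insert_of_notMem j.2]
              push_cast
              omega⟩ ∘ₗ
          (Z.functor.map (edge N ε α.1 j.1)).hom)

end TangleDiagram

/-! Everything reduces to a single saddle. The signs of the cube give d² = 0 as soon as saddles at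
two different crossings commute (`sadTo_comm`). The differentials are bimodule maps as soon as each
saddle commutes with left multiplication at every tail and with right multiplication at every head
(`sadAt_lComm`, `sadAt_rComm`). No classification of open-closed surfaces is used; the commutations
are computed in the two Frobenius algebras.

Combinatorics. Orient the smoothings by the colouring. Changing the smoothing of a crossing
exchanges the successors of the two points that run into it (`Surgery`). Such an exchange merges two
components, not both arcs; or splits one component into two, not both arcs; or takes place between
two different arcs, which then keep their tails and exchange their heads. The map `headOf` from
tails to heads is a bijection, so there are equally many of both. It is unchanged by mergers and
splittings and is composed with a transposition by an exchange.

Algebra. The identities of the copairing Δ(1) (`sum_swap`, `sum_outer`, `sum_inner`) show that a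
saddle carries left multiplications at tails, right multiplications at heads, and multiplications by
the circle algebra at any point. The tensor product of all units generates each space under left
multiplications (`eq_top_of_one_mem`), so two composites of saddles agree if they agree on it. A
merger sends the unit to the unit, a splitting to H(1) and an exchange to D(1), where H and D let
the copairings of the circle and of the arc act on the two components involved.

It remains to compare products of two such operators (`sadTo_one_comm`). The H commute with all H
and all D, the product H_{zx} D_{xy} equals H_{zy} D_{xy}, and D_{xy}² = H_{xy} is the Cardy
condition (`dOp_mul_self`). The D for different arcs satisfy the relations of transpositions that
are needed for `TranspositionProduct.mul_eq_mul`. Both orders of the saddles induce the same map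
from tails to heads, hence the same product of transpositions, which determines the product of the D
unless it is the identity. The count of components excludes most combinations of types, and the
others follow by locating the components that take part.

Actions. Different tails lie on different arcs, and so do different heads; hence the actions of the
factors commute and extend to the tensor power by `PiTensorProduct.commLift`. -/

/-! ### Elements of the values of an open-closed TQFT -/

namespace OpenClosedTQFT

variable {k : Type u} [Field k] (Z : OpenClosedTQFT k)

/-- The vector space of a family of components. -/
abbrev val (X : Ob) : Type u := Z.functor.obj X

/-- The linear map of a cobordism. -/
noncomputable def map {X Y : Ob} (f : X ⟶ Y) : Z.val X →ₗ[k] Z.val Y := (Z.functor.map f).hom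

/-- The product of elements over a disjoint union. -/
noncomputable def mm (X Y : Ob) : Z.val X →ₗ[k] Z.val Y →ₗ[k] Z.val (union X Y) :=
  (TensorProduct.mk k _ _).compr₂ (Functor.LaxMonoidal.μ Z.functor X Y).hom

/-- The element `1` over the empty family. -/
noncomputable def vac : Z.val empty := (Functor.LaxMonoidal.ε Z.functor).hom (1 : k)

theorem map_comp {X Y W : Ob} (f : X ⟶ Y) (g : Y ⟶ W) (x : Z.val X) :
    Z.map (f ≫ g) x = Z.map g (Z.map f x) := by
  simp [map]

theorem map_id {X : Ob} (x : Z.val X) : Z.map (𝟙 X) x = x := by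
  simp [map]

theorem map_tensor {X Y X' Y' : Ob} (f : X ⟶ Y) (g : X' ⟶ Y') (x : Z.val X) (y : Z.val X') :
    Z.map (tensor f g) (Z.mm X X' x y) = Z.mm Y Y' (Z.map f x) (Z.map g y) := by
  have h := Functor.LaxMonoidal.μ_natural Z.functor f g
  exact (LinearMap.congr_fun (ModuleCat.hom_ext_iff.mp h) (x ⊗ₜ y)).symm

theorem map_sumAssoc {X Y W : Ob} (h) (x : Z.val X) (y : Z.val Y) (w : Z.val W) :
    Z.map (relabel (X := union (union X Y) W) (Y := union X (union Y W))
      (Equiv.sumAssoc X.ι Y.ι W.ι) h) (Z.mm _ _ (Z.mm _ _ x y) w) =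
        Z.mm _ _ x (Z.mm _ _ y w) := by
  have h := Functor.LaxMonoidal.associativity Z.functor X Y W
  exact LinearMap.congr_fun (ModuleCat.hom_ext_iff.mp h) ((x ⊗ₜ y) ⊗ₜ w)

theorem map_sumComm {X Y : Ob} (h) (x : Z.val X) (y : Z.val Y) :
    Z.map (relabel (X := union X Y) (Y := union Y X) (Equiv.sumComm X.ι Y.ι) h)
      (Z.mm _ _ x y) = Z.mm _ _ y x := by
  have h := Functor.LaxBraided.braided (F := Z.functor) X Y
  exact LinearMap.congr_fun (ModuleCat.hom_ext_iff.mp h) (x ⊗ₜ y)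

theorem map_emptySum {X : Ob} (h) (x : Z.val X) :
    Z.map (relabel (X := union empty X) (Y := X) (Equiv.emptySum Empty X.ι) h)
      (Z.mm _ _ Z.vac x) = x := by
  have h := Functor.LaxMonoidal.left_unitality Z.functor X
  refine (LinearMap.congr_fun (ModuleCat.hom_ext_iff.mp h) ((1 : k) ⊗ₜ x)).symm.trans ?_
  exact one_smul k x

theorem mu_mu_inv {X Y : Ob} (z : Z.val (union X Y)) :
    (Functor.LaxMonoidal.μ Z.functor X Y).hom
      ((Functor.Monoidal.μIso Z.functor X Y).inv.hom z) = z :=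
  LinearMap.congr_fun (ModuleCat.hom_ext_iff.mp (Functor.Monoidal.μIso Z.functor X Y).inv_hom_id) z

theorem mu_inv_mm {X Y : Ob} (x : Z.val X) (y : Z.val Y) :
    (Functor.Monoidal.μIso Z.functor X Y).inv.hom (Z.mm X Y x y) = x ⊗ₜ[k] y :=
  LinearMap.congr_fun (ModuleCat.hom_ext_iff.mp (Functor.Monoidal.μIso Z.functor X Y).hom_inv_id)
    (x ⊗ₜ[k] y)

/-- Invertibility of the monoidal structure map makes the products span the value of a disjoint
union. -/
theorem mm_ext {X Y : Ob} {E : Type*} [AddCommMonoid E] [Module k E]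
    {f g : Z.val (union X Y) →ₗ[k] E}
    (h : ∀ x y, f (Z.mm X Y x y) = g (Z.mm X Y x y)) : f = g := by
  have H : f ∘ₗ (Functor.LaxMonoidal.μ Z.functor X Y).hom =
      g ∘ₗ (Functor.LaxMonoidal.μ Z.functor X Y).hom := TensorProduct.ext' h
  ext z
  have := LinearMap.congr_fun H ((Functor.Monoidal.μIso Z.functor X Y).inv.hom z)
  simp only [LinearMap.comp_apply] at this
  rwa [mu_mu_inv] at this

theorem exists_sum_mm {X Y : Ob} (z : Z.val (union X Y)) :
    ∃ (n : ℕ) (x : Fin n → Z.val X) (y : Fin n → Z.val Y), z = ∑ i, Z.mm X Y (x i) (y i) := by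
  obtain ⟨n, x, y, h⟩ := TensorProduct.exists_sum_tmul_eq
    ((Functor.Monoidal.μIso Z.functor X Y).inv.hom z)
  refine ⟨n, x, y, ?_⟩
  rw [← mu_mu_inv Z z, h, map_sum]
  rfl

/-- The disjoint union of two linear maps. -/
noncomputable def tm {X Y X' Y' : Ob} (f : Z.val X →ₗ[k] Z.val X') (g : Z.val Y →ₗ[k] Z.val Y') :
    Z.val (union X Y) →ₗ[k] Z.val (union X' Y') :=
  (Functor.LaxMonoidal.μ Z.functor X' Y').hom ∘ₗ TensorProduct.map f g ∘ₗ
    (Functor.Monoidal.μIso Z.functor X Y).inv.hom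

@[simp]
theorem tm_mm {X Y X' Y' : Ob} (f : Z.val X →ₗ[k] Z.val X') (g : Z.val Y →ₗ[k] Z.val Y')
    (x : Z.val X) (y : Z.val Y) : Z.tm f g (Z.mm X Y x y) = Z.mm X' Y' (f x) (g y) := by
  rw [tm, LinearMap.comp_apply, LinearMap.comp_apply, mu_inv_mm]
  rfl

/-- The isomorphism of a relabelling. -/
noncomputable def rel {X Y : Ob} (e : X.ι ≃ Y.ι) (h : ∀ i, Y.isArc (e i) = X.isArc i) :
    Z.val X →ₗ[k] Z.val Y := Z.map (relabel e h)

theorem rel_rel {X Y W : Ob} (e : X.ι ≃ Y.ι) (h : ∀ i, Y.isArc (e i) = X.isArc i)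
    (e' : Y.ι ≃ W.ι) (h' : ∀ i, W.isArc (e' i) = Y.isArc i) (x : Z.val X) :
    Z.rel e' h' (Z.rel e h x) = Z.rel (e.trans e') (trans_isArc e e' h h') x := by
  rw [rel, rel, rel, ← map_comp, relabel_comp]

theorem rel_congr {X Y : Ob} {e e' : X.ι ≃ Y.ι} (he : ∀ i, e i = e' i)
    (h : ∀ i, Y.isArc (e i) = X.isArc i) (x : Z.val X) :
    Z.rel e h x = Z.rel e' (fun i => he i ▸ h i) x := by
  obtain rfl : e = e' := Equiv.ext he
  rfl

theorem rel_of_eq {X : Ob} {e : X.ι ≃ X.ι} (he : ∀ i, e i = i)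
    (h : ∀ i, X.isArc (e i) = X.isArc i) (x : Z.val X) : Z.rel e h x = x := by
  obtain rfl : e = Equiv.refl _ := Equiv.ext he
  exact map_id Z x

theorem symm_isArc {X Y : Ob} (e : X.ι ≃ Y.ι) (h : ∀ i, Y.isArc (e i) = X.isArc i) :
    ∀ i, X.isArc (e.symm i) = Y.isArc i := fun i => by
  rw [← h, e.apply_symm_apply]

theorem rel_symm_rel {X Y : Ob} (e : X.ι ≃ Y.ι) (h h') (x : Z.val X) :
    Z.rel e.symm h' (Z.rel e h x) = x := by
  rw [rel_rel]
  exact rel_of_eq Z (fun i => e.symm_apply_apply i) _ x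

theorem rel_rel_symm {X Y : Ob} (e : X.ι ≃ Y.ι) (h h') (y : Z.val Y) :
    Z.rel e h (Z.rel e.symm h' y) = y := by
  rw [rel_rel]
  exact rel_of_eq Z (fun i => e.apply_symm_apply i) _ y

theorem rel_surjective {X Y : Ob} (e : X.ι ≃ Y.ι) (h : ∀ i, Y.isArc (e i) = X.isArc i) :
    Function.Surjective (Z.rel e h) :=
  fun y => ⟨_, rel_rel_symm Z e h (symm_isArc e h) y⟩

theorem mm_rel {X Y X' Y' : Ob} (e : X.ι ≃ Y.ι) (h : ∀ i, Y.isArc (e i) = X.isArc i)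
    (e' : X'.ι ≃ Y'.ι) (h' : ∀ i, Y'.isArc (e' i) = X'.isArc i) (x : Z.val X) (x' : Z.val X') :
    Z.mm Y Y' (Z.rel e h x) (Z.rel e' h' x') =
      Z.rel (X := union X X') (Y := union Y Y') (Equiv.sumCongr e e')
        (sumCongr_isArc e e' h h') (Z.mm X X' x x') := by
  rw [rel, rel, rel, ← relabel_tensor, map_tensor]

theorem mm_rel_right {X X' Y' : Ob} (e' : X'.ι ≃ Y'.ι) (h' : ∀ i, Y'.isArc (e' i) = X'.isArc i)
    (x : Z.val X) (x' : Z.val X') :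
    Z.mm X Y' x (Z.rel e' h' x') =
      Z.rel (X := union X X') (Y := union X Y') (Equiv.sumCongr (Equiv.refl _) e')
        (sumCongr_isArc _ e' (refl_isArc X) h') (Z.mm X X' x x') := by
  rw [← mm_rel Z _ (refl_isArc X) _ h', rel_of_eq Z (fun _ => rfl) _ x]

theorem mm_rel_left {X Y X' : Ob} (e : X.ι ≃ Y.ι) (h : ∀ i, Y.isArc (e i) = X.isArc i)
    (x : Z.val X) (x' : Z.val X') :
    Z.mm Y X' (Z.rel e h x) x' =
      Z.rel (X := union X X') (Y := union Y X') (Equiv.sumCongr e (Equiv.refl _))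
        (sumCongr_isArc e _ h (refl_isArc X')) (Z.mm X X' x x') := by
  rw [← mm_rel Z _ h _ (refl_isArc X'), rel_of_eq Z (fun _ => rfl) _ x']

/-- The family of the components other than `x`. -/
abbrev rest (X : Ob) (x : X.ι) : Ob := ⟨{z // z ≠ x}, fun z => X.isArc z.1⟩

theorem singleEquiv_isArc (X : Ob) (x : X.ι) (s : Bool) (h : X.isArc x = s) :
    ∀ i, X.isArc (singleEquiv x i) = (union (single s) (rest X x)).isArc i := by
  rintro (i | i)
  exacts [h, rfl]

/-- The operator `φ` on the tensor factor of the component `x`. -/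
noncomputable def opAt (X : Ob) (x : X.ι) (s : Bool) (h : X.isArc x = s)
    (φ : Module.End k (Z.val (single s))) : Module.End k (Z.val X) :=
  Z.rel (X := union (single s) (rest X x)) (singleEquiv x) (singleEquiv_isArc X x s h) ∘ₗ
    Z.tm φ LinearMap.id ∘ₗ Z.rel (Y := union (single s) (rest X x)) (singleEquiv x).symm
      (symm_isArc (X := union (single s) (rest X x)) _ (singleEquiv_isArc X x s h))

/-- A family with one component split off. -/
structure Split (X : Ob) (x : X.ι) (s : Bool) (W : Ob) where
  e : Unit ⊕ W.ι ≃ X.ι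
  h : ∀ i, X.isArc (e i) = (union (single s) W).isArc i
  hx : e (Sum.inl ()) = x

namespace Split

variable {Z} {X : Ob} {x : X.ι} {s : Bool} {W : Ob} (E : Split X x s W)

/-- The product of an element at the split component and an element over the other components. -/
noncomputable def ins (Z : OpenClosedTQFT k) (a : Z.val (single s)) (w : Z.val W) : Z.val X :=
  Z.rel (X := union (single s) W) E.e E.h (Z.mm _ _ a w)

/-- The other components. -/
noncomputable def others : W.ι ≃ {z // z ≠ x} :=
  Equiv.ofBijective (fun w => ⟨E.e (Sum.inr w), fun h => by
    simpa using E.e.injective (h.trans E.hx.symm)⟩) <| by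
    constructor
    · intro a b h
      simpa using E.e.injective (congrArg Subtype.val h)
    · rintro ⟨z, hz⟩
      obtain ⟨i | i, hi⟩ := E.e.surjective z
      · exact absurd (hi.symm.trans E.hx) hz
      · exact ⟨i, Subtype.ext hi⟩

theorem others_isArc (i : W.ι) : (rest X x).isArc (E.others i) = W.isArc i := E.h (Sum.inr i)

theorem isArc_eq (E : Split X x s W) : X.isArc x = s := by
  rw [← E.hx]; exact E.h (Sum.inl ())

/-- Two ways to split off `x` differ only by the bijection `others` between the remaining
components. -/
theorem ins_eq (a : Z.val (single s)) (w : Z.val W) :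
    E.ins Z a w = Z.rel (X := union (single s) (rest X x)) (singleEquiv x)
      (singleEquiv_isArc X x s E.isArc_eq)
        (Z.mm _ _ a (Z.rel (Y := rest X x) E.others E.others_isArc w)) := by
  rw [mm_rel_right, rel_rel, ins]
  exact rel_congr Z (by rintro (i | i); exacts [E.hx, rfl]) _ _

/-- Independence of the choice of splitting: `opAt` is defined with the canonical one but may be
computed with any other. All later properties of `opAt` come from a suitable splitting. -/
theorem opAt_ins (h : X.isArc x = s) (φ : Module.End k (Z.val (single s))) (a : Z.val (single s))
    (w : Z.val W) : Z.opAt X x s h φ (E.ins Z a w) = E.ins Z (φ a) w := by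
  rw [ins_eq, ins_eq, opAt, LinearMap.comp_apply, LinearMap.comp_apply, rel_symm_rel, tm_mm]
  rfl

theorem ext_ins {F : Type*} [AddCommMonoid F] [Module k F] {f g : Z.val X →ₗ[k] F}
    (h : ∀ a w, f (E.ins Z a w) = g (E.ins Z a w)) : f = g := by
  have := mm_ext Z (f := f ∘ₗ Z.rel (X := union (single s) W) E.e E.h) (g := g ∘ₗ Z.rel (X := union (single s) W) E.e E.h) h
  ext z
  obtain ⟨z, rfl⟩ := rel_surjective Z (X := union (single s) W) E.e E.h z
  exact LinearMap.congr_fun this z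

end Split

/-- The canonical way of splitting off a component. -/
noncomputable def Split.canonical (X : Ob) (x : X.ι) (s : Bool) (h : X.isArc x = s) :
    Split X x s (rest X x) :=
  ⟨singleEquiv x, singleEquiv_isArc X x s h, rfl⟩

/-! ### Compatibility of `opAt` with relabelling and disjoint union -/

section naturality

variable (s : Bool) (φ : Module.End k (Z.val (single s)))

/-- A splitting of `X` at `x`, composed with `e`, is a splitting of `Y` at `y`; evaluate each side
with its own splitting. -/
theorem opAt_rel {X Y : Ob} (e : X.ι ≃ Y.ι) (he : ∀ i, Y.isArc (e i) = X.isArc i) {x : X.ι} {y : Y.ι}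
    (hy : e x = y) (h : X.isArc x = s) (h' : Y.isArc y = s) (v : Z.val X) :
    Z.opAt Y y s h' φ (Z.rel e he v) = Z.rel e he (Z.opAt X x s h φ v) := by
  subst hy
  let E := Split.canonical X x s h
  let E' : Split Y (e x) s (rest X x) := ⟨E.e.trans e, fun i => (he _).trans (E.h i), rfl⟩
  have key : ∀ a w, Z.rel e he (E.ins Z a w) = E'.ins Z a w := fun a w => rel_rel Z _ _ _ _ _
  refine LinearMap.congr_fun (E.ext_ins (f := Z.opAt Y _ s h' φ ∘ₗ Z.rel e he)
    (g := Z.rel e he ∘ₗ Z.opAt X x s h φ) fun a w => ?_) v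
  rw [LinearMap.comp_apply, LinearMap.comp_apply, key, E.opAt_ins, E'.opAt_ins, key]

/-- A splitting of `X` extends to the disjoint union by associativity, with `Y` added to the other
components. -/
theorem opAt_inl {X Y : Ob} {x : X.ι} (h : X.isArc x = s)
    (h' : (union X Y).isArc (Sum.inl x) = s) (v : Z.val X) (w : Z.val Y) :
    Z.opAt (union X Y) (Sum.inl x) s h' φ (Z.mm X Y v w) = Z.mm X Y (Z.opAt X x s h φ v) w := by
  let E := Split.canonical X x s h
  let E' : Split (union X Y) (Sum.inl x) s (union (rest X x) Y) :=
    ⟨(Equiv.sumAssoc _ _ _).symm.trans (Equiv.sumCongr E.e (Equiv.refl _)), by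
      rintro (i | i | i)
      exacts [E.h (Sum.inl i), E.h (Sum.inr i), rfl], rfl⟩
  have key : ∀ a v, Z.mm X Y (E.ins Z a v) w = E'.ins Z a (Z.mm _ _ v w) := fun a v => by
    rw [Split.ins, mm_rel_left, Split.ins, ← map_sumAssoc Z (by rintro ((i | i) | i) <;> rfl)]
    refine Eq.trans ?_ (rel_rel Z _ _ _ _ _).symm
    exact rel_congr Z (by rintro ((i | i) | i) <;> rfl) _ _
  refine LinearMap.congr_fun (E.ext_ins
    (f := Z.opAt (union X Y) (Sum.inl x) s h' φ ∘ₗ (Z.mm X Y).flip w)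
    (g := (Z.mm X Y).flip w ∘ₗ Z.opAt X x s h φ) fun a v => ?_) v
  simp only [LinearMap.comp_apply, LinearMap.flip_apply]
  rw [key, E.opAt_ins, E'.opAt_ins, key]

/-- The flip reduces this to `opAt_inl`. -/
theorem opAt_inr {X Y : Ob} {y : Y.ι} (h : Y.isArc y = s)
    (h' : (union X Y).isArc (Sum.inr y) = s) (v : Z.val X) (w : Z.val Y) :
    Z.opAt (union X Y) (Sum.inr y) s h' φ (Z.mm X Y v w) = Z.mm X Y v (Z.opAt Y y s h φ w) := by
  have hc : ∀ i, (union X Y).isArc (Equiv.sumComm Y.ι X.ι i) = (union Y X).isArc i := by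
    rintro (i | i) <;> rfl
  rw [← map_sumComm Z hc, ← map_sumComm Z hc, ← opAt_inl Z s φ h (h' := h)]
  exact opAt_rel Z s φ (X := union Y X) (Y := union X Y) (x := Sum.inl y) (y := Sum.inr y)
    (Equiv.sumComm Y.ι X.ι) hc rfl _ _ _

/-- Split off the only component; the empty family that remains contributes `vac`. -/
theorem opAt_single (x : Unit) (h : (single s).isArc x = s) :
    Z.opAt (single s) x s h φ = φ := by
  let E : Split (single s) x s empty :=
    ⟨Equiv.sumEmpty Unit Empty, by rintro (i | i); exacts [rfl, i.elim], rfl⟩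
  have hc : ∀ i, (union (single s) empty).isArc (Equiv.sumComm Empty Unit i) =
    (union empty (single s)).isArc i := by rintro (i | i) <;> rfl
  have key : ∀ a, E.ins Z a Z.vac = a := fun a => by
    rw [Split.ins, ← map_sumComm Z hc]
    refine (rel_rel Z _ _ _ _ _).trans ?_
    refine Eq.trans ?_ (map_emptySum Z (X := single s) (by rintro (i | i); exacts [i.elim, rfl]) a)
    exact rel_congr Z (by rintro (i | i); exacts [i.elim, rfl]) _ _
  ext a
  conv_lhs => rw [← key a]
  rw [E.opAt_ins, key]

end naturality

/-! ### `opAt` as an algebra homomorphism, commuting at different components -/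

section algebra

variable (X : Ob) (x : X.ι) (s : Bool) (h : X.isArc x = s)

theorem opAt_mul (φ ψ : Module.End k (Z.val (single s))) :
    Z.opAt X x s h (φ * ψ) = Z.opAt X x s h φ * Z.opAt X x s h ψ := by
  let E := Split.canonical X x s h
  refine E.ext_ins fun a w => ?_
  rw [Module.End.mul_apply, E.opAt_ins, E.opAt_ins, E.opAt_ins, Module.End.mul_apply]

theorem opAt_one : Z.opAt X x s h 1 = 1 := by
  let E := Split.canonical X x s h
  refine E.ext_ins fun a w => ?_
  rw [E.opAt_ins, Module.End.one_apply, Module.End.one_apply]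

theorem opAt_add (φ ψ : Module.End k (Z.val (single s))) :
    Z.opAt X x s h (φ + ψ) = Z.opAt X x s h φ + Z.opAt X x s h ψ := by
  let E := Split.canonical X x s h
  refine E.ext_ins fun a w => ?_
  rw [LinearMap.add_apply, E.opAt_ins, E.opAt_ins, E.opAt_ins, LinearMap.add_apply]
  simp only [Split.ins, map_add, LinearMap.add_apply]

theorem opAt_smul (c : k) (φ : Module.End k (Z.val (single s))) :
    Z.opAt X x s h (c • φ) = c • Z.opAt X x s h φ := by
  let E := Split.canonical X x s h
  refine E.ext_ins fun a w => ?_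
  rw [LinearMap.smul_apply, E.opAt_ins, E.opAt_ins, LinearMap.smul_apply]
  simp only [Split.ins, map_smul, LinearMap.smul_apply]

/-- `opAt` as an algebra homomorphism. -/
noncomputable def opAtHom : Module.End k (Z.val (single s)) →ₐ[k] Module.End k (Z.val X) :=
  AlgHom.ofLinearMap ⟨⟨Z.opAt X x s h, Z.opAt_add X x s h⟩, Z.opAt_smul X x s h⟩ (Z.opAt_one X x s h)
    (Z.opAt_mul X x s h)

/-- After `x` has been split off, the operator at `y` acts on the other factor only. -/
theorem opAt_commute {x y : X.ι} (hxy : x ≠ y) (s t : Bool) (hx : X.isArc x = s)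
    (hy : X.isArc y = t) (φ : Module.End k (Z.val (single s)))
    (ψ : Module.End k (Z.val (single t))) : Commute (Z.opAt X x s hx φ) (Z.opAt X y t hy ψ) := by
  let E := Split.canonical X x s hx
  have key : ∀ a w, Z.opAt X y t hy ψ (E.ins Z a w) =
      E.ins Z a (Z.opAt (rest X x) ⟨y, hxy.symm⟩ t hy ψ w) := fun a w => by
    refine (opAt_rel Z t ψ (X := union (single s) (rest X x)) E.e E.h
      (x := Sum.inr ⟨y, hxy.symm⟩) rfl hy hy _).trans ?_
    exact congrArg _ (opAt_inr Z t ψ (X := single s) (Y := rest X x) hy _ a w)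
  refine E.ext_ins fun a w => ?_
  rw [Module.End.mul_apply, Module.End.mul_apply, key, E.opAt_ins, E.opAt_ins, key]

end algebra

end OpenClosedTQFT

/-! ### The algebras of the arc and of the circle -/

namespace OpenClosedTQFT

/-- The monoid object structure of the arc or the circle. -/
@[reducible]
def monObjSingle (s : Bool) : MonObj (single s) where
  one := cob (PreCob.unit s)
  mul := cob (PreCob.mul s)
  one_mul := cob_sound (Rel.unit_mul s)
  mul_one := cob_sound (Rel.mul_unit s)
  mul_assoc := cob_sound (Rel.mul_assoc s)

variable {k : Type u} [Field k] (Z : OpenClosedTQFT k)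

/-- The monoid object structure on the value of the arc or the circle. -/
@[reducible]
noncomputable def monObjVal (s : Bool) : MonObj (Z.functor.obj (single s)) :=
  letI := monObjSingle s
  Z.functor.monObjObj (single s)

/-- The ring structure on the vector space of the arc or the circle. -/
@[reducible]
noncomputable def ringSingle (s : Bool) : Ring (Z.functor.obj (single s)) :=
  letI := Z.monObjVal s
  ModuleCat.MonModuleEquivalenceAlgebra.MonObj.toRing (Z.functor.obj (single s))

attribute [local instance] ringSingle

/-- The algebra structure on the vector space of the arc or the circle. -/
@[reducible]
noncomputable def algebraSingle (s : Bool) : Algebra k (Z.functor.obj (single s)) :=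
  letI := Z.monObjVal s
  ModuleCat.MonModuleEquivalenceAlgebra.Algebra_of_Mon_ (Z.functor.obj (single s))

attribute [local instance] algebraSingle

theorem map_mul_mm (s : Bool) (a b : Z.val (single s)) :
    Z.map (cob (PreCob.mul s)) (Z.mm _ _ a b) = a * b := rfl

theorem map_unit_vac (s : Bool) : Z.map (cob (PreCob.unit s)) Z.vac = 1 := rfl

/-- The counit as a linear form. -/
noncomputable def counit (s : Bool) : Z.val (single s) →ₗ[k] k :=
  (Functor.Monoidal.εIso Z.functor).inv.hom ∘ₗ Z.map (cob (PreCob.counit s))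

/-- Invertibility of the unit map: the value of the empty family is spanned by `vac`. -/
theorem eps_inv (v : Z.val empty) :
    ((Functor.Monoidal.εIso Z.functor).inv.hom v : k) • Z.vac = v := by
  have h := LinearMap.congr_fun (ModuleCat.hom_ext_iff.mp
    (Functor.Monoidal.εIso Z.functor).inv_hom_id) v
  refine Eq.trans ?_ h
  have := (Functor.LaxMonoidal.ε Z.functor).hom.map_smul
    ((Functor.Monoidal.εIso Z.functor).inv.hom v : k) (1 : k)
  rw [smul_eq_mul, mul_one] at this
  exact this.symm

theorem map_counit (s : Bool) (a : Z.val (single s)) :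
    Z.map (cob (PreCob.counit s)) a = Z.counit s a • Z.vac := (eps_inv Z _).symm

theorem map_cob_comp {X Y W : Ob} (f : PreCob X Y) (g : PreCob Y W) (x : Z.val X) :
    Z.map (cob (f.comp g)) x = Z.map (cob g) (Z.map (cob f) x) := map_comp Z (cob f) (cob g) x

theorem map_cob_tensor {X Y X' Y' : Ob} (f : PreCob X Y) (g : PreCob X' Y') (x : Z.val X)
    (y : Z.val X') : Z.map (cob (f.tensor g)) (Z.mm X X' x y) =
      Z.mm Y Y' (Z.map (cob f) x) (Z.map (cob g) y) := map_tensor Z (cob f) (cob g) x y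

theorem map_cob_id {X : Ob} (x : Z.val X) : Z.map (cob (PreCob.id X)) x = x := map_id Z x

theorem map_cob_assoc {X Y W : Ob} (x : Z.val X) (y : Z.val Y) (w : Z.val W) :
    Z.map (cob (PreCob.assoc X Y W)) (Z.mm _ _ (Z.mm _ _ x y) w) = Z.mm _ _ x (Z.mm _ _ y w) :=
  map_sumAssoc Z _ x y w

theorem map_cob_assocInv {X Y W : Ob} (x : Z.val X) (y : Z.val Y) (w : Z.val W) :
    Z.map (cob (PreCob.assocInv X Y W)) (Z.mm _ _ x (Z.mm _ _ y w)) =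
      Z.mm _ _ (Z.mm _ _ x y) w := by
  rw [← map_cob_assoc]
  exact rel_symm_rel Z (X := union (union X Y) W) (Y := union X (union Y W)) _ _ _ _

theorem map_cob_flip {X Y : Ob} (x : Z.val X) (y : Z.val Y) :
    Z.map (cob (PreCob.flip X Y)) (Z.mm _ _ x y) = Z.mm _ _ y x := map_sumComm Z _ x y

theorem map_cob_leftUnit {X : Ob} (x : Z.val X) :
    Z.map (cob (PreCob.leftUnit X)) (Z.mm _ _ Z.vac x) = x := map_emptySum Z _ x

theorem map_cob_leftUnitInv {X : Ob} (x : Z.val X) :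
    Z.map (cob (PreCob.leftUnitInv X)) x = Z.mm _ _ Z.vac x := by
  conv_lhs => rw [← map_cob_leftUnit Z x]
  exact rel_symm_rel Z (X := union empty X) (Y := X) _ _ _ _

theorem map_cob_rightUnit {X : Ob} (x : Z.val X) :
    Z.map (cob (PreCob.rightUnit X)) (Z.mm _ _ x Z.vac) = x := by
  rw [← map_cob_flip]
  refine (rel_rel Z (X := union empty X) (Y := union X empty) (W := X) _ _ _ _ _).trans
    (Eq.trans ?_ (map_cob_leftUnit Z x))
  exact rel_congr Z (by rintro (i | i); exacts [i.elim, rfl]) _ _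

theorem map_cob_rightUnitInv {X : Ob} (x : Z.val X) :
    Z.map (cob (PreCob.rightUnitInv X)) x = Z.mm _ _ x Z.vac := by
  conv_lhs => rw [← map_cob_rightUnit Z x]
  exact rel_symm_rel Z (X := union X empty) (Y := X) _ _ _ _

theorem map_rel {X Y : Ob} {f g : PreCob X Y} (h : Rel f g) (x : Z.val X) :
    Z.map (cob f) x = Z.map (cob g) x := by rw [cob_sound h]

/-- The number of terms of the copairing `Δ(1)`. -/
noncomputable def rank (s : Bool) : ℕ :=
  (Z.exists_sum_mm (Z.map (cob (PreCob.comul s)) 1)).choose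

/-- The left factors of the copairing `Δ(1)`. -/
noncomputable def dl (s : Bool) : Fin (Z.rank s) → Z.val (single s) :=
  (Z.exists_sum_mm (Z.map (cob (PreCob.comul s)) 1)).choose_spec.choose

/-- The right factors of the copairing `Δ(1)`. -/
noncomputable def dr (s : Bool) : Fin (Z.rank s) → Z.val (single s) :=
  (Z.exists_sum_mm (Z.map (cob (PreCob.comul s)) 1)).choose_spec.choose_spec.choose

theorem comul_one (s : Bool) :
    Z.map (cob (PreCob.comul s)) 1 = ∑ i, Z.mm _ _ (Z.dl s i) (Z.dr s i) :=
  (Z.exists_sum_mm (Z.map (cob (PreCob.comul s)) 1)).choose_spec.choose_spec.choose_spec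

/-- The Frobenius relation at `a ⊗ 1` expresses the comultiplication by the copairing. The other
relation, at `1 ⊗ a`, gives `comul_right`. -/
theorem comul_left (s : Bool) (a : Z.val (single s)) :
    Z.map (cob (PreCob.comul s)) a = ∑ i, Z.mm _ _ (a * Z.dl s i) (Z.dr s i) := by
  have h := map_rel Z (Rel.frobenius_right s) (Z.mm _ _ a 1)
  simp only [map_cob_comp, map_cob_tensor, map_cob_id, comul_one, map_sum, map_cob_assocInv,
    map_mul_mm, mul_one] at h
  exact h.symm

theorem comul_right (s : Bool) (a : Z.val (single s)) :
    Z.map (cob (PreCob.comul s)) a = ∑ i, Z.mm _ _ (Z.dl s i) (Z.dr s i * a) := by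
  have h := map_rel Z (Rel.frobenius_left s) (Z.mm _ _ 1 a)
  simp only [map_cob_comp, map_cob_tensor, map_cob_id, comul_one, map_sum, map_cob_assoc,
    map_mul_mm, one_mul, LinearMap.sum_apply] at h
  exact h.symm

/-- The counit axiom says that `dl` and `dr` are dual families for the form `ε(ab)`, so that
elements can be expanded in them. -/
theorem sum_counit_mul_dl (s : Bool) (a : Z.val (single s)) :
    ∑ i, Z.counit s (a * Z.dl s i) • Z.dr s i = a := by
  have h := map_rel Z (Rel.comul_counit_left s) a
  simp only [map_cob_comp, comul_left, map_sum, map_cob_tensor, map_cob_id, map_counit,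
    map_cob_leftUnitInv, map_smul, LinearMap.smul_apply] at h
  have h' := congrArg (Z.map (cob (PreCob.leftUnit (single s)))) h
  simpa only [map_sum, map_smul, map_cob_leftUnit] using h'

theorem sum_counit_dr_mul (s : Bool) (a : Z.val (single s)) :
    ∑ i, Z.counit s (Z.dr s i * a) • Z.dl s i = a := by
  have h := map_rel Z (Rel.comul_counit_right s) a
  simp only [map_cob_comp, comul_right, map_sum, map_cob_tensor, map_cob_id, map_counit,
    map_cob_rightUnitInv, map_smul] at h
  have h' := congrArg (Z.map (cob (PreCob.rightUnit (single s)))) h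
  simpa only [map_sum, map_smul, map_cob_rightUnit] using h'

theorem circle_mul_comm (a b : Z.val (single false)) : a * b = b * a := by
  have h := map_rel Z Rel.circle_commutative (Z.mm _ _ b a)
  simpa only [map_cob_comp, map_cob_flip, map_mul_mm] using h

theorem counit_mul_comm (s : Bool) (a b : Z.val (single s)) :
    Z.counit s (a * b) = Z.counit s (b * a) := by
  cases s
  · rw [circle_mul_comm]
  · have h := map_rel Z Rel.arc_symmetric (Z.mm _ _ b a)
    simp only [map_cob_comp, map_cob_flip, map_mul_mm] at h
    rw [counit, LinearMap.comp_apply, LinearMap.comp_apply, h]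

/-! ### Identities for the copairing Δ(1) -/

section casimir

variable (s : Bool)

/-- Expand every `dr i` in the family `dl`. The coefficients `ε(dr j * dr i)` are symmetric because
the counit is a trace, so summing over the other index first exchanges the two legs. -/
theorem sum_tmul_swap :
    ∑ i, Z.dr s i ⊗ₜ[k] Z.dl s i = ∑ i, Z.dl s i ⊗ₜ[k] Z.dr s i := by
  have h₁ : ∀ i, Z.dl s i ⊗ₜ[k] Z.dr s i =
      ∑ j, (Z.counit s (Z.dr s j * Z.dr s i) • Z.dl s i) ⊗ₜ[k] Z.dl s j := fun i => by
    conv_lhs => rw [← sum_counit_dr_mul Z s (Z.dr s i), TensorProduct.tmul_sum]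
    exact Finset.sum_congr rfl fun j _ => by rw [TensorProduct.tmul_smul, TensorProduct.smul_tmul']
  rw [Finset.sum_congr rfl fun i _ => h₁ i, Finset.sum_comm]
  refine Finset.sum_congr rfl fun j _ => ?_
  rw [← TensorProduct.sum_tmul]
  congr 1
  conv_lhs => rw [← sum_counit_dr_mul Z s (Z.dr s j)]
  exact Finset.sum_congr rfl fun i _ => by rw [counit_mul_comm]

/-- Both sides are Δ(a). -/
theorem sum_tmul_outer (a : Z.val (single s)) :
    ∑ i, (a * Z.dl s i) ⊗ₜ[k] Z.dr s i = ∑ i, Z.dl s i ⊗ₜ[k] (Z.dr s i * a) := by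
  have h := (comul_left Z s a).symm.trans (comul_right Z s a)
  have h' := congrArg (Functor.Monoidal.μIso Z.functor (single s) (single s)).inv.hom h
  simpa only [map_sum, mu_inv_mm] using h'

/-- Conjugate `sum_tmul_outer` with the flip, under which the copairing is invariant. -/
theorem sum_tmul_inner (a : Z.val (single s)) :
    ∑ i, (Z.dl s i * a) ⊗ₜ[k] Z.dr s i = ∑ i, Z.dl s i ⊗ₜ[k] (a * Z.dr s i) := by
  have h := congrArg (TensorProduct.comm k _ _) (sum_tmul_outer Z s a)
  simp only [map_sum, TensorProduct.comm_tmul] at h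
  have h₁ := congrArg (TensorProduct.map LinearMap.id (LinearMap.mulLeft k a)) (sum_tmul_swap Z s)
  have h₂ := congrArg (TensorProduct.map (LinearMap.mulRight k a) LinearMap.id)
    (sum_tmul_swap Z s)
  simp only [map_sum, TensorProduct.map_tmul, LinearMap.id_apply, LinearMap.mulLeft_apply,
    LinearMap.mulRight_apply] at h₁ h₂
  rw [← h₁, ← h₂, h]

variable {E : Type*} [AddCommMonoid E] [Module k E]
  (φ : Z.val (single s) →ₗ[k] Z.val (single s) →ₗ[k] E)

theorem sum_swap : ∑ i, φ (Z.dr s i) (Z.dl s i) = ∑ i, φ (Z.dl s i) (Z.dr s i) := by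
  simpa using congrArg (TensorProduct.lift φ) (sum_tmul_swap Z s)

theorem sum_outer (a : Z.val (single s)) :
    ∑ i, φ (a * Z.dl s i) (Z.dr s i) = ∑ i, φ (Z.dl s i) (Z.dr s i * a) := by
  simpa using congrArg (TensorProduct.lift φ) (sum_tmul_outer Z s a)

theorem sum_inner (a : Z.val (single s)) :
    ∑ i, φ (Z.dl s i * a) (Z.dr s i) = ∑ i, φ (Z.dl s i) (a * Z.dr s i) := by
  simpa using congrArg (TensorProduct.lift φ) (sum_tmul_inner Z s a)

end casimir

/-! ### Interaction of the arc and the circle: centrality, duality and the Cardy condition -/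

/-- The homomorphism `ı` of algebras from the circle to the arc. -/
noncomputable def zip : Z.val (single false) →ₗ[k] Z.val (single true) := Z.map (cob PreCob.zip)

/-- The linear map `ı*` from the arc to the circle. -/
noncomputable def cozip : Z.val (single true) →ₗ[k] Z.val (single false) :=
  Z.map (cob PreCob.cozip)

theorem zip_mul (a b : Z.val (single false)) : Z.zip (a * b) = Z.zip a * Z.zip b := by
  have h := map_rel Z Rel.zip_mul (Z.mm _ _ a b)
  simp only [map_cob_comp, map_cob_tensor, map_mul_mm] at h
  exact h.symm

theorem zip_one : Z.zip 1 = 1 := by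
  have h := map_rel Z Rel.zip_unit Z.vac
  simp only [map_cob_comp, map_unit_vac] at h
  exact h

theorem zip_central (c : Z.val (single false)) (a : Z.val (single true)) :
    Z.zip c * a = a * Z.zip c := by
  have h := map_rel Z Rel.knowledge (Z.mm _ _ c a)
  simp only [map_cob_comp, map_cob_tensor, map_cob_id, map_cob_flip, map_mul_mm] at h
  exact h

theorem counit_mul_cozip (c : Z.val (single false)) (a : Z.val (single true)) :
    Z.counit false (c * Z.cozip a) = Z.counit true (Z.zip c * a) := by
  have h := map_rel Z Rel.duality (Z.mm _ _ c a)
  simp only [map_cob_comp, map_cob_tensor, map_cob_id, map_mul_mm] at h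
  exact congrArg (Functor.Monoidal.εIso Z.functor).inv.hom h

theorem zip_cozip (a : Z.val (single true)) :
    Z.zip (Z.cozip a) = ∑ i, Z.dr true i * (a * Z.dl true i) := by
  have h := map_rel Z Rel.cardy a
  simp only [map_cob_comp, comul_left, map_sum, map_cob_flip, map_mul_mm] at h
  exact h.symm

/-- Duality gives the coefficients of `ı*(a)` in the dual families of the circle. Every further
property of `ı*` apart from the Cardy condition is read off from this expansion. -/
theorem cozip_eq (a : Z.val (single true)) :
    Z.cozip a = ∑ m, Z.counit true (Z.zip (Z.dl false m) * a) • Z.dr false m := by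
  conv_lhs => rw [← sum_counit_mul_dl Z false (Z.cozip a)]
  exact Finset.sum_congr rfl fun m _ => by rw [circle_mul_comm, counit_mul_cozip]

/-- The coefficients in `cozip_eq` are traces of products with a central element `ı(c)`, hence
symmetric in `a` and `b`. -/
theorem cozip_mul_comm (a b : Z.val (single true)) : Z.cozip (a * b) = Z.cozip (b * a) := by
  rw [cozip_eq, cozip_eq]
  refine Finset.sum_congr rfl fun m _ => ?_
  rw [← mul_assoc, zip_central, mul_assoc, counit_mul_comm, mul_assoc]

/-- Linearity of `ı*` over the circle algebra, since it is adjoint to the algebra homomorphism `ı`.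
-/
theorem cozip_zip_mul (c : Z.val (single false)) (a : Z.val (single true)) :
    Z.cozip (Z.zip c * a) = c * Z.cozip a := by
  conv_rhs => rw [← sum_counit_mul_dl Z false (c * Z.cozip a)]
  rw [cozip_eq]
  refine Finset.sum_congr rfl fun m _ => ?_
  rw [← mul_assoc, ← zip_mul, ← counit_mul_cozip, circle_mul_comm Z (c * Z.cozip a), mul_assoc]

/-- Adjointness in terms of copairings: `ı` on one leg of the copairing of the circle becomes `ı*`
on the other leg of that of the arc. -/
theorem sum_zip_tmul :
    ∑ m, Z.zip (Z.dl false m) ⊗ₜ[k] Z.dr false m =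
      ∑ i, Z.dl true i ⊗ₜ[k] Z.cozip (Z.dr true i) := by
  have h : ∀ i, Z.dl true i ⊗ₜ[k] Z.cozip (Z.dr true i) =
      ∑ m, (Z.counit true (Z.dr true i * Z.zip (Z.dl false m)) • Z.dl true i) ⊗ₜ[k]
        Z.dr false m := fun i => by
    rw [cozip_eq, TensorProduct.tmul_sum]
    exact Finset.sum_congr rfl fun m _ => by
      rw [TensorProduct.tmul_smul, TensorProduct.smul_tmul', counit_mul_comm]
  rw [Finset.sum_congr rfl fun i _ => h i, Finset.sum_comm]
  refine Finset.sum_congr rfl fun m _ => ?_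
  rw [← TensorProduct.sum_tmul, sum_counit_dr_mul]

theorem sum_zip {E : Type*} [AddCommMonoid E] [Module k E]
    (φ : Z.val (single true) →ₗ[k] Z.val (single false) →ₗ[k] E) :
    ∑ m, φ (Z.zip (Z.dl false m)) (Z.dr false m) =
      ∑ i, φ (Z.dl true i) (Z.cozip (Z.dr true i)) := by
  simpa using congrArg (TensorProduct.lift φ) (sum_zip_tmul Z)

/-- Two copairings of the arc make the annulus. -/
theorem sum_zip_zip {E : Type*} [AddCommMonoid E] [Module k E]
    (φ : Z.val (single true) →ₗ[k] Z.val (single true) →ₗ[k] E) :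
    ∑ m, φ (Z.zip (Z.dl false m)) (Z.zip (Z.dr false m)) =
      ∑ i, ∑ j, φ (Z.dl true i * Z.dl true j) (Z.dr true i * Z.dr true j) := by
  have h := sum_zip Z (φ.compl₂ Z.zip)
  simp only [LinearMap.compl₂_apply, zip_cozip, map_sum] at h
  rw [h, Finset.sum_comm]
  -- The Cardy condition has produced `dl i ⊗ dr j * dr i * dl j`. Now `sum_inner` moves `dr j`
  -- behind `dl i`, and a swap of the legs with index `j` gives the square of Δ(1) in `A ⊗ A`.
  have h₁ := fun j => sum_inner Z true (φ.compl₂ (LinearMap.mulRight k (Z.dl true j)))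
    (Z.dr true j)
  simp only [LinearMap.compl₂_apply, LinearMap.mulRight_apply, mul_assoc] at h₁
  rw [← Finset.sum_congr rfl fun j _ => h₁ j, Finset.sum_comm]
  refine Finset.sum_congr rfl fun i _ => ?_
  simpa using sum_swap Z true (φ.compl₁₂ (LinearMap.mulLeft k (Z.dl true i))
    (LinearMap.mulLeft k (Z.dr true i)))

end OpenClosedTQFT

/-! ### Unit vectors -/

namespace OpenClosedTQFT

variable {k : Type u} [Field k] (Z : OpenClosedTQFT k)

attribute [local instance] ringSingle algebraSingle

/-- Moves a factor past another one. The bijection is given only by its values, which is what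
`Split.mm_ins` needs to keep track of the split component. -/
theorem mm_mm_swap {X Y W : Ob} (x : Z.val X) (y : Z.val Y) (w : Z.val W) :
    ∃ (e : X.ι ⊕ (Y.ι ⊕ W.ι) ≃ Y.ι ⊕ (X.ι ⊕ W.ι)) (h : ∀ i, (union Y (union X W)).isArc (e i) =
      (union X (union Y W)).isArc i), (∀ i, e (Sum.inl i) = Sum.inr (Sum.inl i)) ∧
      (∀ i, e (Sum.inr (Sum.inl i)) = Sum.inl i) ∧
      (∀ i, e (Sum.inr (Sum.inr i)) = Sum.inr (Sum.inr i)) ∧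
      Z.rel (X := union X (union Y W)) (Y := union Y (union X W)) e h
        (Z.mm _ _ x (Z.mm _ _ y w)) = Z.mm _ _ y (Z.mm _ _ x w) := by
  have h₁ : ∀ i, (union (union Y X) W).isArc (Equiv.sumCongr (Equiv.sumComm X.ι Y.ι)
      (Equiv.refl W.ι) i) = (union (union X Y) W).isArc i := by rintro ((i | i) | i) <;> rfl
  have h₂ : ∀ i, (union Y X).isArc (Equiv.sumComm X.ι Y.ι i) = (union X Y).isArc i := by
    rintro (i | i) <;> rfl
  refine ⟨(Equiv.sumAssoc X.ι Y.ι W.ι).symm.trans ((Equiv.sumCongr (Equiv.sumComm X.ι Y.ι)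
    (Equiv.refl W.ι)).trans (Equiv.sumAssoc Y.ι X.ι W.ι)), by rintro (i | i | i) <;> rfl,
    fun _ => rfl, fun _ => rfl, fun _ => rfl, ?_⟩
  have a₁ : ∀ i, (union X (union Y W)).isArc (Equiv.sumAssoc X.ι Y.ι W.ι i) =
    (union (union X Y) W).isArc i := by rintro ((i | i) | i) <;> rfl
  have a₂ : ∀ i, (union Y (union X W)).isArc (Equiv.sumAssoc Y.ι X.ι W.ι i) =
    (union (union Y X) W).isArc i := by rintro ((i | i) | i) <;> rfl
  rw [← map_sumAssoc Z a₁, ← map_sumAssoc Z a₂, ← map_sumComm Z h₂]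
  have := mm_rel_left Z (X := union X Y) (Y := union Y X) (X' := W) _ h₂ (Z.mm _ _ x y) w
  rw [rel] at this
  rw [this]
  refine (rel_rel Z (X := union (union X Y) W) (Y := union X (union Y W))
    (W := union Y (union X W)) _ a₁ _ _ _).trans ?_
  refine Eq.trans ?_ (rel_rel Z (X := union (union X Y) W) (Y := union (union Y X) W)
    (W := union Y (union X W)) _ _ _ a₂ _).symm
  exact rel_congr Z (by rintro ((i | i) | i) <;> rfl) _ _

theorem Split.mm_ins {U X : Ob} {x : X.ι} {s : Bool} {W : Ob} (E : Split X x s W) (u : Z.val U)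
    (a : Z.val (single s)) (w : Z.val W) :
    ∃ E' : Split (union U X) (Sum.inr x) s (union U W),
      Z.mm U X u (E.ins Z a w) = E'.ins Z a (Z.mm U W u w) := by
  obtain ⟨e, h, h₁, h₂, h₃, he⟩ := mm_mm_swap Z a u w
  have hc := sumCongr_isArc (X := U) (Y := U) (X' := union (single s) W) (Y' := X)
    (Equiv.refl U.ι) E.e (refl_isArc U) E.h
  refine ⟨⟨e.trans (Equiv.sumCongr (Equiv.refl U.ι) E.e), fun i => (hc _).trans (h i), ?_⟩, ?_⟩
  · rw [Equiv.trans_apply, h₁]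
    exact congrArg Sum.inr E.hx
  · rw [ins, mm_rel_right Z (X := U), ← he]
    exact (rel_rel Z (X := union (single s) (union U W)) (Y := union U (union (single s) W))
      (W := union U X) _ h _ hc _)

/-- The vector is the tensor product of the units of all components. -/
inductive IsOne : ∀ X : Ob, Z.val X → Prop
  | vac : IsOne empty Z.vac
  | cons {X : Ob} {v : Z.val X} (s : Bool) : IsOne X v →
      IsOne (union (single s) X) (Z.mm (single s) X (1 : Z.functor.obj (single s)) v)
  | rel {X Y : Ob} {v : Z.val X} (e : X.ι ≃ Y.ι) (h : ∀ i, Y.isArc (e i) = X.isArc i) :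
      IsOne X v → IsOne Y (Z.rel e h v)

namespace IsOne

variable {Z}

/-- Whatever the order in which the units were multiplied together, any component may be taken as
the last one. Induction on the construction, with `Split.mm_ins` to move an older component to the
front. -/
theorem peel {X : Ob} {v : Z.val X} (hv : IsOne Z X v) : ∀ (x : X.ι) (s : Bool),
    X.isArc x = s → ∃ (W : Ob) (E : Split X x s W) (w : Z.val W), IsOne Z W w ∧
      v = E.ins Z (1 : Z.functor.obj (single s)) w := by
  induction hv with
  | vac => exact fun x => x.elim
  | @cons X v s hv ih =>
    rintro (⟨⟩ | x) t ht
    · obtain rfl : s = t := ht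
      exact ⟨X, ⟨Equiv.refl _, fun _ => rfl, rfl⟩, v, hv, (rel_of_eq Z (fun _ => rfl) _ _).symm⟩
    · obtain ⟨W, E, w, hw, rfl⟩ := ih x t ht
      obtain ⟨E', hE⟩ := E.mm_ins Z (U := single s) (1 : Z.functor.obj (single s)) 1 w
      exact ⟨_, E', _, .cons s hw, hE⟩
  | @rel X Y v e h hv ih =>
    intro y s hs
    obtain ⟨x, rfl⟩ := e.surjective y
    obtain ⟨W, E, w, hw, rfl⟩ := ih x s ((h x).symm.trans hs)
    exact ⟨W, ⟨E.e.trans e, fun i => (h _).trans (E.h i), congrArg e E.hx⟩, w, hw,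
      rel_rel Z _ _ _ _ _⟩

theorem peel_rest {X : Ob} {v : Z.val X} (hv : IsOne Z X v) (x : X.ι) (s : Bool)
    (hs : X.isArc x = s) : ∃ w : Z.val (rest X x), IsOne Z (rest X x) w ∧
      v = (Split.canonical X x s hs).ins Z (1 : Z.functor.obj (single s)) w := by
  obtain ⟨W, E, w, hw, rfl⟩ := hv.peel x s hs
  exact ⟨_, .rel E.others E.others_isArc hw, E.ins_eq _ _⟩

theorem eq_vac {X : Ob} {v : Z.val X} (hv : IsOne Z X v) : ∀ _ : IsEmpty X.ι,
    v = Z.rel (X := empty) (Equiv.equivOfIsEmpty Empty X.ι) (fun i => Empty.elim i) Z.vac := by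
  induction hv with
  | vac => exact fun _ => (rel_of_eq Z (X := empty) (fun i => Empty.elim i) _ _).symm
  | cons => exact fun hX => (hX.false (Sum.inl ())).elim
  | rel e h _ ih =>
    intro hX
    rw [ih e.isEmpty, rel_rel]
    exact rel_congr Z (X := empty) (fun i => Empty.elim i) _ _

theorem card_rest {X : Ob} (x : X.ι) : Nat.card (rest X x).ι + 1 = Nat.card X.ι := by
  rw [← Nat.card_congr (singleEquiv x), Nat.card_sum, Nat.card_unique (α := Unit), add_comm]

/-- Peel the same component off both vectors; what remains agrees by induction on the number of
components. -/
theorem unique : ∀ (n : ℕ) (X : Ob), Nat.card X.ι = n → ∀ v v' : Z.val X, IsOne Z X v →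
    IsOne Z X v' → v = v' := by
  intro n
  induction n with
  | zero =>
    intro X hX v v' hv hv'
    have : IsEmpty X.ι := by
      rcases Nat.card_eq_zero.1 hX with h | h
      exacts [h, absurd X.finite (not_finite_iff_infinite.2 h)]
    rw [hv.eq_vac this, hv'.eq_vac this]
  | succ n ih =>
    intro X hX v v' hv hv'
    have : Nonempty X.ι := (Nat.card_pos_iff.1 (by omega)).1
    obtain ⟨x⟩ := this
    obtain ⟨w, hw, rfl⟩ := hv.peel_rest x _ rfl
    obtain ⟨w', hw', rfl⟩ := hv'.peel_rest x _ rfl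
    rw [ih _ (by have := card_rest x; omega) w w' hw hw']

variable (Z) in
theorem exists_isOne : ∀ (n : ℕ) (X : Ob), Nat.card X.ι = n → ∃ v : Z.val X, IsOne Z X v := by
  intro n
  induction n with
  | zero =>
    intro X hX
    have : IsEmpty X.ι := by
      rcases Nat.card_eq_zero.1 hX with h | h
      exacts [h, absurd X.finite (not_finite_iff_infinite.2 h)]
    exact ⟨_, .rel (X := empty) (Equiv.equivOfIsEmpty Empty X.ι) (fun i => Empty.elim i) .vac⟩
  | succ n ih =>
    intro X hX
    have : Nonempty X.ι := (Nat.card_pos_iff.1 (by omega)).1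
    obtain ⟨x⟩ := this
    obtain ⟨w, hw⟩ := ih (rest X x) (by have := card_rest x; omega)
    exact ⟨_, .rel (X := union (single (X.isArc x)) (rest X x)) (singleEquiv x)
      (singleEquiv_isArc X x _ rfl) (.cons _ hw)⟩

theorem mm {X Y : Ob} {v : Z.val X} {w : Z.val Y} (hv : IsOne Z X v) (hw : IsOne Z Y w) :
    IsOne Z (union X Y) (Z.mm X Y v w) := by
  induction hv with
  | vac =>
    rw [← map_cob_leftUnitInv]
    exact .rel (Y := union empty Y) _ _ hw
  | cons s _ ih =>
    rw [← map_cob_assocInv]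
    exact .rel (X := union _ (union _ _)) (Y := union (union _ _) _) _ _ (.cons s ih)
  | rel e h _ ih =>
    rw [mm_rel_left]
    exact .rel (X := union _ _) (Y := union _ _) _ _ ih

end IsOne

/-- The tensor product of the units of all components. -/
noncomputable def one (X : Ob) : Z.val X := (IsOne.exists_isOne Z _ X rfl).choose

theorem isOne_one (X : Ob) : IsOne Z X (Z.one X) := (IsOne.exists_isOne Z _ X rfl).choose_spec

theorem IsOne.eq_one {X : Ob} {v : Z.val X} (h : IsOne Z X v) : v = Z.one X :=
  IsOne.unique _ X rfl _ _ h (isOne_one Z X)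

theorem rel_one {X Y : Ob} (e : X.ι ≃ Y.ι) (h : ∀ i, Y.isArc (e i) = X.isArc i) :
    Z.rel e h (Z.one X) = Z.one Y :=
  IsOne.eq_one Z (.rel e h (isOne_one Z X))

theorem mm_one (X Y : Ob) : Z.mm X Y (Z.one X) (Z.one Y) = Z.one (union X Y) :=
  IsOne.eq_one Z ((isOne_one Z X).mm (isOne_one Z Y))

theorem one_single (s : Bool) : Z.one (single s) = (1 : Z.functor.obj (single s)) := by
  refine (IsOne.eq_one Z ?_).symm
  rw [← map_cob_rightUnit Z (X := single s) (1 : Z.functor.obj (single s))]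
  exact .rel (X := union _ _) _ _ (.cons s .vac)

theorem Split.ins_one {X : Ob} {x : X.ι} {s : Bool} {W : Ob} (E : Split X x s W) :
    E.ins Z (1 : Z.functor.obj (single s)) (Z.one W) = Z.one X := by
  rw [ins, ← one_single, mm_one Z (single s) W]
  exact rel_one Z (X := union (single s) W) _ _

theorem Split.opAt_ins_of_ne {X : Ob} {x y : X.ι} {s : Bool} {W : Ob} (E : Split X x s W)
    {y' : W.ι} (hy' : E.e (Sum.inr y') = y) (t : Bool) (hy : X.isArc y = t) (ht : W.isArc y' = t)
    (ψ : Module.End k (Z.val (single t))) (a : Z.val (single s)) (w : Z.val W) :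
    Z.opAt X y t hy ψ (E.ins Z a w) = E.ins Z a (Z.opAt W y' t ht ψ w) := by
  refine (opAt_rel Z t ψ (X := union (single s) W) E.e E.h
    (x := Sum.inr y') hy' ht hy _).trans ?_
  exact congrArg _ (opAt_inr Z t ψ (X := single s) (Y := W) ht _ a w)

/-- The unit vector generates the whole vector space under left multiplications. -/
theorem eq_top_of_one_mem : ∀ (n : ℕ) (X : Ob), Nat.card X.ι = n → ∀ U : Submodule k (Z.val X),
    Z.one X ∈ U → (∀ (x : X.ι) (s : Bool) (h : X.isArc x = s) (a : Z.functor.obj (single s)),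
      ∀ v ∈ U, Z.opAt X x s h (LinearMap.mulLeft k a) v ∈ U) → U = ⊤ := by
  intro n
  induction n with
  | zero =>
    intro X hX U h _
    have : IsEmpty X.ι := by
      rcases Nat.card_eq_zero.1 hX with h | h
      exacts [h, absurd X.finite (not_finite_iff_infinite.2 h)]
    rw [(isOne_one Z X).eq_vac this] at h
    refine eq_top_iff.2 fun v _ => ?_
    obtain ⟨v, rfl⟩ := rel_surjective Z (X := empty) (Y := X) (Equiv.equivOfIsEmpty Empty X.ι)
      (fun i => Empty.elim i) v
    rw [← eps_inv Z v, map_smul]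
    exact U.smul_mem _ h
  | succ n ih =>
    intro X hX U h hU
    have : Nonempty X.ι := (Nat.card_pos_iff.1 (by omega)).1
    obtain ⟨x⟩ := this
    let E := Split.canonical X x _ rfl
    -- The vectors `w` whose product with the unit at `x` lies in `U` form a subspace of the value
    -- of the other components, to which the induction hypothesis applies.
    have key : ∀ w, E.ins Z (1 : Z.functor.obj (single (X.isArc x))) w ∈ U := by
      let g : Z.val (rest X x) →ₗ[k] Z.val X :=
        Z.rel (X := union (single (X.isArc x)) (rest X x)) E.e E.h ∘ₗ
          Z.mm _ _ (1 : Z.functor.obj (single (X.isArc x)))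
      have hg := ih (rest X x) (by have := IsOne.card_rest x; omega) (U.comap g) ?_ ?_
      · intro w
        have : w ∈ U.comap g := by rw [hg]; trivial
        exact this
      · change E.ins Z _ _ ∈ U
        rw [E.ins_one]
        exact h
      · intro y s hs a v hv
        change E.ins Z _ _ ∈ U
        rw [← E.opAt_ins_of_ne Z (y := y.1) rfl s hs hs]
        exact hU _ _ _ _ _ hv
    -- Stated through the quotient map, the claim can be tested on products `a ⊗ w`, and these arise
    -- from `1 ⊗ w` by left multiplication with `a` at `x`.
    have : U.mkQ = 0 := by
      refine E.ext_ins fun a w => ?_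
      rw [LinearMap.zero_apply, Submodule.mkQ_apply, Submodule.Quotient.mk_eq_zero]
      have := hU x _ rfl a _ (key w)
      rw [E.opAt_ins, LinearMap.mulLeft_apply, mul_one] at this
      exact this
    rw [← U.ker_mkQ, this, LinearMap.ker_zero]

end OpenClosedTQFT

/-! ### Saddles as linear maps -/

namespace OpenClosedTQFT

variable {k : Type u} [Field k] (Z : OpenClosedTQFT k)

attribute [local instance] ringSingle algebraSingle

/-- The linear map of `convert`. -/
noncomputable def conv (s t : Bool) : Z.val (single s) →ₗ[k] Z.val (single t) :=
  Z.map (convert s t)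

theorem conv_self (s : Bool) (a : Z.val (single s)) : Z.conv s s a = a := by
  cases s <;> exact map_id Z a

theorem conv_true_true (a : Z.val (single true)) : Z.conv true true a = a := Z.conv_self true a

theorem conv_false_false (a : Z.val (single false)) : Z.conv false false a = a :=
  Z.conv_self false a

theorem conv_false_true (a : Z.val (single false)) : Z.conv false true a = Z.zip a := rfl

theorem conv_true_false (a : Z.val (single true)) : Z.conv true false a = Z.cozip a := rfl

/-- The hypothesis excludes `ı*` only, which need not be multiplicative. -/
theorem conv_mul {s t : Bool} (h : s = true → t = true) (a b : Z.functor.obj (single s)) :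
    Z.conv s t (a * b) = Z.conv s t a * Z.conv s t b := by
  cases s <;> cases t
  · simp only [conv_self]
  · exact zip_mul Z a b
  · exact absurd (h rfl) (by simp)
  · simp only [conv_self]

theorem conv_one {s t : Bool} (h : s = true → t = true) :
    Z.conv s t (1 : Z.functor.obj (single s)) = (1 : Z.functor.obj (single t)) := by
  cases s <;> cases t
  · simp only [conv_self]
  · exact zip_one Z
  · exact absurd (h rfl) (by simp)
  · simp only [conv_self]

theorem conv_conv {s t : Bool} (h : s = true → t = true) (c : Z.val (single false)) :
    Z.conv s t (Z.conv false s c) = Z.conv false t c := by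
  cases s <;> cases t
  · simp only [conv_self]
  · simp only [conv_self]
  · exact absurd (h rfl) (by simp)
  · simp only [conv_self]

theorem conv_central (s : Bool) (c : Z.val (single false)) (a : Z.functor.obj (single s)) :
    Z.conv false s c * a = a * Z.conv false s c := by
  cases s
  · simp only [conv_self]
    exact circle_mul_comm Z c a
  · exact zip_central Z c a

/-- What remains of multiplicativity when `ı*` is allowed: linearity over the circle algebra. -/
theorem conv_conv_mul {s t : Bool} (h : t = true → s = true) (c : Z.val (single false))
    (a : Z.functor.obj (single s)) :
    Z.conv s t (Z.conv false s c * a) = Z.conv false t c * Z.conv s t a := by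
  cases s <;> cases t
  · simp only [conv_self]
  · exact absurd (h rfl) (by simp)
  · simp only [conv_false_true, conv_true_false, conv_false_false]
    exact cozip_zip_mul Z c a
  · simp only [conv_self]

theorem map_merge (s t r : Bool) (a : Z.val (single s)) (b : Z.val (single t)) :
    Z.map (merge s t r) (Z.mm _ _ a b) =
      (Z.conv s r a * Z.conv t r b : Z.functor.obj (single r)) := by
  refine (map_comp Z (X := union (single s) (single t)) (tensor (convert s r) (convert t r))
    (cob (PreCob.mul r)) _).trans ?_
  rw [map_tensor]
  rfl

/-- The linear map of `split`. -/
noncomputable def splitMap (r s t : Bool) :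
    Z.val (single r) →ₗ[k] Z.val (union (single s) (single t)) :=
  Z.map (split r s t)

theorem map_split_left (r s t : Bool) (a : Z.functor.obj (single r)) :
    Z.splitMap r s t a =
      ∑ i, Z.mm _ _ (Z.conv r s (a * Z.dl r i)) (Z.conv r t (Z.dr r i)) := by
  refine (map_comp Z (W := union (single s) (single t)) (cob (PreCob.comul r))
    (tensor (convert r s) (convert r t)) _).trans ?_
  rw [comul_left, map_sum]
  exact Finset.sum_congr rfl fun i _ => map_tensor Z _ _ _ _

theorem map_split_right (r s t : Bool) (a : Z.functor.obj (single r)) :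
    Z.splitMap r s t a =
      ∑ i, Z.mm _ _ (Z.conv r s (Z.dl r i)) (Z.conv r t (Z.dr r i * a)) := by
  refine (map_comp Z (W := union (single s) (single t)) (cob (PreCob.comul r))
    (tensor (convert r s) (convert r t)) _).trans ?_
  rw [comul_right, map_sum]
  exact Finset.sum_congr rfl fun i _ => map_tensor Z _ _ _ _

/-- The linear map of `arcSaddle`. -/
noncomputable def arcMap : Z.val (union (single true) (single true)) →ₗ[k]
    Z.val (union (single true) (single true)) :=
  Z.map arcSaddle

theorem map_arcSaddle (a b : Z.functor.obj (single true)) :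
    Z.arcMap (Z.mm (single true) (single true) a b) =
      ∑ i, Z.mm (single true) (single true) (a * Z.dl true i * b) (Z.dr true i) := by
  have h : arcSaddle = cob (((PreCob.comul true).tensor (PreCob.id (single true))).comp
      ((PreCob.assoc _ _ _).comp (((PreCob.id (single true)).tensor
        (PreCob.flip (single true) (single true))).comp ((PreCob.assocInv _ _ _).comp
          ((PreCob.mul true).tensor (PreCob.id (single true))))))) := rfl
  rw [arcMap, h]
  change Z.map (X := union (single true) (single true)) (Y := union (single true) (single true))
    (cob _) _ = _
  simp only [map_cob_comp, map_cob_tensor, map_cob_id, comul_left, map_sum, LinearMap.sum_apply,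
    map_cob_assoc, map_cob_flip, map_cob_assocInv, map_mul_mm]

/-- Multiplication by an element of the circle on the component `x`. -/
noncomputable def cOp (X : Ob) (x : X.ι) (c : Z.val (single false)) : Module.End k (Z.val X) :=
  Z.opAt X x (X.isArc x) rfl
    (LinearMap.mulLeft k (Z.conv false (X.isArc x) c : Z.functor.obj (single (X.isArc x))))

/-- Left multiplication on the arc `x`. -/
noncomputable def lOp (X : Ob) (x : X.ι) (h : X.isArc x = true) (a : Z.functor.obj (single true)) :
    Module.End k (Z.val X) :=
  Z.opAt X x true h (LinearMap.mulLeft k a)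

/-- Right multiplication on the arc `x`. -/
noncomputable def rOp (X : Ob) (x : X.ι) (h : X.isArc x = true) (a : Z.functor.obj (single true)) :
    Module.End k (Z.val X) :=
  Z.opAt X x true h (LinearMap.mulRight k a)

theorem cOp_eq {X : Ob} {x : X.ι} {s : Bool} (h : X.isArc x = s) (c : Z.val (single false)) :
    Z.cOp X x c = Z.opAt X x s h
      (LinearMap.mulLeft k (Z.conv false s c : Z.functor.obj (single s))) := by
  subst h; rfl

/-- The copairing of the circle on two components. -/
noncomputable def hOp (X : Ob) (x y : X.ι) : Module.End k (Z.val X) :=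
  ∑ m, Z.cOp X x (Z.dl false m) * Z.cOp X y (Z.dr false m)

/-- The copairing of the arc on two arcs. -/
noncomputable def dOp (X : Ob) (x y : X.ι) (hx : X.isArc x = true) (hy : X.isArc y = true) :
    Module.End k (Z.val X) :=
  ∑ i, Z.lOp X x hx (Z.dl true i) * Z.lOp X y hy (Z.dr true i)

/-- A decomposition of a family into two parts. -/
structure Decomp (X U W : Ob) where
  e : U.ι ⊕ W.ι ≃ X.ι
  h : ∀ i, X.isArc (e i) = (union U W).isArc i

namespace Decomp

variable {Z} {X U W : Ob} (D : Decomp X U W)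

/-- The product of elements over both parts. -/
noncomputable def put (Z : OpenClosedTQFT k) (u : Z.val U) (w : Z.val W) : Z.val X :=
  Z.rel (X := union U W) D.e D.h (Z.mm _ _ u w)

theorem ext_put {F : Type*} [AddCommMonoid F] [Module k F] {f g : Z.val X →ₗ[k] F}
    (h : ∀ u w, f (D.put Z u w) = g (D.put Z u w)) : f = g := by
  have := mm_ext Z (f := f ∘ₗ Z.rel (X := union U W) D.e D.h)
    (g := g ∘ₗ Z.rel (X := union U W) D.e D.h) h
  ext z
  obtain ⟨z, rfl⟩ := rel_surjective Z (X := union U W) D.e D.h z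
  exact LinearMap.congr_fun this z

theorem opAt_put_left {x : X.ι} {i : U.ι} (hi : D.e (Sum.inl i) = x) (s : Bool)
    (hx : X.isArc x = s) (hu : U.isArc i = s) (φ : Module.End k (Z.val (single s)))
    (u : Z.val U) (w : Z.val W) :
    Z.opAt X x s hx φ (D.put Z u w) = D.put Z (Z.opAt U i s hu φ u) w := by
  refine (opAt_rel Z s φ (X := union U W) D.e D.h (x := Sum.inl i) hi hu hx _).trans ?_
  exact congrArg _ (opAt_inl Z s φ hu _ u w)

theorem opAt_put_right {x : X.ι} {i : W.ι} (hi : D.e (Sum.inr i) = x) (s : Bool)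
    (hx : X.isArc x = s) (hw : W.isArc i = s) (φ : Module.End k (Z.val (single s)))
    (u : Z.val U) (w : Z.val W) :
    Z.opAt X x s hx φ (D.put Z u w) = D.put Z u (Z.opAt W i s hw φ w) := by
  refine (opAt_rel Z s φ (X := union U W) D.e D.h (x := Sum.inr i) hi hw hx _).trans ?_
  exact congrArg _ (opAt_inr Z s φ hw _ u w)

theorem put_one : D.put Z (Z.one U) (Z.one W) = Z.one X := by
  rw [put, mm_one Z U W]
  exact rel_one Z (X := union U W) _ _

theorem put_sum {ι : Type*} (t : Finset ι) (u : ι → Z.val U) (w : Z.val W) :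
    D.put Z (∑ i ∈ t, u i) w = ∑ i ∈ t, D.put Z (u i) w := by
  simp only [put, map_sum, LinearMap.sum_apply]

/-- A linear map which replaces the first part and relabels the second. -/
def Replaces {Y U' W' : Ob} (D : Decomp X U W) (D' : Decomp Y U' W') (S : Z.val X →ₗ[k] Z.val Y)
    (σ : Z.val U →ₗ[k] Z.val U') (e : W.ι ≃ W'.ι) (he : ∀ i, W'.isArc (e i) = W.isArc i) : Prop :=
  ∀ u w, S (D.put Z u w) = D'.put Z (σ u) (Z.rel e he w)

variable {D} {Y U' W' : Ob} {D' : Decomp Y U' W'} {S : Z.val X →ₗ[k] Z.val Y}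
    {σ : Z.val U →ₗ[k] Z.val U'} {e : W.ι ≃ W'.ι} {he : ∀ i, W'.isArc (e i) = W.isArc i}

/-- Locality: on the components that touch the saddle, compatibility with multiplications need only
be checked for the small map `σ`. -/
theorem Replaces.opAt_left (H : Replaces D D' S σ e he) {x : X.ι} {y : Y.ι} {i : U.ι} {i' : U'.ι}
    (hi : D.e (Sum.inl i) = x) (hi' : D'.e (Sum.inl i') = y) {s t : Bool} {hx : X.isArc x = s}
    {hy : Y.isArc y = t} {hu : U.isArc i = s} {hu' : U'.isArc i' = t}
    {φ : Module.End k (Z.val (single s))} {ψ : Module.End k (Z.val (single t))}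
    (hσ : ∀ u, σ (Z.opAt U i s hu φ u) = Z.opAt U' i' t hu' ψ (σ u)) (v : Z.val X) :
    S (Z.opAt X x s hx φ v) = Z.opAt Y y t hy ψ (S v) := by
  refine LinearMap.congr_fun (D.ext_put (f := S ∘ₗ Z.opAt X x s hx φ)
    (g := Z.opAt Y y t hy ψ ∘ₗ S) fun u w => ?_) v
  rw [LinearMap.comp_apply, LinearMap.comp_apply, D.opAt_put_left hi s hx hu, H, H,
    D'.opAt_put_left hi' t hy hu', hσ]

theorem Replaces.opAt_right (H : Replaces D D' S σ e he) {x : X.ι} {y : Y.ι} {i : W.ι}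
    (hi : D.e (Sum.inr i) = x) (hi' : D'.e (Sum.inr (e i)) = y) {s : Bool} {hx : X.isArc x = s}
    {hy : Y.isArc y = s} {φ : Module.End k (Z.val (single s))} (v : Z.val X) :
    S (Z.opAt X x s hx φ v) = Z.opAt Y y s hy φ (S v) := by
  have hw : W.isArc i = s := by rw [← hx, ← hi, D.h]; rfl
  have hw' : W'.isArc (e i) = s := by rw [he, hw]
  refine LinearMap.congr_fun (D.ext_put (f := S ∘ₗ Z.opAt X x s hx φ)
    (g := Z.opAt Y y s hy φ ∘ₗ S) fun u w => ?_) v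
  rw [LinearMap.comp_apply, LinearMap.comp_apply, D.opAt_put_right hi s hx hw, H, H,
    D'.opAt_put_right hi' s hy hw', opAt_rel Z s φ e he rfl hw hw']

end Decomp

/-- Two different components split off. -/
noncomputable def pairDecomp (X : Ob) (x y : X.ι) (h : x ≠ y) {s t : Bool} (hs : X.isArc x = s)
    (ht : X.isArc y = t) : Decomp X (union (single s) (single t)) (away X x y) :=
  ⟨pairEquiv x y h, by rintro ((i | i) | i); exacts [hs, ht, rfl]⟩

/-- One component, given twice, split off. -/
noncomputable def onceDecomp (X : Ob) (x y : X.ι) (h : x = y) {s : Bool} (hs : X.isArc x = s) :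
    Decomp X (single s) (away X x y) :=
  ⟨onceEquiv x y h, by rintro (i | i); exacts [hs, rfl]⟩

/-! ### Saddles between families, and the multiplications they carry along -/

section saddle

variable {X Y : Ob} {x₁ x₂ : X.ι} {y₁ y₂ : Y.ι} (e : Away x₁ x₂ ≃ Away y₁ y₂)
  (he : ∀ i, (away Y y₁ y₂).isArc (e i) = (away X x₁ x₂).isArc i)

/-- The linear map of a saddle. -/
noncomputable def sad : Z.val X →ₗ[k] Z.val Y :=
  Z.map (saddle X Y x₁ x₂ y₁ y₂ (relabelIso (X := away X x₁ x₂) (Y := away Y y₁ y₂) e he))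

theorem sad_merge (hx : x₁ ≠ x₂) (hy : y₁ = y₂) {s t r : Bool} (hs : X.isArc x₁ = s)
    (ht : X.isArc x₂ = t) (hr : Y.isArc y₁ = r) :
    Decomp.Replaces (pairDecomp X x₁ x₂ hx hs ht) (onceDecomp Y y₁ y₂ hy hr) (Z.sad e he)
      (Z.map (merge s t r)) e he := by
  subst hs ht hr
  intro u w
  rw [sad, saddle, dif_neg hx, dif_pos hy, map_comp, map_comp]
  refine congrArg _ ((congrArg _ ?_).trans (map_tensor Z (X := union _ _) (merge _ _ _) _ u w))
  exact rel_symm_rel Z (X := union (union (single (X.isArc x₁)) (single (X.isArc x₂)))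
    (away X x₁ x₂)) (pairEquiv x₁ x₂ hx) _ _ _

theorem sad_split (hx : x₁ = x₂) (hy : y₁ ≠ y₂) {s t r : Bool} (hr : X.isArc x₁ = r)
    (hs : Y.isArc y₁ = s) (ht : Y.isArc y₂ = t) :
    Decomp.Replaces (onceDecomp X x₁ x₂ hx hr) (pairDecomp Y y₁ y₂ hy hs ht) (Z.sad e he)
      (Z.splitMap r s t) e he := by
  subst hs ht hr
  intro u w
  rw [sad, saddle, dif_pos hx, dif_neg hy, map_comp, map_comp]
  refine congrArg _ ((congrArg _ ?_).trans (map_tensor Z (Y := union _ _) (split _ _ _) _ u w))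
  exact rel_symm_rel Z (X := union (single (X.isArc x₁)) (away X x₁ x₂))
    (onceEquiv x₁ x₂ hx) _ _ _

theorem sad_arc_conv (hx : x₁ ≠ x₂) (hy : y₁ ≠ y₂) {s t s' t' : Bool} (hs : X.isArc x₁ = s)
    (ht : X.isArc x₂ = t) (hs' : Y.isArc y₁ = s') (ht' : Y.isArc y₂ = t') :
    Decomp.Replaces (pairDecomp X x₁ x₂ hx hs ht) (pairDecomp Y y₁ y₂ hy hs' ht') (Z.sad e he)
      (Z.map ((convert s true ⊗ₘ convert t true) ≫ arcSaddle ≫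
          (convert true s' ⊗ₘ convert true t'))) e he := by
  subst hs ht hs' ht'
  intro u w
  rw [sad, saddle, dif_neg hx, dif_neg hy, map_comp, map_comp]
  refine congrArg _ ((congrArg _ ?_).trans
    (map_tensor Z (X := union _ _) (Y := union _ _) (_ ≫ arcSaddle ≫ _) _ u w))
  exact rel_symm_rel Z (X := union (union (single (X.isArc x₁)) (single (X.isArc x₂)))
    (away X x₁ x₂)) (pairEquiv x₁ x₂ hx) _ _ _

theorem sad_arc (hx : x₁ ≠ x₂) (hy : y₁ ≠ y₂) (hs : X.isArc x₁ = true) (ht : X.isArc x₂ = true)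
    (hs' : Y.isArc y₁ = true) (ht' : Y.isArc y₂ = true) :
    Decomp.Replaces (pairDecomp X x₁ x₂ hx hs ht) (pairDecomp Y y₁ y₂ hy hs' ht') (Z.sad e he)
      Z.arcMap e he := by
  have h := Z.sad_arc_conv e he hx hy hs ht hs' ht'
  have hσ : ((convert true true ⊗ₘ convert true true) ≫ arcSaddle ≫
      (convert true true ⊗ₘ convert true true)) = arcSaddle := by
    change (𝟙 (single true) ⊗ₘ 𝟙 (single true)) ≫ arcSaddle ≫
      (𝟙 (single true) ⊗ₘ 𝟙 (single true)) = arcSaddle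
    rw [id_tensorHom_id, Category.id_comp, Category.comp_id]
  rwa [hσ] at h

theorem isArc_inl (s t : Bool) : (union (single s) (single t)).isArc (Sum.inl ()) = s := rfl

theorem isArc_inr (s t : Bool) : (union (single s) (single t)).isArc (Sum.inr ()) = t := rfl

theorem opAt_mm_left {s t : Bool} (h : (union (single s) (single t)).isArc (Sum.inl ()) = s)
    (φ : Module.End k (Z.val (single s))) (a : Z.val (single s)) (b : Z.val (single t)) :
    Z.opAt (union (single s) (single t)) (Sum.inl ()) s h φ (Z.mm _ _ a b) =
      Z.mm _ _ (φ a) b := by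
  rw [opAt_inl Z s φ (X := single s) (Y := single t) (x := ()) rfl, opAt_single]

theorem opAt_mm_right {s t : Bool} (h : (union (single s) (single t)).isArc (Sum.inr ()) = t)
    (φ : Module.End k (Z.val (single t))) (a : Z.val (single s)) (b : Z.val (single t)) :
    Z.opAt (union (single s) (single t)) (Sum.inr ()) t h φ (Z.mm _ _ a b) =
      Z.mm _ _ a (φ b) := by
  rw [opAt_inr Z t φ (X := single s) (Y := single t) (y := ()) rfl, opAt_single]

/-- The linear map `S` carries multiplications by elements of the circle from `x` to `y`. -/
def CComm (S : Z.val X →ₗ[k] Z.val Y) (x : X.ι) (y : Y.ι) : Prop :=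
  ∀ c v, S (Z.cOp X x c v) = Z.cOp Y y c (S v)

/-- The linear map `S` carries left multiplications from `x` to `y`. -/
def LComm (S : Z.val X →ₗ[k] Z.val Y) (x : X.ι) (y : Y.ι) : Prop :=
  ∀ hx hy a v, S (Z.lOp X x hx a v) = Z.lOp Y y hy a (S v)

/-- The linear map `S` carries right multiplications from `x` to `y`. -/
def RComm (S : Z.val X →ₗ[k] Z.val Y) (x : X.ι) (y : Y.ι) : Prop :=
  ∀ hx hy a v, S (Z.rOp X x hx a v) = Z.rOp Y y hy a (S v)

section away

variable {U U' : Ob} {D : Decomp X U (away X x₁ x₂)} {D' : Decomp Y U' (away Y y₁ y₂)}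
  {S : Z.val X →ₗ[k] Z.val Y} {σ : Z.val U →ₗ[k] Z.val U'} {e he}

theorem cComm_away (H : Decomp.Replaces D D' S σ e he) (z : Away x₁ x₂)
    (h : D.e (Sum.inr z) = z.1) (h' : D'.e (Sum.inr (e z)) = (e z).1) :
    Z.CComm S z.1 (e z).1 := by
  intro c v
  have hz : X.isArc z.1 = Y.isArc (e z).1 := (he z).symm
  rw [cOp_eq Z hz, cOp]
  exact H.opAt_right (i := z) h h' v

theorem lComm_away (H : Decomp.Replaces D D' S σ e he) (z : Away x₁ x₂)
    (h : D.e (Sum.inr z) = z.1) (h' : D'.e (Sum.inr (e z)) = (e z).1) :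
    Z.LComm S z.1 (e z).1 := fun _ _ _ v => H.opAt_right (i := z) h h' v

theorem rComm_away (H : Decomp.Replaces D D' S σ e he) (z : Away x₁ x₂)
    (h : D.e (Sum.inr z) = z.1) (h' : D'.e (Sum.inr (e z)) = (e z).1) :
    Z.RComm S z.1 (e z).1 := fun _ _ _ v => H.opAt_right (i := z) h h' v

end away

section local_operators

variable {s t : Bool} {U' W W' : Ob} {S : Z.val X →ₗ[k] Z.val Y} {D' : Decomp Y U' W'}
  {e : W.ι ≃ W'.ι} {he : ∀ i, W'.isArc (e i) = W.isArc i} {x : X.ι} {y : Y.ι} {i' : U'.ι}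
  {r' : Bool} {hy : Y.isArc y = r'} (hu' : U'.isArc i' = r')
  {ψ : Module.End k (Z.val (single r'))}

theorem _root_.OpenClosedTQFT.Decomp.Replaces.opAt_pair_left
    {D : Decomp X (union (single s) (single t)) W}
    {σ : Z.val (union (single s) (single t)) →ₗ[k] Z.val U'} (H : Decomp.Replaces D D' S σ e he)
    (hi : D.e (Sum.inl (Sum.inl ())) = x) (hi' : D'.e (Sum.inl i') = y) {hx : X.isArc x = s}
    {φ : Module.End k (Z.val (single s))}
    (hσ : ∀ a b, σ (Z.mm _ _ (φ a) b) = Z.opAt U' i' r' hu' ψ (σ (Z.mm _ _ a b))) (v : Z.val X) :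
    S (Z.opAt X x s hx φ v) = Z.opAt Y y r' hy ψ (S v) := by
  refine H.opAt_left (i := Sum.inl ()) (i' := i') hi hi' (hu := isArc_inl s t) (hu' := hu') (fun u => ?_) v
  refine LinearMap.congr_fun (mm_ext Z (f := σ ∘ₗ Z.opAt _ _ _ _ φ)
    (g := Z.opAt U' i' r' hu' ψ ∘ₗ σ) fun a b => ?_) u
  rw [LinearMap.comp_apply, LinearMap.comp_apply, opAt_mm_left, hσ]

theorem _root_.OpenClosedTQFT.Decomp.Replaces.opAt_pair_right
    {D : Decomp X (union (single s) (single t)) W}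
    {σ : Z.val (union (single s) (single t)) →ₗ[k] Z.val U'} (H : Decomp.Replaces D D' S σ e he)
    (hi : D.e (Sum.inl (Sum.inr ())) = x) (hi' : D'.e (Sum.inl i') = y) {hx : X.isArc x = t}
    {φ : Module.End k (Z.val (single t))}
    (hσ : ∀ a b, σ (Z.mm _ _ a (φ b)) = Z.opAt U' i' r' hu' ψ (σ (Z.mm _ _ a b))) (v : Z.val X) :
    S (Z.opAt X x t hx φ v) = Z.opAt Y y r' hy ψ (S v) := by
  refine H.opAt_left (i := Sum.inr ()) (i' := i') hi hi' (hu := isArc_inr s t) (hu' := hu') (fun u => ?_) v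
  refine LinearMap.congr_fun (mm_ext Z (f := σ ∘ₗ Z.opAt _ _ _ _ φ)
    (g := Z.opAt U' i' r' hu' ψ ∘ₗ σ) fun a b => ?_) u
  rw [LinearMap.comp_apply, LinearMap.comp_apply, opAt_mm_right, hσ]

theorem _root_.OpenClosedTQFT.Decomp.Replaces.opAt_once
    {D : Decomp X (single s) W}
    {σ : Z.val (single s) →ₗ[k] Z.val U'} (H : Decomp.Replaces D D' S σ e he)
    (hi : D.e (Sum.inl ()) = x) (hi' : D'.e (Sum.inl i') = y) {hx : X.isArc x = s}
    {φ : Module.End k (Z.val (single s))}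
    (hσ : ∀ a, σ (φ a) = Z.opAt U' i' r' hu' ψ (σ a)) (v : Z.val X) :
    S (Z.opAt X x s hx φ v) = Z.opAt Y y r' hy ψ (S v) := by
  refine H.opAt_left (i := ()) (i' := i') hi hi' (hu := rfl) (hu' := hu') (fun u => ?_) v
  rw [opAt_single, hσ]

end local_operators

/-! ### Mergers -/

section merge

theorem sad_merge_away (hx : x₁ ≠ x₂) (hy : y₁ = y₂) (z : Away x₁ x₂) :
    Z.CComm (Z.sad e he) z.1 (e z).1 ∧
    Z.LComm (Z.sad e he) z.1 (e z).1 ∧ Z.RComm (Z.sad e he) z.1 (e z).1 := by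
  have H := Z.sad_merge e he hx hy rfl rfl rfl
  exact ⟨Z.cComm_away H z rfl rfl, Z.lComm_away H z rfl rfl, Z.rComm_away H z rfl rfl⟩

/-- For the first factor this is associativity; for the second, the element is moved past the first
factor, which is possible because the circle acts centrally. -/
theorem sad_merge_cComm (hx : x₁ ≠ x₂) (hy : y₁ = y₂) (h₁ : X.isArc x₁ = true → Y.isArc y₁ = true)
    (h₂ : X.isArc x₂ = true → Y.isArc y₁ = true) :
    Z.CComm (Z.sad e he) x₁ y₁ ∧ Z.CComm (Z.sad e he) x₂ y₁ := by
  have H := Z.sad_merge e he hx hy rfl rfl rfl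
  refine ⟨fun c v => H.opAt_pair_left Z (i' := ()) rfl rfl rfl (fun a b => ?_) v,
    fun c v => H.opAt_pair_right Z (i' := ()) rfl rfl rfl (fun a b => ?_) v⟩
  · rw [opAt_single, map_merge, map_merge, LinearMap.mulLeft_apply, LinearMap.mulLeft_apply,
      conv_mul Z h₁, conv_conv Z h₁, mul_assoc]
  · rw [opAt_single, map_merge, map_merge, LinearMap.mulLeft_apply, LinearMap.mulLeft_apply,
      conv_mul Z h₂, conv_conv Z h₂, ← mul_assoc, ← mul_assoc, conv_central]

/-- If one of the merging components is an arc, then the other is a circle, whose image in the arc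
algebra is central. Therefore left and right multiplications both pass. -/
theorem sad_merge_lComm (hx : x₁ ≠ x₂) (hy : y₁ = y₂)
    (h : ¬ (X.isArc x₁ = true ∧ X.isArc x₂ = true)) :
    (Z.LComm (Z.sad e he) x₁ y₁ ∧ Z.LComm (Z.sad e he) x₂ y₁) ∧
      (Z.RComm (Z.sad e he) x₁ y₁ ∧ Z.RComm (Z.sad e he) x₂ y₁) := by
  refine ⟨⟨fun hs hr a' v => ?_, fun ht hr a' v => ?_⟩, fun hs hr a' v => ?_, fun ht hr a' v => ?_⟩
  · have ht : X.isArc x₂ = false := by simpa [hs] using h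
    refine (Z.sad_merge e he hx hy hs ht hr).opAt_pair_left Z (i' := ()) rfl rfl rfl (fun a b => ?_) v
    rw [opAt_single, map_merge, map_merge, LinearMap.mulLeft_apply, LinearMap.mulLeft_apply,
      conv_self, conv_self, mul_assoc]
  · have hs : X.isArc x₁ = false := by simpa [ht] using h
    refine (Z.sad_merge e he hx hy hs ht hr).opAt_pair_right Z (i' := ()) rfl rfl rfl (fun a b => ?_) v
    rw [opAt_single, map_merge, map_merge, LinearMap.mulLeft_apply, LinearMap.mulLeft_apply,
      conv_self, conv_self, conv_central, conv_central, mul_assoc]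
  · have ht : X.isArc x₂ = false := by simpa [hs] using h
    refine (Z.sad_merge e he hx hy hs ht hr).opAt_pair_left Z (i' := ()) rfl rfl rfl (fun a b => ?_) v
    rw [opAt_single, map_merge, map_merge, LinearMap.mulRight_apply, LinearMap.mulRight_apply,
      conv_self, conv_self, mul_assoc, mul_assoc, conv_central]
  · have hs : X.isArc x₁ = false := by simpa [ht] using h
    refine (Z.sad_merge e he hx hy hs ht hr).opAt_pair_right Z (i' := ()) rfl rfl rfl (fun a b => ?_) v
    rw [opAt_single, map_merge, map_merge, LinearMap.mulRight_apply, LinearMap.mulRight_apply,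
      conv_self, conv_self, mul_assoc]

theorem sad_merge_one (hx : x₁ ≠ x₂) (hy : y₁ = y₂) (h₁ : X.isArc x₁ = true → Y.isArc y₁ = true)
    (h₂ : X.isArc x₂ = true → Y.isArc y₁ = true) : Z.sad e he (Z.one X) = Z.one Y := by
  have H := Z.sad_merge e he hx hy rfl rfl rfl
  rw [← (pairDecomp X x₁ x₂ hx rfl rfl).put_one, H, rel_one, ← mm_one, one_single, one_single,
    map_merge, conv_one Z h₁, conv_one Z h₂, mul_one, ← one_single, Decomp.put_one]

end merge

/-! ### Splittings -/

section split

theorem sad_split_away (hx : x₁ = x₂) (hy : y₁ ≠ y₂) (z : Away x₁ x₂) :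
    Z.CComm (Z.sad e he) z.1 (e z).1 ∧
    Z.LComm (Z.sad e he) z.1 (e z).1 ∧ Z.RComm (Z.sad e he) z.1 (e z).1 := by
  have H := Z.sad_split e he hx hy rfl rfl rfl
  exact ⟨Z.cComm_away H z rfl rfl, Z.lComm_away H z rfl rfl, Z.rComm_away H z rfl rfl⟩

/-- For the left leg write the comultiplication with `comul_left`, for the right leg with
`comul_right`; centrality brings the element to the required side. -/
theorem sad_split_cComm (hx : x₁ = x₂) (hy : y₁ ≠ y₂)
    (h₁ : Y.isArc y₁ = true → X.isArc x₁ = true) (h₂ : Y.isArc y₂ = true → X.isArc x₁ = true) :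
    Z.CComm (Z.sad e he) x₁ y₁ ∧ Z.CComm (Z.sad e he) x₁ y₂ := by
  have H := Z.sad_split e he hx hy rfl rfl rfl
  refine ⟨fun c v => H.opAt_once Z (U' := union (single _) (single _)) (r' := Y.isArc y₁)
      (i' := Sum.inl ())
      (isArc_inl (Y.isArc y₁) (Y.isArc y₂)) rfl rfl (fun a => ?_) v,
    fun c v => H.opAt_once Z (U' := union (single _) (single _)) (r' := Y.isArc y₂)
      (i' := Sum.inr ())
      (isArc_inr (Y.isArc y₁) (Y.isArc y₂)) rfl rfl (fun a => ?_) v⟩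
  · rw [map_split_left, map_split_left, map_sum]
    refine Finset.sum_congr rfl fun i _ => ?_
    rw [opAt_mm_left, LinearMap.mulLeft_apply, LinearMap.mulLeft_apply, mul_assoc,
      conv_conv_mul Z h₁]
  · rw [map_split_right, map_split_right, map_sum]
    refine Finset.sum_congr rfl fun i _ => ?_
    rw [opAt_mm_right, LinearMap.mulLeft_apply, LinearMap.mulLeft_apply, ← mul_assoc,
      ← conv_central, mul_assoc, conv_conv_mul Z h₂]

/-- The bilinear map that applies `ı*` to one of the factors. -/
noncomputable def mmConv (s t : Bool) :
    Z.functor.obj (single true) →ₗ[k] Z.functor.obj (single true) →ₗ[k]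
      Z.val (union (single s) (single t)) :=
  (Z.mm _ _).compl₁₂ (Z.conv true s) (Z.conv true t)

/-- Left multiplication is visible in `comul_left`. A factor `a'` on the right of `a` passes by
`sum_outer` to the right of `dr i`, inside `ı*`. There it may be moved to the left of `dr i` by
`cozip_mul_comm`, and `sum_inner` returns it to the right of `dl i`. -/
theorem sad_split_lComm₁ (hx : x₁ = x₂) (hy : y₁ ≠ y₂) (ht : Y.isArc y₂ = false) :
    Z.LComm (Z.sad e he) x₁ y₁ ∧ Z.RComm (Z.sad e he) x₁ y₁ := by
  refine ⟨fun hr hs a' v => ?_, fun hr hs a' v => ?_⟩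
  · refine (Z.sad_split e he hx hy hr hs ht).opAt_once Z (i' := Sum.inl ()) (isArc_inl true false) rfl rfl
      (fun a => ?_) v
    rw [map_split_left, map_split_left, map_sum]
    refine Finset.sum_congr rfl fun i _ => ?_
    rw [opAt_mm_left, LinearMap.mulLeft_apply, LinearMap.mulLeft_apply, mul_assoc, conv_self,
      conv_self]
  · refine (Z.sad_split e he hx hy hr hs ht).opAt_once Z (i' := Sum.inl ()) (isArc_inl true false) rfl rfl
      (fun a => ?_) v
    have h₁ := Z.sum_outer true ((Z.mmConv true false).compl₁₂
      (LinearMap.mulLeft k a) LinearMap.id) a'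
    have h₂ := Z.sum_inner true ((Z.mmConv true false).compl₁₂
      (LinearMap.mulLeft k a) LinearMap.id) a'
    simp only [mmConv, LinearMap.compl₁₂_apply, LinearMap.mulLeft_apply, LinearMap.id_apply,
      conv_true_true, conv_true_false] at h₁ h₂
    simp only [map_split_left, map_sum, LinearMap.mulRight_apply, conv_true_true,
      conv_true_false, mul_assoc]
    refine Eq.trans ?_ (Finset.sum_congr rfl fun i _ =>
      opAt_mm_left Z (isArc_inl true false) (LinearMap.mulRight k a') _ _).symm
    simp only [LinearMap.mulRight_apply, mul_assoc]
    rw [h₁, h₂]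
    exact Finset.sum_congr rfl fun i _ => by rw [cozip_mul_comm]

/-- The mirror image of `sad_split_lComm₁`: now right multiplication is the visible one, and left
multiplication goes around through `ı*`. -/
theorem sad_split_lComm₂ (hx : x₁ = x₂) (hy : y₁ ≠ y₂) (hs : Y.isArc y₁ = false) :
    Z.LComm (Z.sad e he) x₁ y₂ ∧ Z.RComm (Z.sad e he) x₁ y₂ := by
  refine ⟨fun hr ht a' v => ?_, fun hr ht a' v => ?_⟩
  · refine (Z.sad_split e he hx hy hr hs ht).opAt_once Z (i' := Sum.inr ()) (isArc_inr false true) rfl rfl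
      (fun a => ?_) v
    have h₁ := Z.sum_outer true ((Z.mmConv false true).compl₁₂
      LinearMap.id (LinearMap.mulRight k a)) a'
    have h₂ := Z.sum_inner true ((Z.mmConv false true).compl₁₂
      LinearMap.id (LinearMap.mulRight k a)) a'
    simp only [mmConv, LinearMap.compl₁₂_apply, LinearMap.mulRight_apply, LinearMap.id_apply,
      conv_true_true, conv_true_false, mul_assoc] at h₁ h₂
    simp only [map_split_right, map_sum, LinearMap.mulLeft_apply, conv_true_true,
      conv_true_false]
    refine Eq.trans ?_ (Finset.sum_congr rfl fun i _ =>
      opAt_mm_right Z (isArc_inr false true) (LinearMap.mulLeft k a') _ _).symm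
    simp only [LinearMap.mulLeft_apply]
    rw [← h₁, ← h₂]
    exact Finset.sum_congr rfl fun i _ => by rw [cozip_mul_comm]
  · refine (Z.sad_split e he hx hy hr hs ht).opAt_once Z (i' := Sum.inr ()) (isArc_inr false true) rfl rfl
      (fun a => ?_) v
    rw [map_split_right, map_split_right, map_sum]
    refine Finset.sum_congr rfl fun i _ => ?_
    rw [opAt_mm_right, LinearMap.mulRight_apply, LinearMap.mulRight_apply, ← mul_assoc, conv_self,
      conv_self]

theorem cOp_put_left {W : Ob} {s t : Bool} (D : Decomp Y (union (single s) (single t)) W)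
    (hD : D.e (Sum.inl (Sum.inl ())) = y₁) (c : Z.val (single false)) (a : Z.val (single s))
    (b : Z.val (single t)) (w : Z.val W) :
    Z.cOp Y y₁ c (D.put Z (Z.mm _ _ a b) w) =
      D.put Z (Z.mm _ _ (Z.conv false s c * a : Z.functor.obj (single s)) b) w := by
  have hs : Y.isArc y₁ = s := by rw [← hD, D.h]; rfl
  rw [cOp_eq Z hs, D.opAt_put_left hD s hs (isArc_inl _ _), opAt_mm_left]
  rfl

theorem cOp_put_right {W : Ob} {s t : Bool} (D : Decomp Y (union (single s) (single t)) W)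
    (hD : D.e (Sum.inl (Sum.inr ())) = y₂) (c : Z.val (single false)) (a : Z.val (single s))
    (b : Z.val (single t)) (w : Z.val W) :
    Z.cOp Y y₂ c (D.put Z (Z.mm _ _ a b) w) =
      D.put Z (Z.mm _ _ a (Z.conv false t c * b : Z.functor.obj (single t))) w := by
  have hs : Y.isArc y₂ = t := by rw [← hD, D.h]; rfl
  rw [cOp_eq Z hs, D.opAt_put_left hD t hs (isArc_inr _ _), opAt_mm_right]
  rfl

/-- In the mixed cases the unit of the arc is sent to the copairing of the arc with `ı*` on one leg,
which `sum_zip` turns into the copairing of the circle with `ı` on the other leg. -/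
theorem split_one (s t : Bool) (h : ¬ (s = true ∧ t = true)) :
    Z.splitMap (s || t) s t (1 : Z.functor.obj (single (s || t))) =
      ∑ m, Z.mm _ _ (Z.conv false s (Z.dl false m)) (Z.conv false t (Z.dr false m)) := by
  rw [map_split_left]
  simp only [one_mul]
  cases s <;> cases t
  · rfl
  · have h₁ := Z.sum_zip (Z.mm (single false) (single true)).flip
    have h₂ := Z.sum_swap true (Z.mmConv false true)
    have h₃ := Z.sum_swap false ((Z.mm (single false) (single true)).compl₂ Z.zip)
    simp only [mmConv, LinearMap.compl₁₂_apply, LinearMap.flip_apply, LinearMap.compl₂_apply,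
      conv_true_true, conv_true_false] at h₁ h₂ h₃
    change ∑ i, Z.mm _ _ (Z.conv true false (Z.dl true i)) (Z.conv true true (Z.dr true i)) = _
    simp only [conv_true_true, conv_true_false, conv_false_false, conv_false_true]
    rw [← h₂, ← h₁, h₃]
  · have h₁ := Z.sum_zip (Z.mm (single true) (single false))
    change ∑ i, Z.mm _ _ (Z.conv true true (Z.dl true i)) (Z.conv true false (Z.dr true i)) = _
    simp only [conv_true_true, conv_true_false, conv_false_false, conv_false_true]
    exact h₁.symm
  · simp at h

theorem sad_split_one (hx : x₁ = x₂) (hy : y₁ ≠ y₂)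
    (h : X.isArc x₁ = (Y.isArc y₁ || Y.isArc y₂))
    (h' : ¬ (Y.isArc y₁ = true ∧ Y.isArc y₂ = true)) :
    Z.sad e he (Z.one X) = Z.hOp Y y₁ y₂ (Z.one Y) := by
  have H := Z.sad_split e he hx hy h rfl rfl
  rw [← (onceDecomp X x₁ x₂ hx h).put_one, H, rel_one, one_single, split_one Z _ _ h',
    Decomp.put_sum, hOp, LinearMap.sum_apply]
  refine Finset.sum_congr rfl fun m _ => ?_
  conv_rhs => rw [← (pairDecomp Y y₁ y₂ hy rfl rfl).put_one]
  rw [← mm_one, one_single, one_single, Module.End.mul_apply, cOp_put_right Z (y₂ := y₂) (pairDecomp Y y₁ y₂ hy rfl rfl) rfl,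
    cOp_put_left Z (y₁ := y₁) (pairDecomp Y y₁ y₂ hy rfl rfl) rfl, mul_one, mul_one]

end split

/-! ### Saddles between two arcs -/

section arc

theorem sad_arc_away (hx : x₁ ≠ x₂) (hy : y₁ ≠ y₂) (hs : X.isArc x₁ = true)
    (ht : X.isArc x₂ = true) (hs' : Y.isArc y₁ = true) (ht' : Y.isArc y₂ = true)
    (z : Away x₁ x₂) : Z.CComm (Z.sad e he) z.1 (e z).1 ∧
    Z.LComm (Z.sad e he) z.1 (e z).1 ∧ Z.RComm (Z.sad e he) z.1 (e z).1 := by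
  have H := Z.sad_arc e he hx hy hs ht hs' ht'
  exact ⟨Z.cComm_away H z rfl rfl, Z.lComm_away H z rfl rfl, Z.rComm_away H z rfl rfl⟩

/-- A second normal form, in which each new arc ends with the end of the other old arc. It makes the
exchange of the right actions visible. -/
theorem map_arcSaddle_right (a b : Z.functor.obj (single true)) :
    Z.arcMap (Z.mm (single true) (single true) a b) =
      ∑ i, Z.mm (single true) (single true) (Z.dl true i * b) (Z.dr true i * a) := by
  rw [map_arcSaddle]
  have h := Z.sum_outer true ((Z.mm (single true) (single true)).compl₁₂
    (LinearMap.mulRight k b) LinearMap.id) a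
  simpa only [LinearMap.compl₁₂_apply, LinearMap.mulRight_apply, LinearMap.id_apply] using h

/-- In `a * dl i * b ⊗ dr i`, a factor to the left of `b` is moved to the left of `dr i` by
`sum_inner`. -/
theorem sad_arc_lComm (hx : x₁ ≠ x₂) (hy : y₁ ≠ y₂) (hs : X.isArc x₁ = true)
    (ht : X.isArc x₂ = true) (hs' : Y.isArc y₁ = true) (ht' : Y.isArc y₂ = true) :
    Z.LComm (Z.sad e he) x₁ y₁ ∧ Z.LComm (Z.sad e he) x₂ y₂ := by
  have H := Z.sad_arc e he hx hy hs ht hs' ht'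
  refine ⟨fun _ _ a' v => H.opAt_pair_left Z (U' := union (single true) (single true)) (r' := true)
      (i' := Sum.inl ()) (isArc_inl true true) rfl rfl (fun a b => ?_) v,
    fun _ _ a' v => H.opAt_pair_right Z (U' := union (single true) (single true)) (r' := true)
      (i' := Sum.inr ()) (isArc_inr true true) rfl rfl (fun a b => ?_) v⟩
  · simp only [map_arcSaddle, LinearMap.mulLeft_apply, map_sum]
    refine Finset.sum_congr rfl fun i _ => ?_
    refine Eq.trans ?_ (opAt_mm_left Z _ _ _ _).symm
    simp only [LinearMap.mulLeft_apply, mul_assoc]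
  · simp only [map_arcSaddle, LinearMap.mulLeft_apply, map_sum]
    have h := Z.sum_inner true ((Z.mm (single true) (single true)).compl₁₂
      (LinearMap.mulLeft k a ∘ₗ LinearMap.mulRight k b) LinearMap.id) a'
    simp only [LinearMap.compl₁₂_apply, LinearMap.mulRight_apply, LinearMap.mulLeft_apply,
      LinearMap.id_apply, LinearMap.comp_apply, mul_assoc] at h
    simp only [mul_assoc]
    rw [h]
    exact Finset.sum_congr rfl fun i _ =>
      (opAt_mm_right Z (isArc_inr true true) (LinearMap.mulLeft k a') _ _).symm

theorem sad_arc_rComm (hx : x₁ ≠ x₂) (hy : y₁ ≠ y₂) (hs : X.isArc x₁ = true)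
    (ht : X.isArc x₂ = true) (hs' : Y.isArc y₁ = true) (ht' : Y.isArc y₂ = true) :
    Z.RComm (Z.sad e he) x₁ y₂ ∧ Z.RComm (Z.sad e he) x₂ y₁ := by
  have H := Z.sad_arc e he hx hy hs ht hs' ht'
  refine ⟨fun _ _ a' v => H.opAt_pair_left Z (U' := union (single true) (single true)) (r' := true)
      (i' := Sum.inr ()) (isArc_inr true true) rfl rfl (fun a b => ?_) v,
    fun _ _ a' v => H.opAt_pair_right Z (U' := union (single true) (single true)) (r' := true)
      (i' := Sum.inl ()) (isArc_inl true true) rfl rfl (fun a b => ?_) v⟩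
  · simp only [map_arcSaddle_right, LinearMap.mulRight_apply, map_sum]
    refine Finset.sum_congr rfl fun i _ => ?_
    refine Eq.trans ?_ (opAt_mm_right Z _ _ _ _).symm
    simp only [LinearMap.mulRight_apply, mul_assoc]
  · simp only [map_arcSaddle_right, LinearMap.mulRight_apply, map_sum]
    refine Finset.sum_congr rfl fun i _ => ?_
    refine Eq.trans ?_ (opAt_mm_left Z _ _ _ _).symm
    simp only [LinearMap.mulRight_apply, mul_assoc]

theorem sad_arc_cComm (hx : x₁ ≠ x₂) (hy : y₁ ≠ y₂) (hs : X.isArc x₁ = true)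
    (ht : X.isArc x₂ = true) (hs' : Y.isArc y₁ = true) (ht' : Y.isArc y₂ = true) :
    Z.CComm (Z.sad e he) x₁ y₁ ∧ Z.CComm (Z.sad e he) x₂ y₂ := by
  have H := Z.sad_arc_lComm e he hx hy hs ht hs' ht'
  refine ⟨fun c v => ?_, fun c v => ?_⟩
  · rw [cOp_eq Z hs, cOp_eq Z hs']
    exact H.1 hs hs' _ v
  · rw [cOp_eq Z ht, cOp_eq Z ht']
    exact H.2 ht ht' _ v

theorem lOp_put_left {W : Ob} (D : Decomp Y (union (single true) (single true)) W)
    (hD : D.e (Sum.inl (Sum.inl ())) = y₁) (hs : Y.isArc y₁ = true)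
    (c a b : Z.functor.obj (single true)) (w : Z.val W) :
    Z.lOp Y y₁ hs c (D.put Z (Z.mm _ _ a b) w) = D.put Z (Z.mm _ _ (c * a) b) w := by
  rw [lOp, D.opAt_put_left hD true hs (isArc_inl _ _), opAt_mm_left]
  rfl

theorem lOp_put_right {W : Ob} (D : Decomp Y (union (single true) (single true)) W)
    (hD : D.e (Sum.inl (Sum.inr ())) = y₂) (hs : Y.isArc y₂ = true)
    (c a b : Z.functor.obj (single true)) (w : Z.val W) :
    Z.lOp Y y₂ hs c (D.put Z (Z.mm _ _ a b) w) = D.put Z (Z.mm _ _ a (c * b)) w := by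
  rw [lOp, D.opAt_put_left hD true hs (isArc_inr _ _), opAt_mm_right]
  rfl

theorem sad_arc_one (hx : x₁ ≠ x₂) (hy : y₁ ≠ y₂) (hs : X.isArc x₁ = true)
    (ht : X.isArc x₂ = true) (hs' : Y.isArc y₁ = true) (ht' : Y.isArc y₂ = true) :
    Z.sad e he (Z.one X) = Z.dOp Y y₁ y₂ hs' ht' (Z.one Y) := by
  have H := Z.sad_arc e he hx hy hs ht hs' ht'
  rw [← (pairDecomp X x₁ x₂ hx hs ht).put_one, H, rel_one, ← mm_one, one_single, map_arcSaddle]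
  refine (Decomp.put_sum _ _ _ _).trans ?_
  rw [dOp, LinearMap.sum_apply]
  refine Finset.sum_congr rfl fun m _ => ?_
  conv_rhs => rw [← (pairDecomp Y y₁ y₂ hy hs' ht').put_one]
  rw [← mm_one, one_single, Module.End.mul_apply, 
    lOp_put_right Z (y₂ := y₂) (pairDecomp Y y₁ y₂ hy hs' ht') rfl,
    lOp_put_left Z (y₁ := y₁) (pairDecomp Y y₁ y₂ hy hs' ht') rfl,
    mul_one, mul_one, one_mul, mul_one]

end arc

end saddle

end OpenClosedTQFT

/-! ### Relations between the operators -/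

namespace OpenClosedTQFT

variable {k : Type u} [Field k] (Z : OpenClosedTQFT k)

attribute [local instance] ringSingle algebraSingle

section operators

variable (X : Ob)

theorem lOp_mul (x : X.ι) (h : X.isArc x = true) (a b : Z.functor.obj (single true)) :
    Z.lOp X x h (a * b) = Z.lOp X x h a * Z.lOp X x h b := by
  rw [lOp, lOp, lOp, ← opAt_mul]
  exact congrArg _ (LinearMap.mulLeft_mul k _ a b)

theorem rOp_mul (x : X.ι) (h : X.isArc x = true) (a b : Z.functor.obj (single true)) :
    Z.rOp X x h (a * b) = Z.rOp X x h b * Z.rOp X x h a := by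
  rw [rOp, rOp, rOp, ← opAt_mul]
  exact congrArg _ (LinearMap.mulRight_mul k _ a b)

theorem lOp_one (x : X.ι) (h : X.isArc x = true) : Z.lOp X x h 1 = 1 := by
  rw [lOp, LinearMap.mulLeft_one]
  exact opAt_one Z X x true h

theorem rOp_one (x : X.ι) (h : X.isArc x = true) : Z.rOp X x h 1 = 1 := by
  rw [rOp, LinearMap.mulRight_one]
  exact opAt_one Z X x true h

/-- `lOp` as a linear map. -/
noncomputable def lLin (x : X.ι) (h : X.isArc x = true) :
    Z.functor.obj (single true) →ₗ[k] Module.End k (Z.val X) :=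
  (Z.opAtHom X x true h).toLinearMap ∘ₗ LinearMap.mul k (Z.functor.obj (single true))

/-- `rOp` as a linear map. -/
noncomputable def rLin (x : X.ι) (h : X.isArc x = true) :
    Z.functor.obj (single true) →ₗ[k] Module.End k (Z.val X) :=
  (Z.opAtHom X x true h).toLinearMap ∘ₗ (LinearMap.mul k (Z.functor.obj (single true))).flip

/-- `cOp` as a linear map. -/
noncomputable def cLin (x : X.ι) : Z.val (single false) →ₗ[k] Module.End k (Z.val X) :=
  (Z.opAtHom X x (X.isArc x) rfl).toLinearMap ∘ₗ
    LinearMap.mul k (Z.functor.obj (single (X.isArc x))) ∘ₗ Z.conv false (X.isArc x)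

theorem cLin_apply (x : X.ι) (c : Z.val (single false)) : Z.cLin X x c = Z.cOp X x c := rfl

theorem cOp_eq_lOp (x : X.ι) (h : X.isArc x = true) (c : Z.val (single false)) :
    Z.cOp X x c = Z.lOp X x h (Z.zip c) := cOp_eq Z h c

variable {X}

theorem lOp_commute {x y : X.ι} (hxy : x ≠ y) (hx : X.isArc x = true) (hy : X.isArc y = true)
    (a b : Z.functor.obj (single true)) : Commute (Z.lOp X x hx a) (Z.lOp X y hy b) :=
  opAt_commute Z X hxy true true hx hy _ _

theorem rOp_commute {x y : X.ι} (hxy : x ≠ y) (hx : X.isArc x = true) (hy : X.isArc y = true)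
    (a b : Z.functor.obj (single true)) : Commute (Z.rOp X x hx a) (Z.rOp X y hy b) :=
  opAt_commute Z X hxy true true hx hy _ _

theorem lOp_rOp_commute (x y : X.ι) (hx : X.isArc x = true) (hy : X.isArc y = true)
    (a b : Z.functor.obj (single true)) : Commute (Z.lOp X x hx a) (Z.rOp X y hy b) := by
  by_cases hxy : x = y
  · subst hxy
    rw [Commute, SemiconjBy, lOp, rOp, ← opAt_mul, ← opAt_mul]
    refine congrArg _ (LinearMap.ext fun c => ?_)
    exact (mul_assoc a c b).symm
  · exact opAt_commute Z X hxy true true hx hy _ _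

theorem cOp_commute (x y : X.ι) (c c' : Z.val (single false)) :
    Commute (Z.cOp X x c) (Z.cOp X y c') := by
  by_cases hxy : x = y
  · subst hxy
    rw [Commute, SemiconjBy, cOp, cOp, ← opAt_mul, ← opAt_mul]
    refine congrArg _ ((LinearMap.mulLeft_mul k _ _ _).symm.trans
      (Eq.trans ?_ (LinearMap.mulLeft_mul k _ _ _)))
    rw [conv_central]
  · exact opAt_commute Z X hxy _ _ rfl rfl _ _

theorem cOp_lOp_commute (x y : X.ι) (hy : X.isArc y = true) (c : Z.val (single false))
    (a : Z.functor.obj (single true)) : Commute (Z.cOp X x c) (Z.lOp X y hy a) := by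
  by_cases hxy : x = y
  · subst hxy
    rw [cOp_eq_lOp Z X x hy, Commute, SemiconjBy, ← lOp_mul, ← lOp_mul, zip_central]
  · exact opAt_commute Z X hxy _ _ rfl hy _ _

theorem hOp_symm (x y : X.ι) : Z.hOp X x y = Z.hOp X y x := by
  have h := Z.sum_swap false
    ((LinearMap.mul k (Module.End k (Z.val X))).compl₁₂ (Z.cLin X x) (Z.cLin X y))
  simp only [LinearMap.compl₁₂_apply, LinearMap.mul_apply', cLin_apply] at h
  rw [hOp, ← h, hOp]
  exact Finset.sum_congr rfl fun i _ => cOp_commute Z _ _ _ _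

theorem hOp_commute (x y z w : X.ι) : Commute (Z.hOp X x y) (Z.hOp X z w) :=
  Commute.sum_left _ _ _ fun _ _ => Commute.sum_right _ _ _ fun _ _ =>
    ((Z.cOp_commute _ _ _ _).mul_right (Z.cOp_commute _ _ _ _)).mul_left
      ((Z.cOp_commute _ _ _ _).mul_right (Z.cOp_commute _ _ _ _))

theorem hOp_dOp_commute (x y z w : X.ι) (hz : X.isArc z = true) (hw : X.isArc w = true) :
    Commute (Z.hOp X x y) (Z.dOp X z w hz hw) :=
  Commute.sum_left _ _ _ fun _ _ => Commute.sum_right _ _ _ fun _ _ =>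
    ((Z.cOp_lOp_commute _ _ _ _ _).mul_right (Z.cOp_lOp_commute _ _ _ _ _)).mul_left
      ((Z.cOp_lOp_commute _ _ _ _ _).mul_right (Z.cOp_lOp_commute _ _ _ _ _))

/-- The bilinear map of left multiplications on two arcs. -/
noncomputable def llLin (x y : X.ι) (hx : X.isArc x = true) (hy : X.isArc y = true) :
    Z.functor.obj (single true) →ₗ[k] Z.functor.obj (single true) →ₗ[k] Module.End k (Z.val X) :=
  (LinearMap.mul k (Module.End k (Z.val X))).compl₁₂ (Z.lLin X x hx) (Z.lLin X y hy)

theorem llLin_apply (x y : X.ι) (hx : X.isArc x = true) (hy : X.isArc y = true)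
    (a b : Z.functor.obj (single true)) :
    Z.llLin x y hx hy a b = Z.lOp X x hx a * Z.lOp X y hy b := rfl

theorem dOp_symm {x y : X.ι} (hxy : x ≠ y) (hx : X.isArc x = true) (hy : X.isArc y = true) :
    Z.dOp X x y hx hy = Z.dOp X y x hy hx := by
  have h := Z.sum_swap true (Z.llLin x y hx hy)
  simp only [llLin_apply] at h
  rw [dOp, ← h, dOp]
  exact Finset.sum_congr rfl fun i _ => lOp_commute Z hxy _ _ _ _

theorem dOp_commute {x y z w : X.ι} (hx : X.isArc x = true) (hy : X.isArc y = true)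
    (hz : X.isArc z = true) (hw : X.isArc w = true) (hxz : x ≠ z) (hxw : x ≠ w) (hyz : y ≠ z)
    (hyw : y ≠ w) : Commute (Z.dOp X x y hx hy) (Z.dOp X z w hz hw) :=
  Commute.sum_left _ _ _ fun _ _ => Commute.sum_right _ _ _ fun _ _ =>
    ((Z.lOp_commute hxz _ _ _ _).mul_right (Z.lOp_commute hxw _ _ _ _)).mul_left
      ((Z.lOp_commute hyz _ _ _ _).mul_right (Z.lOp_commute hyw _ _ _ _))

/-- The identity `sum_outer` in terms of operators: a multiplication slides through the copairing
and changes the arc. -/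
theorem lOp_mul_dOp {x y : X.ι} (hx : X.isArc x = true) (hy : X.isArc y = true)
    (a : Z.functor.obj (single true)) :
    Z.lOp X x hx a * Z.dOp X x y hx hy = Z.dOp X x y hx hy * Z.lOp X y hy a := by
  have h := Z.sum_outer true (Z.llLin x y hx hy) a
  simp only [llLin_apply, lOp_mul] at h
  rw [dOp, Finset.mul_sum, Finset.sum_mul]
  simpa only [mul_assoc] using h

/-- The analogue of `(x y)(y z) = (y z)(z x)` for transpositions: the leg at `y` slides through the
second copairing and comes out at `z`. -/
theorem dOp_mul_dOp_cyclic {x y z : X.ι} (hx : X.isArc x = true) (hy : X.isArc y = true)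
    (hz : X.isArc z = true) (hxy : x ≠ y) (hxz : x ≠ z) :
    Z.dOp X x y hx hy * Z.dOp X y z hy hz = Z.dOp X y z hy hz * Z.dOp X z x hz hx := by
  rw [dOp_symm Z hxz.symm]
  have h : ∀ i, Z.lOp X x hx (Z.dl true i) * Z.lOp X y hy (Z.dr true i) * Z.dOp X y z hy hz =
      Z.dOp X y z hy hz * (Z.lOp X x hx (Z.dl true i) * Z.lOp X z hz (Z.dr true i)) := fun i => by
    rw [mul_assoc, lOp_mul_dOp Z, ← mul_assoc, ← mul_assoc]
    congr 1
    exact Commute.sum_right _ _ _ fun _ _ =>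
      (Z.lOp_commute hxy _ _ _ _).mul_right (Z.lOp_commute hxz _ _ _ _)
  rw [dOp, Finset.sum_mul, Finset.sum_congr rfl fun i _ => h i, ← Finset.mul_sum, ← dOp]

/-- Elements of the circle act centrally, so after sliding to the other arc they may be moved back
in front. -/
theorem cOp_mul_dOp {x y : X.ι} (hx : X.isArc x = true) (hy : X.isArc y = true)
    (c : Z.val (single false)) :
    Z.cOp X x c * Z.dOp X x y hx hy = Z.cOp X y c * Z.dOp X x y hx hy := by
  rw [cOp_eq_lOp Z X x hx, cOp_eq_lOp Z X y hy, lOp_mul_dOp Z, ← cOp_eq_lOp Z X y hy]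
  exact (Commute.sum_right _ _ _ fun _ _ => (Z.cOp_lOp_commute _ _ _ _ _).mul_right
    (Z.cOp_lOp_commute _ _ _ _ _)).symm

theorem hOp_mul_dOp {x y : X.ι} (z : X.ι) (hx : X.isArc x = true)
    (hy : X.isArc y = true) :
    Z.hOp X z x * Z.dOp X x y hx hy = Z.hOp X z y * Z.dOp X x y hx hy := by
  simp only [hOp, Finset.sum_mul, mul_assoc, cOp_mul_dOp Z hx hy]

/-- The operator form of `sum_zip_zip`, which rests on the Cardy condition: two exchanges between
the same arcs amount to the copairing of the circle. -/
theorem dOp_mul_self {x y : X.ι} (hxy : x ≠ y) (hx : X.isArc x = true) (hy : X.isArc y = true) :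
    Z.dOp X x y hx hy * Z.dOp X x y hx hy = Z.hOp X x y := by
  have h := Z.sum_zip_zip (Z.llLin x y hx hy)
  simp only [llLin_apply] at h
  simp only [hOp, cOp_eq_lOp Z X x hx, cOp_eq_lOp Z X y hy, h]
  simp only [lOp_mul]
  rw [dOp, Finset.sum_mul]
  refine Finset.sum_congr rfl fun i _ => ?_
  rw [Finset.mul_sum]
  refine Finset.sum_congr rfl fun j _ => ?_
  rw [mul_assoc, mul_assoc, ← mul_assoc (Z.lOp X y hy _), (lOp_commute Z hxy.symm _ _ _ _).eq,
    mul_assoc]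

end operators

end OpenClosedTQFT

/-! ### Surgery on oriented strands -/

/-- A relation whose graph is a disjoint union of oriented paths and cycles: every point has at
most one successor and at most one predecessor. -/
structure IsStrands {P : Type} (r : P → P → Prop) : Prop where
  succ_unique : ∀ {a b c}, r a b → r a c → b = c
  pred_unique : ∀ {a b c}, r b a → r c a → b = c

namespace IsStrands

open Relation

variable {P : Type} {r : P → P → Prop}

theorem reverse (H : IsStrands r) : IsStrands (flip r) := ⟨H.pred_unique, H.succ_unique⟩

theorem total_succ (H : IsStrands r) {a b c : P} (h : ReflTransGen r a b)
    (h' : ReflTransGen r a c) : ReflTransGen r b c ∨ ReflTransGen r c b :=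
  ReflTransGen.total_of_right_unique (fun _ _ _ => H.succ_unique) h h'

theorem total_pred (H : IsStrands r) {a b c : P} (h : ReflTransGen r b a)
    (h' : ReflTransGen r c a) : ReflTransGen r b c ∨ ReflTransGen r c b :=
  (H.reverse.total_succ (reflTransGen_swap.2 h) (reflTransGen_swap.2 h')).symm.imp
    reflTransGen_swap.1 reflTransGen_swap.1

theorem eqvGen_of_path {a b : P} (h : ReflTransGen r a b) : EqvGen r a b := by
  induction h with
  | refl => exact .refl _
  | tail _ h ih => exact .trans _ _ _ ih (.rel _ _ h)

/-- By uniqueness of successors and predecessors, two paths with a common start or a common end are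
comparable, so a zigzag straightens to a directed path. -/
theorem path_or_path (H : IsStrands r) {a b : P} (h : EqvGen r a b) :
    ReflTransGen r a b ∨ ReflTransGen r b a := by
  induction h with
  | rel a b h => exact Or.inl (.single h)
  | refl a => exact Or.inl .refl
  | symm a b _ ih => exact ih.symm
  | trans a b c _ _ ih₁ ih₂ =>
    rcases ih₁ with h₁ | h₁ <;> rcases ih₂ with h₂ | h₂
    · exact Or.inl (h₁.trans h₂)
    · exact H.total_pred h₁ h₂
    · exact H.total_succ h₁ h₂
    · exact Or.inr (h₂.trans h₁)

theorem eq_of_path_to_tail {t p : P} (ht : ∀ a, ¬ r a t) (h : ReflTransGen r p t) : p = t := by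
  rcases h.cases_tail with h | ⟨c, _, h⟩
  exacts [h.symm, absurd h (ht c)]

theorem eq_of_path_from_head {h p : P} (hh : ∀ a, ¬ r h a) (hp : ReflTransGen r h p) : p = h := by
  rcases hp.cases_head with h | ⟨c, h, _⟩
  exacts [h.symm, absurd h (hh c)]

theorem path_of_tail (H : IsStrands r) {t p : P} (ht : ∀ a, ¬ r a t) (h : EqvGen r t p) :
    ReflTransGen r t p := by
  rcases H.path_or_path h with h | h
  · exact h
  · rw [eq_of_path_to_tail ht h]

theorem path_of_head (H : IsStrands r) {h p : P} (hh : ∀ a, ¬ r h a) (hp : EqvGen r p h) :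
    ReflTransGen r p h := by
  rcases H.path_or_path hp with h' | h'
  · exact h'
  · rw [eq_of_path_from_head hh h']

theorem tail_unique (H : IsStrands r) {t t' : P} (ht : ∀ a, ¬ r a t) (ht' : ∀ a, ¬ r a t')
    (h : EqvGen r t t') : t = t' :=
  eq_of_path_to_tail ht' (H.path_of_tail ht h)

theorem head_unique (H : IsStrands r) {h h' : P} (hh : ∀ a, ¬ r h a) (hh' : ∀ a, ¬ r h' a)
    (e : EqvGen r h h') : h = h' :=
  (eq_of_path_from_head hh (H.path_of_head hh' e)).symm

/-- A path that never ends comes back. -/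
theorem head_or_cycle [Finite P] (H : IsStrands r) (p : P) :
    (∃ h, (∀ a, ¬ r h a) ∧ ReflTransGen r p h) ∨ ∃ q, ReflTransGen r p q ∧ r q p := by
  by_contra hc
  push Not at hc
  obtain ⟨h₁, h₂⟩ := hc
  have h₃ : ∀ q : {q // ReflTransGen r p q}, ∃ a, r q.1 a := fun q => by
    by_contra h
    push Not at h
    exact h₁ q.1 h q.2
  choose s hs using h₃
  -- On the finite set of points reachable from `p` the successor map is injective, hence
  -- surjective; so `p` itself is the successor of a reachable point.
  have hinj : Function.Injective
      (fun q : {q // ReflTransGen r p q} => (⟨s q, q.2.tail (hs q)⟩ : {q // ReflTransGen r p q})) :=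
    fun a b hab => by
      have h := congrArg Subtype.val hab
      exact Subtype.ext (H.pred_unique (hs a) (by simp only at h; rw [h]; exact hs b))
  obtain ⟨q, hq⟩ := Finite.surjective_of_injective hinj ⟨p, .refl⟩
  have h := congrArg Subtype.val hq
  simp only at h
  refine h₂ q.1 q.2 ?_
  have := hs q
  rwa [h] at this

theorem exists_head [Finite P] (H : IsStrands r) {t : P} (ht : ∀ a, ¬ r a t) :
    ∃ h, (∀ a, ¬ r h a) ∧ EqvGen r t h := by
  rcases H.head_or_cycle t with ⟨h, hh, hp⟩ | ⟨q, _, hq⟩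
  exacts [⟨h, hh, eqvGen_of_path hp⟩, absurd hq (ht q)]

theorem eqvGen_reverse {a b : P} (h : EqvGen (flip r) a b) : EqvGen r a b := by
  induction h with
  | rel a b h => exact .symm _ _ (.rel _ _ h)
  | refl a => exact .refl a
  | symm a b _ ih => exact .symm _ _ ih
  | trans a b c _ _ ih₁ ih₂ => exact .trans _ _ _ ih₁ ih₂

theorem exists_tail [Finite P] (H : IsStrands r) {h : P} (hh : ∀ a, ¬ r h a) :
    ∃ t, (∀ a, ¬ r a t) ∧ EqvGen r t h := by
  obtain ⟨t, ht, h⟩ := H.reverse.exists_head hh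
  exact ⟨t, ht, .symm _ _ (eqvGen_reverse h)⟩

end IsStrands

/-- The relation `r'` arises from the strands of `r` by an exchange of the successors of the points
`x₁` and `x₂`. -/
structure Surgery {P : Type} (r r' : P → P → Prop) (x₁ x₂ : P) : Prop where
  strands : IsStrands r
  ne : x₁ ≠ x₂
  succ₁ : ∃ b, r x₁ b
  succ₂ : ∃ b, r x₂ b
  iff₁ : ∀ b, r' x₁ b ↔ r x₂ b
  iff₂ : ∀ b, r' x₂ b ↔ r x₁ b
  iff_away : ∀ a b, a ≠ x₁ → a ≠ x₂ → (r' a b ↔ r a b)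

namespace Surgery

open Relation IsStrands

variable {P : Type} {r r' : P → P → Prop} {x₁ x₂ : P}

theorem exchange (H : Surgery r r' x₁ x₂) : Surgery r r' x₂ x₁ :=
  ⟨H.strands, H.ne.symm, H.succ₂, H.succ₁, H.iff₂, H.iff₁, fun a b h h' => H.iff_away a b h' h⟩

/-- The exchange of successors as precomposition with a transposition, from which uniqueness of
successors and predecessors and the invariance of tails follow at once. -/
theorem iff_swap (H : Surgery r r' x₁ x₂) [DecidableEq P] (a b : P) :
    r' a b ↔ r (Equiv.swap x₁ x₂ a) b := by
  by_cases h₁ : a = x₁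
  · subst h₁; rw [Equiv.swap_apply_left, H.iff₁]
  · by_cases h₂ : a = x₂
    · subst h₂; rw [Equiv.swap_apply_right, H.iff₂]
    · rw [Equiv.swap_apply_of_ne_of_ne h₁ h₂, H.iff_away a b h₁ h₂]

theorem strands' (H : Surgery r r' x₁ x₂) : IsStrands r' := by
  classical
  refine ⟨fun h h' => ?_, fun h h' => ?_⟩
  · rw [H.iff_swap] at h h'
    exact H.strands.succ_unique h h'
  · rw [H.iff_swap] at h h'
    exact (Equiv.swap x₁ x₂).injective (H.strands.pred_unique h h')

theorem symm (H : Surgery r r' x₁ x₂) : Surgery r' r x₁ x₂ :=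
  ⟨H.strands', H.ne, H.succ₂.imp fun b h => (H.iff₁ b).2 h, H.succ₁.imp fun b h => (H.iff₂ b).2 h,
    fun b => (H.iff₂ b).symm, fun b => (H.iff₁ b).symm, fun a b h h' => (H.iff_away a b h h').symm⟩

theorem tail_iff (H : Surgery r r' x₁ x₂) (p : P) : (∀ a, ¬ r' a p) ↔ ∀ a, ¬ r a p := by
  classical
  simp only [H.iff_swap]
  exact (Equiv.swap x₁ x₂).forall_congr_left.trans (by simp)

/-- The point lies on one of the strands that run into the surgery. -/
def Touches (r : P → P → Prop) (x₁ x₂ p : P) : Prop := EqvGen r p x₁ ∨ EqvGen r p x₂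

theorem Touches.congr {p q : P} (h : Touches r x₁ x₂ p) (e : EqvGen r q p) :
    Touches r x₁ x₂ q := h.imp (e.trans _ _ _) (e.trans _ _ _)

/-- Only steps from `x₁` and `x₂` are lost. There the point and its old successor both lie on
touched strands of `r'`, since the old successor now follows the other surgery point. -/
theorem step (H : Surgery r r' x₁ x₂) {p q : P} (h : EqvGen r p q) :
    EqvGen r' p q ∨ (Touches r' x₁ x₂ p ∧ Touches r' x₁ x₂ q) := by
  induction h with
  | rel a b h =>
    by_cases h₁ : a = x₁
    · subst h₁
      exact Or.inr ⟨Or.inl (.refl _), Or.inr (.symm _ _ (.rel _ _ ((H.iff₂ b).2 h)))⟩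
    · by_cases h₂ : a = x₂
      · subst h₂
        exact Or.inr ⟨Or.inr (.refl _), Or.inl (.symm _ _ (.rel _ _ ((H.iff₁ b).2 h)))⟩
      · exact Or.inl (.rel _ _ ((H.iff_away a b h₁ h₂).2 h))
  | refl a => exact Or.inl (.refl a)
  | symm a b _ ih => exact ih.imp (.symm _ _) And.symm
  | trans a b c _ _ ih₁ ih₂ =>
    rcases ih₁ with h₁ | ⟨h₁, h₁'⟩ <;> rcases ih₂ with h₂ | ⟨h₂, h₂'⟩
    · exact Or.inl (.trans _ _ _ h₁ h₂)
    · exact Or.inr ⟨h₂.congr h₁, h₂'⟩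
    · exact Or.inr ⟨h₁, h₁'.congr (.symm _ _ h₂)⟩
    · exact Or.inr ⟨h₁, h₂'⟩

theorem touches (H : Surgery r r' x₁ x₂) {p : P} (h : Touches r x₁ x₂ p) :
    Touches r' x₁ x₂ p := by
  rcases h with h | h
  · exact (H.step h).elim Or.inl And.left
  · exact (H.step h).elim Or.inr And.left

/-- Steps from points other than `x₁` and `x₂`. -/
def Off (r : P → P → Prop) (x₁ x₂ a b : P) : Prop := a ≠ x₁ ∧ a ≠ x₂ ∧ r a b

theorem off_eq (H : Surgery r r' x₁ x₂) : Off r' x₁ x₂ = Off r x₁ x₂ := by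
  ext a b
  exact and_congr_right fun h => and_congr_right fun h' => H.iff_away a b h h'

theorem off_comm (r : P → P → Prop) (x₁ x₂ : P) : Off r x₂ x₁ = Off r x₁ x₂ := by
  ext a b
  exact and_left_comm

theorem path_of_off {a b : P} (h : ReflTransGen (Off r x₁ x₂) a b) : ReflTransGen r a b :=
  ReflTransGen.mono (fun _ _ (h : Off r x₁ x₂ _ _) => h.2.2) _ _ h

/-- Stop the path at its first visit to one of the surgery points. -/
theorem off_or (a b : P) (h : ReflTransGen r a b) :
    ReflTransGen (Off r x₁ x₂) a b ∨ ReflTransGen (Off r x₁ x₂) a x₁ ∨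
      ReflTransGen (Off r x₁ x₂) a x₂ := by
  induction h using ReflTransGen.head_induction_on with
  | refl => exact Or.inl .refl
  | @head a c h _ ih =>
    by_cases h₁ : a = x₁
    · subst h₁; exact Or.inr (Or.inl .refl)
    · by_cases h₂ : a = x₂
      · subst h₂; exact Or.inr (Or.inr .refl)
      · have hs : Off r x₁ x₂ a c := ⟨h₁, h₂, h⟩
        exact ih.imp (.head hs) (Or.imp (.head hs) (.head hs))

theorem off_of_path {a : P} (h : ReflTransGen r a x₁) :
    ReflTransGen (Off r x₁ x₂) a x₁ ∨ ReflTransGen (Off r x₁ x₂) a x₂ := by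
  rcases off_or (x₁ := x₁) (x₂ := x₂) _ _ h with h | h
  exacts [Or.inl h, h]

theorem off_strands (H : Surgery r r' x₁ x₂) : IsStrands (Off r x₁ x₂) :=
  ⟨fun h h' => H.strands.succ_unique h.2.2 h'.2.2,
    fun h h' => H.strands.pred_unique h.2.2 h'.2.2⟩

theorem off_disjoint (H : Surgery r r' x₁ x₂) {p : P} (h₁ : ReflTransGen (Off r x₁ x₂) p x₁)
    (h₂ : ReflTransGen (Off r x₁ x₂) p x₂) : False := by
  rcases H.off_strands.total_succ h₁ h₂ with h | h
  · exact H.ne (eq_of_path_from_head (fun a ha => ha.1 rfl) h).symm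
  · exact H.ne (eq_of_path_from_head (fun a ha => ha.2.1 rfl) h)

/-- The only predecessors of `n₁` and `n₂` are `x₁` and `x₂`, so both are starting points for the
relation `Off`, and strands with different starting points are disjoint. -/
theorem off_cross (H : Surgery r r' x₁ x₂) {n₁ n₂ p : P} (hn₁ : r x₁ n₁) (hn₂ : r x₂ n₂)
    (h₁ : ReflTransGen (Off r x₁ x₂) n₁ p) (h₂ : ReflTransGen (Off r x₁ x₂) n₂ p) : False := by
  have hne : n₁ ≠ n₂ := fun h => H.ne (H.strands.pred_unique hn₁ (h ▸ hn₂))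
  rcases H.off_strands.total_pred h₁ h₂ with h | h
  · exact hne (eq_of_path_to_tail (fun a ha => ha.2.1 (H.strands.pred_unique ha.2.2 hn₂)) h)
  · exact hne (eq_of_path_to_tail (fun a ha => ha.1 (H.strands.pred_unique ha.2.2 hn₁)) h).symm

/-- The strand from `x₁` closes up before it meets `x₂`. Reaching `x₁` without leaving a surgery
point is then constant along all steps of `r`, hence holds on the whole component. -/
theorem not_off_of_cycle (H : Surgery r r' x₁ x₂) {n₁ p : P} (hn₁ : r x₁ n₁)
    (h₁ : ReflTransGen (Off r x₁ x₂) n₁ x₁) (hp : EqvGen r x₁ p) :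
    ReflTransGen (Off r x₁ x₂) p x₁ := by
  obtain ⟨n₂, hn₂⟩ := H.succ₂
  have key : ∀ a b, r a b → (ReflTransGen (Off r x₁ x₂) a x₁ ↔ ReflTransGen (Off r x₁ x₂) b x₁) := by
    intro a b hab
    by_cases ha₁ : a = x₁
    · subst ha₁
      exact iff_of_true .refl (H.strands.succ_unique hab hn₁ ▸ h₁)
    · by_cases ha₂ : a = x₂
      · subst ha₂
        exact iff_of_false (fun h => H.off_disjoint h .refl)
          (fun h => H.off_cross hn₁ hn₂ h₁ (H.strands.succ_unique hab hn₂ ▸ h))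
      · refine ⟨fun h => ?_, fun h => .head ⟨ha₁, ha₂, hab⟩ h⟩
        rcases h.cases_head with h | ⟨c, hc, h⟩
        · exact absurd h ha₁
        · exact H.strands.succ_unique hc.2.2 hab ▸ h
  have : ∀ p q, EqvGen r p q → (ReflTransGen (Off r x₁ x₂) p x₁ ↔
      ReflTransGen (Off r x₁ x₂) q x₁) := by
    intro p q h
    induction h with
    | rel a b h => exact key a b h
    | refl a => exact Iff.rfl
    | symm a b _ ih => exact ih.symm
    | trans a b c _ _ ih₁ ih₂ => exact ih₁.trans ih₂
  exact (this _ _ hp).1 .refl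

/-- Cut at `x₁` and `x₂`, the component structure is determined by where the pieces that start at
`n₁` and `n₂` end: crosswise connections join `x₁` and `x₂` before the surgery. -/
theorem eqvGen_iff (H : Surgery r r' x₁ x₂) {n₁ n₂ : P} (hn₁ : r x₁ n₁) (hn₂ : r x₂ n₂) :
    EqvGen r x₁ x₂ ↔ ReflTransGen (Off r x₁ x₂) n₁ x₂ ∨ ReflTransGen (Off r x₁ x₂) n₂ x₁ := by
  have key : ∀ {x₁ x₂ n₁ : P}, Surgery r r' x₁ x₂ → r x₁ n₁ → ReflTransGen r x₁ x₂ →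
      ReflTransGen (Off r x₁ x₂) n₁ x₂ := by
    intro x₁ x₂ n₁ H hn₁ h
    rcases h.cases_head with h | ⟨c, hc, h'⟩
    · exact absurd h H.ne
    · obtain rfl := H.strands.succ_unique hc hn₁
      rcases off_or (x₁ := x₁) (x₂ := x₂) _ _ h' with h' | h' | h'
      · exact h'
      · exact (H.off_disjoint (H.not_off_of_cycle hn₁ h' (eqvGen_of_path h)) .refl).elim
      · exact h'
  constructor
  · intro h
    rcases H.strands.path_or_path h with h | h
    · exact Or.inl (key H hn₁ h)
    · exact Or.inr (off_comm r x₁ x₂ ▸ key H.exchange hn₂ h)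
  · rintro (h | h)
    · exact .trans _ _ _ (.rel _ _ hn₁) (eqvGen_of_path (path_of_off h))
    · exact .symm _ _ (.trans _ _ _ (.rel _ _ hn₂) (eqvGen_of_path (path_of_off h)))

/-- The surgery exchanges `n₁` and `n₂` but leaves `Off` unchanged. Thus straight connections join
`x₁` and `x₂` afterwards, and the statements on splitting, merging and arcs compare the two
criteria. -/
theorem eqvGen'_iff (H : Surgery r r' x₁ x₂) {n₁ n₂ : P} (hn₁ : r x₁ n₁) (hn₂ : r x₂ n₂) :
    EqvGen r' x₁ x₂ ↔ ReflTransGen (Off r x₁ x₂) n₂ x₂ ∨ ReflTransGen (Off r x₁ x₂) n₁ x₁ := by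
  rw [H.symm.eqvGen_iff ((H.iff₁ n₂).2 hn₂) ((H.iff₂ n₁).2 hn₁), H.off_eq]

/-- A surgery on one component gives two components. -/
theorem split (H : Surgery r r' x₁ x₂) (h : EqvGen r x₁ x₂) : ¬ EqvGen r' x₁ x₂ := by
  obtain ⟨n₁, hn₁⟩ := H.succ₁
  obtain ⟨n₂, hn₂⟩ := H.succ₂
  rw [H.eqvGen_iff hn₁ hn₂] at h
  rw [H.eqvGen'_iff hn₁ hn₂]
  rintro (h' | h') <;> rcases h with h | h
  · exact H.off_cross hn₁ hn₂ h h'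
  · exact H.off_disjoint h h'
  · exact H.off_disjoint h' h
  · exact H.off_cross hn₁ hn₂ h' h

/-- A surgery on a circle and another component gives one component. -/
theorem merge [Finite P] (H : Surgery r r' x₁ x₂) (h : ¬ EqvGen r x₁ x₂)
    (hc : ∀ p, (∀ a, ¬ r p a) → ¬ EqvGen r x₁ p) : EqvGen r' x₁ x₂ := by
  obtain ⟨n₁, hn₁⟩ := H.succ₁
  obtain ⟨n₂, hn₂⟩ := H.succ₂
  rw [H.eqvGen_iff hn₁ hn₂] at h
  rw [H.eqvGen'_iff hn₁ hn₂]
  rcases H.strands.head_or_cycle x₁ with ⟨p, hp, h'⟩ | ⟨q, hq, h'⟩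
  · exact absurd (eqvGen_of_path h') (hc p hp)
  · have h₁ : ReflTransGen r n₁ x₁ := by
      rcases hq.cases_head with h₁ | ⟨c, hc, h₁⟩
      · subst h₁
        rw [H.strands.succ_unique hn₁ h']
      · rw [H.strands.succ_unique hn₁ hc]
        exact h₁.tail h'
    rcases off_of_path (x₂ := x₂) h₁ with h₁ | h₁
    · exact Or.inr h₁
    · exact absurd (Or.inl h₁) h

/-- A surgery on two arcs gives two arcs. -/
theorem arcs (H : Surgery r r' x₁ x₂) {p₁ p₂ : P} (hp₁ : ∀ a, ¬ r p₁ a)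
    (hp₂ : ∀ a, ¬ r p₂ a) (h₁ : EqvGen r x₁ p₁) (h₂ : EqvGen r x₂ p₂) : ¬ EqvGen r' x₁ x₂ := by
  obtain ⟨n₁, hn₁⟩ := H.succ₁
  obtain ⟨n₂, hn₂⟩ := H.succ₂
  rw [H.eqvGen'_iff hn₁ hn₂]
  have key : ∀ {x₁ x₂ n₁ p₁ : P}, Surgery r r' x₁ x₂ → r x₁ n₁ → (∀ a, ¬ r p₁ a) →
      EqvGen r x₁ p₁ → ¬ ReflTransGen (Off r x₁ x₂) n₁ x₁ := by
    intro x₁ x₂ n₁ p₁ H hn₁ hp₁ h₁ h'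
    have := H.not_off_of_cycle hn₁ h' h₁
    rcases this.cases_head with h | ⟨c, hc, _⟩
    · exact hp₁ n₁ (h ▸ hn₁)
    · exact hp₁ c hc.2.2
  rintro (h' | h')
  · exact key H.exchange hn₂ hp₂ h₂ (off_comm r x₁ x₂ ▸ h')
  · exact key H hn₁ hp₁ h₁ h'

/-- The tail of an arc that runs into the surgery stays where it is. -/
theorem tail_stays (H : Surgery r r' x₁ x₂) (h : ¬ EqvGen r x₁ x₂) {t : P} (ht : ∀ a, ¬ r a t)
    (h₁ : EqvGen r t x₁) : EqvGen r' t x₁ := by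
  rcases off_of_path (x₂ := x₂) (H.strands.path_of_tail ht h₁) with h' | h'
  · rw [← H.off_eq] at h'
    exact eqvGen_of_path (path_of_off h')
  · exact absurd (.trans _ _ _ (.symm _ _ h₁) (eqvGen_of_path (path_of_off h'))) h

/-- The head of an arc that runs into the surgery moves to the other arc. -/
theorem head_moves (H : Surgery r r' x₁ x₂) (h : ¬ EqvGen r x₁ x₂) {p : P} (hp : ∀ a, ¬ r p a)
    (h₁ : EqvGen r x₁ p) : EqvGen r' x₂ p := by
  obtain ⟨n₁, hn₁⟩ := H.succ₁
  obtain ⟨n₂, hn₂⟩ := H.succ₂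
  rcases (H.strands.path_of_head hp h₁).cases_head with rfl | ⟨c, hc, h'⟩
  · exact absurd hn₁ (hp n₁)
  obtain rfl := H.strands.succ_unique hc hn₁
  rcases off_or (x₁ := x₁) (x₂ := x₂) _ _ h' with h' | h' | h'
  · rw [← H.off_eq] at h'
    exact .trans _ _ _ (.rel _ _ ((H.iff₂ c).2 hc)) (eqvGen_of_path (path_of_off h'))
  · rcases (H.not_off_of_cycle hn₁ h' h₁).cases_head with h | ⟨c', hc', _⟩
    · exact absurd (h ▸ hn₁) (hp _)
    · exact absurd hc'.2.2 (hp c')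
  · exact absurd ((H.eqvGen_iff hn₁ hn₂).2 (Or.inl h')) h

end Surgery

/-! ### Oriented smoothings -/

namespace Layer

variable (L : Layer) (one : Prop)

/-- The other end of the strand of a smoothed layer that starts at a given end. -/
noncomputable def mate : ℕ ⊕ ℕ → ℕ ⊕ ℕ :=
  open Classical in
  match L.kind with
  | .cup => Sum.elim (fun i => if i < L.pos then .inr i else .inr (i + 2))
      (fun i => if i < L.pos then .inl i else if i = L.pos then .inr (L.pos + 1) else
        if i = L.pos + 1 then .inr L.pos else .inl (i - 2))
  | .cap => Sum.elim (fun i => if i < L.pos then .inr i else if i = L.pos then .inl (L.pos + 1) else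
        if i = L.pos + 1 then .inl L.pos else .inr (i - 2))
      (fun i => if i < L.pos then .inl i else .inl (i + 2))
  | .cross b =>
      if b = true ↔ one then
        Sum.elim (fun i => if i = L.pos then .inl (L.pos + 1) else
            if i = L.pos + 1 then .inl L.pos else .inr i)
          (fun i => if i = L.pos then .inr (L.pos + 1) else
            if i = L.pos + 1 then .inr L.pos else .inl i)
      else Sum.elim Sum.inr Sum.inl

variable {L one}

theorem Strand.mate_eq {x y : ℕ ⊕ ℕ} (h : L.Strand x y) :
    L.mate one x = y ∧ L.mate one y = x := by
  cases h with
  | left i h =>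
    rcases hk : L.kind with _ | _ | b <;> simp only [mate, hk]
    · simp [h]
    · simp [h]
    · split_ifs <;> simp [h.ne, (show i ≠ L.pos + 1 by omega)]
  | cup_right i hL h =>
    simp [mate, hL, h, (show ¬ i + 2 < L.pos by omega), (show i + 2 ≠ L.pos by omega),
      (show i + 1 ≠ L.pos by omega)]
  | cup_turn hL => simp [mate, hL]
  | cap_right i hL h =>
    simp [mate, hL, h, (show ¬ i + 2 < L.pos by omega), (show i + 2 ≠ L.pos by omega),
      (show i + 1 ≠ L.pos by omega)]
  | cap_turn hL => simp [mate, hL]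
  | cross_right i b hL h =>
    simp only [mate, hL]
    split_ifs <;> simp [(show i ≠ L.pos by omega), (show i ≠ L.pos + 1 by omega)]

/-- The strands of a smoothed layer are part of an involution of its ends, so at most one strand
meets an end. This gives uniqueness of successors. -/
theorem SmoothStrand.mate_eq {x y : ℕ ⊕ ℕ} (h : L.SmoothStrand one x y) :
    L.mate one x = y ∧ L.mate one y = x := by
  cases h with
  | strand h => exact h.mate_eq
  | vertical_left b hL h =>
    simp [mate, hL, h, show ¬ ((¬ one) ↔ one) by tauto]
  | vertical_right b hL h =>
    simp [mate, hL, h, show ¬ ((¬ one) ↔ one) by tauto]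
  | horizontal_bottom b hL h => simp [mate, hL, h]
  | horizontal_top b hL h => simp [mate, hL, h]

/-- The end of a layer lies between the ends of the neighbouring levels. -/
def InRange (m m' : ℕ) : ℕ ⊕ ℕ → Prop := Sum.elim (· < m) (· < m')

/-- The complement of `SmoothStrand.mate_eq`: every end carries a strand, so a strand of the diagram
stops only at the boundary. -/
theorem exists_smoothStrand {m m' : ℕ} (hL : L.Fits m m') {x : ℕ ⊕ ℕ} (hx : InRange m m' x) :
    ∃ y, InRange m m' y ∧ (L.SmoothStrand one x y ∨ L.SmoothStrand one y x) := by
  rcases hk : L.kind with _ | _ | b <;> simp only [Fits, hk] at hL <;> rcases x with i | i <;>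
    simp only [InRange, Sum.elim_inl, Sum.elim_inr] at hx
  · by_cases hi : i < L.pos
    · exact ⟨.inr i, by simp [InRange]; omega, Or.inl (.strand (.left i hi))⟩
    · exact ⟨.inr (i + 2), by simp [InRange]; omega,
        Or.inl (.strand (.cup_right i hk (not_lt.1 hi)))⟩
  · by_cases hi : i < L.pos
    · exact ⟨.inl i, by simp [InRange]; omega, Or.inr (.strand (.left i hi))⟩
    · by_cases h₁ : i = L.pos
      · subst h₁
        exact ⟨.inr (L.pos + 1), by simp [InRange]; omega, Or.inl (.strand (.cup_turn hk))⟩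
      · by_cases h₂ : i = L.pos + 1
        · subst h₂
          exact ⟨.inr L.pos, by simp [InRange]; omega, Or.inr (.strand (.cup_turn hk))⟩
        · obtain ⟨i, rfl⟩ : ∃ a, i = a + 2 := ⟨i - 2, by omega⟩
          exact ⟨.inl i, by simp [InRange]; omega,
            Or.inr (.strand (.cup_right i hk (by omega)))⟩
  · by_cases hi : i < L.pos
    · exact ⟨.inr i, by simp [InRange]; omega, Or.inl (.strand (.left i hi))⟩
    · by_cases h₁ : i = L.pos
      · subst h₁
        exact ⟨.inl (L.pos + 1), by simp [InRange]; omega, Or.inl (.strand (.cap_turn hk))⟩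
      · by_cases h₂ : i = L.pos + 1
        · subst h₂
          exact ⟨.inl L.pos, by simp [InRange]; omega, Or.inr (.strand (.cap_turn hk))⟩
        · obtain ⟨i, rfl⟩ : ∃ a, i = a + 2 := ⟨i - 2, by omega⟩
          exact ⟨.inr i, by simp [InRange]; omega,
            Or.inl (.strand (.cap_right i hk (by omega)))⟩
  · by_cases hi : i < L.pos
    · exact ⟨.inl i, by simp [InRange]; omega, Or.inr (.strand (.left i hi))⟩
    · exact ⟨.inl (i + 2), by simp [InRange]; omega,
        Or.inr (.strand (.cap_right i hk (not_lt.1 hi)))⟩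
  · by_cases hi : i < L.pos
    · exact ⟨.inr i, by simp [InRange]; omega, Or.inl (.strand (.left i hi))⟩
    · by_cases h₁ : i = L.pos
      · subst h₁
        by_cases ho : b = true ↔ one
        · exact ⟨.inl (L.pos + 1), by simp [InRange]; omega, Or.inl (.horizontal_bottom b hk ho)⟩
        · exact ⟨.inr L.pos, by simp [InRange]; omega, Or.inl (.vertical_left b hk (by tauto))⟩
      · by_cases h₂ : i = L.pos + 1
        · subst h₂
          by_cases ho : b = true ↔ one
          · exact ⟨.inl L.pos, by simp [InRange]; omega, Or.inr (.horizontal_bottom b hk ho)⟩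
          · exact ⟨.inr (L.pos + 1), by simp [InRange]; omega,
              Or.inl (.vertical_right b hk (by tauto))⟩
        · exact ⟨.inr i, by simp [InRange]; omega,
            Or.inl (.strand (.cross_right i b hk (by omega)))⟩
  · by_cases hi : i < L.pos
    · exact ⟨.inl i, by simp [InRange]; omega, Or.inr (.strand (.left i hi))⟩
    · by_cases h₁ : i = L.pos
      · subst h₁
        by_cases ho : b = true ↔ one
        · exact ⟨.inr (L.pos + 1), by simp [InRange]; omega, Or.inl (.horizontal_top b hk ho)⟩
        · exact ⟨.inl L.pos, by simp [InRange]; omega, Or.inr (.vertical_left b hk (by tauto))⟩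
      · by_cases h₂ : i = L.pos + 1
        · subst h₂
          by_cases ho : b = true ↔ one
          · exact ⟨.inr L.pos, by simp [InRange]; omega, Or.inr (.horizontal_top b hk ho)⟩
          · exact ⟨.inl (L.pos + 1), by simp [InRange]; omega,
              Or.inr (.vertical_right b hk (by tauto))⟩
        · exact ⟨.inl i, by simp [InRange]; omega,
            Or.inr (.strand (.cross_right i b hk (by omega)))⟩

end Layer

namespace TangleDiagram

theorem shadedUp_succ (ε : ℤˣ) (i : ℕ) : ShadedUp ε (i + 1) ↔ ¬ ShadedUp ε i := by
  rw [ShadedUp, ShadedUp, pow_succ]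
  rcases neg_one_pow_eq_or ℤˣ i with h | h <;> rcases Int.units_eq_one_or ε with h' | h' <;>
    rw [h, h'] <;> decide

theorem shadedUp_neg (ε : ℤˣ) (i : ℕ) : ShadedUp (-ε) i ↔ ¬ ShadedUp ε i := by
  rw [ShadedUp, ShadedUp]
  rcases neg_one_pow_eq_or ℤˣ i with h | h <;> rcases Int.units_eq_one_or ε with h' | h' <;>
    rw [h, h'] <;> decide

/-- The oriented smoothings run through the given end into the layer. -/
def Enters (ε : ℤˣ) : ℕ ⊕ ℕ → Prop := Sum.elim (ShadedUp ε) (fun i => ¬ ShadedUp ε i)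

theorem enters_neg (ε : ℤˣ) (x : ℕ ⊕ ℕ) : Enters (-ε) x ↔ ¬ Enters ε x := by
  rcases x with i | i <;> simp only [Enters, Sum.elim_inl, Sum.elim_inr, shadedUp_neg]

/-- Coherence of the checkerboard orientation: a strand between bottom and top keeps the parity of
the position, even past a cup or a cap, and a turn joins neighbouring positions. This holds for both
smoothings of a crossing. -/
theorem enters_iff (ε : ℤˣ) {L : Layer} {one : Prop} {x y : ℕ ⊕ ℕ} (h : L.SmoothStrand one x y) :
    Enters ε x ↔ ¬ Enters ε y := by
  cases h with
  | strand h =>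
    cases h <;> simp only [Enters, Sum.elim_inl, Sum.elim_inr, shadedUp_succ, not_not]
  | _ => simp only [Enters, Sum.elim_inl, Sum.elim_inr, shadedUp_succ, not_not]

variable {p q : ℕ} (T : TangleDiagram p q) (ε : ℤˣ)

/-- The crossing in the layer `l`, if there is one, belongs to `α`. -/
abbrev OneAt (α : Finset T.Crossing) (l : Fin T.height) : Prop :=
  ∃ h : (T.layer l).IsCrossing, (⟨l, h⟩ : T.Crossing) ∈ α

/-- The oriented smoothing `D_α` runs through a strand of a layer from `P` to `Q`. -/
def Next (α : Finset T.Crossing) (P Q : T.Point) : Prop :=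
  ∃ (l : Fin T.height) (x y : ℕ ⊕ ℕ),
    ((T.layer l).SmoothStrand (T.OneAt α l) x y ∨ (T.layer l).SmoothStrand (T.OneAt α l) y x) ∧
      T.IsEnd l x P ∧ T.IsEnd l y Q ∧ Enters ε x

variable {T ε} {α : Finset T.Crossing}

/-- Changing the sign of `ε` reverses all strands, so statements about predecessors and tails follow
from those about successors and heads. -/
theorem next_neg {P Q : T.Point} : T.Next (-ε) α P Q ↔ T.Next ε α Q P := by
  have key : ∀ ε P Q, T.Next ε α Q P → T.Next (-ε) α P Q := by
    rintro ε P Q ⟨l, x, y, h, hx, hy, he⟩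
    refine ⟨l, y, x, h.symm, hy, hx, ?_⟩
    rw [enters_neg]
    rcases h with h | h
    · exact (enters_iff ε h).1 he
    · exact fun h' => (enters_iff ε h).1 h' he
  exact ⟨fun h => by simpa using key (-ε) Q P h, key ε P Q⟩

/-- A point runs into a single layer: the one above it if it points upwards, the one below it
otherwise. Hence the point determines the layer and the end. -/
theorem enters_ne {l : Fin T.height} {x : ℕ ⊕ ℕ} {P : T.Point} (h : T.IsEnd l x P)
    (he : Enters ε x) : (ShadedUp ε P.2 ∧ x = .inl P.2 ∧ P.1 = l.castSucc) ∨
      (¬ ShadedUp ε P.2 ∧ x = .inr P.2 ∧ P.1 = l.succ) := by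
  rcases x with i | i
  · obtain ⟨h₁, rfl⟩ := h
    exact Or.inl ⟨he, rfl, h₁⟩
  · obtain ⟨h₁, rfl⟩ := h
    exact Or.inr ⟨he, rfl, h₁⟩

theorem isEnd_unique {l : Fin T.height} {x : ℕ ⊕ ℕ} {P Q : T.Point} (h : T.IsEnd l x P)
    (h' : T.IsEnd l x Q) : P = Q := by
  obtain ⟨a, i⟩ := P
  obtain ⟨b, j⟩ := Q
  rcases x with x | x <;> obtain ⟨h₁, h₂⟩ := h <;> obtain ⟨h₃, h₄⟩ := h' <;>
    dsimp only at h₁ h₂ h₃ h₄ <;> subst h₁ <;> subst h₃ <;>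
    exact congrArg (Sigma.mk _) (Fin.ext (h₂.trans h₄.symm))

theorem next_unique {P Q R : T.Point} (h : T.Next ε α P Q) (h' : T.Next ε α P R) : Q = R := by
  obtain ⟨l, x, y, h, hx, hy, he⟩ := h
  obtain ⟨l', x', y', h', hx', hy', he'⟩ := h'
  have hxl : l = l' ∧ x = x' := by
    rcases enters_ne hx he with ⟨a, b, c⟩ | ⟨a, b, c⟩ <;>
      rcases enters_ne hx' he' with ⟨a', b', c'⟩ | ⟨a', b', c'⟩
    · exact ⟨Fin.castSucc_injective _ (c.symm.trans c'), b.trans b'.symm⟩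
    · exact absurd a a'
    · exact absurd a' a
    · exact ⟨Fin.succ_injective _ (c.symm.trans c'), b.trans b'.symm⟩
  obtain ⟨rfl, rfl⟩ := hxl
  have hm : ∀ {y}, (T.layer l).SmoothStrand (T.OneAt α l) x y ∨
      (T.layer l).SmoothStrand (T.OneAt α l) y x → (T.layer l).mate (T.OneAt α l) x = y :=
    fun h => h.elim (fun h => h.mate_eq.1) (fun h => h.mate_eq.2)
  obtain rfl := (hm h).symm.trans (hm h')
  exact isEnd_unique hy hy'

theorem isStrands_next : IsStrands (T.Next ε α) :=
  ⟨next_unique, fun h h' => next_unique (next_neg.2 h) (next_neg.2 h')⟩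

theorem exists_isEnd (l : Fin T.height) {y : ℕ ⊕ ℕ}
    (h : Layer.InRange (T.width l.castSucc) (T.width l.succ) y) : ∃ Q, T.IsEnd l y Q := by
  rcases y with i | i
  exacts [⟨⟨l.castSucc, i, h⟩, rfl, rfl⟩, ⟨⟨l.succ, i, h⟩, rfl, rfl⟩]

theorem exists_next {l : Fin T.height} {x : ℕ ⊕ ℕ} {P : T.Point} (h : T.IsEnd l x P)
    (he : Enters ε x) : ∃ Q, T.Next ε α P Q := by
  have hx : Layer.InRange (T.width l.castSucc) (T.width l.succ) x := by
    obtain ⟨a, i⟩ := P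
    rcases x with j | j <;> obtain ⟨h₁, h₂⟩ := h <;> dsimp only at h₁ h₂ <;> subst h₁ h₂ <;>
      exact i.2
  obtain ⟨y, hy, hs⟩ := Layer.exists_smoothStrand (one := T.OneAt α l) (T.fits l) hx
  obtain ⟨Q, hQ⟩ := exists_isEnd l hy
  exact ⟨Q, l, x, y, hs, h, hQ, he⟩

/-- The predicate that defines the heads. -/
def IsHead (_T : TangleDiagram p q) (ε : ℤˣ) (b : Fin p ⊕ Fin q) : Prop :=
  Sum.elim (fun i => ¬ ShadedUp ε i.1) (fun i => ShadedUp ε i.1) b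

/-- The predicate that defines the tails. -/
def IsTail (_T : TangleDiagram p q) (ε : ℤˣ) (b : Fin p ⊕ Fin q) : Prop :=
  Sum.elim (fun i => ShadedUp ε i.1) (fun i => ¬ ShadedUp ε i.1) b

theorem not_isTail (b : Fin p ⊕ Fin q) : ¬ T.IsTail ε b ↔ T.IsHead ε b := by
  rcases b with i | i
  exacts [Iff.rfl, not_not]

theorem isHead_neg (b : Fin p ⊕ Fin q) : T.IsHead (-ε) b ↔ T.IsTail ε b := by
  rcases b with i | i
  · exact (not_congr (shadedUp_neg ε i)).trans not_not
  · exact shadedUp_neg ε i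

/-- The layer into which a point runs is missing only for upward points at the top level and
downward points at the bottom level. -/
theorem not_next_iff (P : T.Point) :
    (∀ Q, ¬ T.Next ε α P Q) ↔ ∃ b, T.IsHead ε b ∧ T.boundary b = P := by
  constructor
  · intro h
    obtain ⟨a, i⟩ := P
    by_cases hu : ShadedUp ε i
    · rcases Fin.eq_castSucc_or_eq_last a with ⟨l, rfl⟩ | rfl
      · obtain ⟨Q, hQ⟩ := exists_next (α := α) (l := l) (x := .inl i) (P := ⟨l.castSucc, i⟩)
          ⟨rfl, rfl⟩ hu
        exact absurd hQ (h Q)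
      · exact ⟨.inr (i.cast T.width_target), hu, rfl⟩
    · rcases Fin.eq_zero_or_eq_succ a with rfl | ⟨l, rfl⟩
      · exact ⟨.inl (i.cast T.width_source), hu, rfl⟩
      · obtain ⟨Q, hQ⟩ := exists_next (α := α) (l := l) (x := .inr i) (P := ⟨l.succ, i⟩)
          ⟨rfl, rfl⟩ hu
        exact absurd hQ (h Q)
  · rintro ⟨b, hb, rfl⟩ Q ⟨l, x, y, -, hx, -, he⟩
    rcases b with i | i <;> rcases enters_ne hx he with ⟨h₁, -, h₂⟩ | ⟨h₁, -, h₂⟩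
    · exact hb h₁
    · exact (Fin.succ_ne_zero l h₂.symm)
    · exact (Fin.castSucc_lt_last l).ne h₂.symm
    · exact h₁ hb

theorem not_prev_iff (P : T.Point) :
    (∀ Q, ¬ T.Next ε α Q P) ↔ ∃ b, T.IsTail ε b ∧ T.boundary b = P := by
  simp only [← next_neg (ε := ε), not_next_iff, isHead_neg]

/-- Every strand is oriented in exactly one of its two directions, so forgetting the orientation
does not change the components. -/
theorem mk_eq_mk_iff {P Q : T.Point} :
    Quot.mk (T.Joined α) P = Quot.mk (T.Joined α) Q ↔ Relation.EqvGen (T.Next ε α) P Q := by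
  constructor
  · intro h
    have h' := Quot.eqvGen_exact h
    clear h
    induction h' with
    | rel P Q h =>
      obtain ⟨l, x, y, h, hx, hy⟩ := h
      by_cases he : Enters ε x
      · exact .rel _ _ ⟨l, x, y, Or.inl h, hx, hy, he⟩
      · refine .symm _ _ (.rel _ _ ⟨l, y, x, Or.inr h, hy, hx, ?_⟩)
        by_contra he'
        exact he ((enters_iff ε h).2 he')
    | refl P => exact .refl P
    | symm P Q _ ih => exact .symm _ _ ih
    | trans P Q R _ _ ih ih' => exact .trans _ _ _ ih ih'
  · intro h
    induction h with
    | rel P Q h =>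
      obtain ⟨l, x, y, h | h, hx, hy, -⟩ := h
      · exact Quot.sound ⟨l, x, y, h, hx, hy⟩
      · exact (Quot.sound ⟨l, y, x, h, hy, hx⟩).symm
    | refl P => rfl
    | symm P Q _ ih => exact ih.symm
    | trans P Q R _ _ ih ih' => exact ih.trans ih'

open Classical in
/-- One of the two ends at which the smoothings run out of the crossing `j`. -/
noncomputable def out₁ (T : TangleDiagram p q) (ε : ℤˣ) (j : T.Crossing) : T.Point :=
  if ShadedUp ε (T.layer j.1).pos then T.top j 0 else T.top j 1

open Classical in
/-- The other one of the two ends at which the smoothings run out of the crossing `j`. -/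
noncomputable def out₂ (T : TangleDiagram p q) (ε : ℤˣ) (j : T.Crossing) : T.Point :=
  if ShadedUp ε (T.layer j.1).pos then T.bottom j 1 else T.bottom j 0

theorem oneAt_iff (j : T.Crossing) : T.OneAt α j.1 ↔ j ∈ α := ⟨fun ⟨_, h⟩ => h, fun h => ⟨j.2, h⟩⟩

/-- The two incoming ends of a crossing are diagonally opposite. The vertical smoothing leads them
to `out₁` and `out₂`; the horizontal one, in `next_horizontal`, exchanges these targets. -/
theorem next_vertical {j : T.Crossing} {b : Bool} (hb : (T.layer j.1).kind = .cross b)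
    (h : b = true ↔ j ∉ α) :
    T.Next ε α (T.in₁ ε j) (T.out₁ ε j) ∧ T.Next ε α (T.in₂ ε j) (T.out₂ ε j) := by
  rw [← oneAt_iff] at h
  by_cases hu : ShadedUp ε (T.layer j.1).pos <;> simp only [in₁, in₂, out₁, out₂, hu, if_true,
    if_false]
  · exact ⟨⟨j.1, _, _, Or.inl (.vertical_left b hb h), T.bottom_isEnd j 0, T.top_isEnd j 0, hu⟩,
      ⟨j.1, _, _, Or.inr (.vertical_right b hb h), T.top_isEnd j 1, T.bottom_isEnd j 1,
        fun h => (shadedUp_succ _ _).1 h hu⟩⟩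
  · exact ⟨⟨j.1, _, _, Or.inl (.vertical_right b hb h), T.bottom_isEnd j 1, T.top_isEnd j 1,
        (shadedUp_succ _ _).2 hu⟩,
      ⟨j.1, _, _, Or.inr (.vertical_left b hb h), T.top_isEnd j 0, T.bottom_isEnd j 0, hu⟩⟩

theorem next_horizontal {j : T.Crossing} {b : Bool} (hb : (T.layer j.1).kind = .cross b)
    (h : b = true ↔ j ∈ α) :
    T.Next ε α (T.in₁ ε j) (T.out₂ ε j) ∧ T.Next ε α (T.in₂ ε j) (T.out₁ ε j) := by
  rw [← oneAt_iff] at h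
  by_cases hu : ShadedUp ε (T.layer j.1).pos <;> simp only [in₁, in₂, out₁, out₂, hu, if_true,
    if_false]
  · exact ⟨⟨j.1, _, _, Or.inl (.horizontal_bottom b hb h), T.bottom_isEnd j 0, T.bottom_isEnd j 1,
        hu⟩,
      ⟨j.1, _, _, Or.inr (.horizontal_top b hb h), T.top_isEnd j 1, T.top_isEnd j 0,
        fun h => (shadedUp_succ _ _).1 h hu⟩⟩
  · exact ⟨⟨j.1, _, _, Or.inr (.horizontal_bottom b hb h), T.bottom_isEnd j 1, T.bottom_isEnd j 0,
        (shadedUp_succ _ _).2 hu⟩,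
      ⟨j.1, _, _, Or.inl (.horizontal_top b hb h), T.top_isEnd j 0, T.top_isEnd j 1, hu⟩⟩

/-- Among the four corners only `in₁` and `in₂` run into the crossing, so every other point keeps
its successor. -/
theorem next_of_agree {β : Finset T.Crossing} {j : T.Crossing}
    (h : ∀ i, i ≠ j → (i ∈ α ↔ i ∈ β)) {P Q : T.Point} (h₁ : P ≠ T.in₁ ε j) (h₂ : P ≠ T.in₂ ε j)
    (hPQ : T.Next ε α P Q) : T.Next ε β P Q := by
  obtain ⟨l, x, y, hs, hP, hQ, he⟩ := hPQ
  by_cases hl : l = j.1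
  · subst hl
    have hb : ∀ d : Fin 2, x = .inl ((T.layer j.1).pos + d.1) → False := by
      rintro d rfl
      obtain rfl := T.eq_bottom d hP
      fin_cases d
      · have hu : ShadedUp ε (T.layer j.1).pos := he
        exact h₁ (by simp [in₁, hu])
      · have hu : ¬ ShadedUp ε (T.layer j.1).pos := (shadedUp_succ _ _).1 he
        exact h₁ (by simp [in₁, hu])
    have ht : ∀ d : Fin 2, x = .inr ((T.layer j.1).pos + d.1) → False := by
      rintro d rfl
      obtain rfl := T.eq_top d hP
      fin_cases d
      · have hu : ¬ ShadedUp ε (T.layer j.1).pos := he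
        exact h₂ (by simp [in₂, hu])
      · have hu : ShadedUp ε (T.layer j.1).pos := not_not.1 fun h => he ((shadedUp_succ _ _).2 h)
        exact h₂ (by simp [in₂, hu])
    rcases hs with hs | hs
    · cases hs with
      | strand h => exact ⟨_, _, _, Or.inl (.strand h), hP, hQ, he⟩
      | vertical_left => exact (hb 0 rfl).elim
      | vertical_right => exact (hb 1 rfl).elim
      | horizontal_bottom => exact (hb 0 rfl).elim
      | horizontal_top => exact (ht 0 rfl).elim
    · cases hs with
      | strand h => exact ⟨_, _, _, Or.inr (.strand h), hP, hQ, he⟩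
      | vertical_left => exact (ht 0 rfl).elim
      | vertical_right => exact (ht 1 rfl).elim
      | horizontal_bottom => exact (hb 1 rfl).elim
      | horizontal_top => exact (ht 1 rfl).elim
  · have e : T.OneAt α l ↔ T.OneAt β l :=
      exists_congr fun hc => h ⟨l, hc⟩ (fun h' => hl (congrArg Subtype.val h'))
    exact ⟨l, x, y, propext e ▸ hs, hP, hQ, he⟩

theorem in₁_ne_in₂ (j : T.Crossing) : T.in₁ ε j ≠ T.in₂ ε j := by
  have h : ∀ d d', T.bottom j d ≠ T.top j d' := fun d d' h =>
    (Fin.castSucc_lt_succ (i := j.1)).ne (congrArg Sigma.fst h)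
  simp only [in₁, in₂]
  split_ifs
  exacts [h _ _, h _ _]

open Classical in
/-- The smoothings `D_α` and `D_{α ⊔ {j}}` differ by a surgery. -/
theorem next_surgery (ε : ℤˣ) {j : T.Crossing} (hj : j ∉ α) :
    Surgery (T.Next ε α) (T.Next ε (insert j α)) (T.in₁ ε j) (T.in₂ ε j) := by
  have key : ∃ a b, T.Next ε α (T.in₁ ε j) a ∧ T.Next ε α (T.in₂ ε j) b ∧
      T.Next ε (insert j α) (T.in₁ ε j) b ∧ T.Next ε (insert j α) (T.in₂ ε j) a := by
    obtain ⟨b, hb⟩ := j.2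
    have hj' := Finset.mem_insert_self j α
    -- The value of `b` decides whether the `0`-smoothing is the vertical one or the horizontal one.
    by_cases h : b = true
    · have h₁ := next_vertical (ε := ε) hb (iff_of_true h hj)
      have h₂ := next_horizontal (ε := ε) hb (iff_of_true h hj')
      exact ⟨_, _, h₁.1, h₁.2, h₂.1, h₂.2⟩
    · have h₁ := next_horizontal (ε := ε) hb (iff_of_false h hj)
      have h₂ := next_vertical (ε := ε) hb (iff_of_false h (not_not.2 hj'))
      exact ⟨_, _, h₁.1, h₁.2, h₂.1, h₂.2⟩
  obtain ⟨a, b, h₁, h₂, h₃, h₄⟩ := key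
  refine ⟨isStrands_next, in₁_ne_in₂ j, ⟨a, h₁⟩, ⟨b, h₂⟩, fun c => ?_, fun c => ?_,
    fun P Q hP hP' => ⟨next_of_agree (fun i hi => by simp [hi]) hP hP',
      next_of_agree (fun i hi => by simp [hi]) hP hP'⟩⟩
  · exact ⟨fun h => next_unique h₃ h ▸ h₂, fun h => next_unique h₂ h ▸ h₃⟩
  · exact ⟨fun h => next_unique h₄ h ▸ h₁, fun h => next_unique h₁ h ▸ h₄⟩

theorem boundary_next_head {b : Fin p ⊕ Fin q} (hb : T.IsHead ε b) (Q : T.Point) :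
    ¬ T.Next ε α (T.boundary b) Q := (not_next_iff _).2 ⟨b, hb, rfl⟩ Q

theorem boundary_next_tail {b : Fin p ⊕ Fin q} (hb : T.IsTail ε b) (Q : T.Point) :
    ¬ T.Next ε α Q (T.boundary b) := (not_prev_iff _).2 ⟨b, hb, rfl⟩ Q

/-- In a diagram of height `0` a source point coincides with a target point, so `boundary` itself
need not be injective. Such a point is a head on one side and a tail on the other, by its parity. -/
theorem boundary_injOn_head {b b' : Fin p ⊕ Fin q} (hb : T.IsHead ε b) (hb' : T.IsHead ε b')
    (h : T.boundary b = T.boundary b') : b = b' := by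
  have h' : (T.boundary b).2.1 = (T.boundary b').2.1 := by rw [h]
  rcases b with i | i <;> rcases b' with j | j
  · exact congrArg _ (Fin.ext h')
  · exact (hb (by rw [show i.1 = j.1 from h']; exact hb')).elim
  · exact (hb' (by rw [← show i.1 = j.1 from h']; exact hb)).elim
  · exact congrArg _ (Fin.ext h')

theorem boundary_injOn_tail {b b' : Fin p ⊕ Fin q} (hb : T.IsTail ε b) (hb' : T.IsTail ε b')
    (h : T.boundary b = T.boundary b') : b = b' :=
  boundary_injOn_head ((isHead_neg b).2 hb) ((isHead_neg b').2 hb') h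

/-- The component of the point `P` in the smoothing `D_α`. -/
abbrev cls (α : Finset T.Crossing) (P : T.Point) : (T.family α).ι := Quot.mk (T.Joined α) P

end TangleDiagram

/-! ### The maps of the saddles of a tangle diagram -/

namespace TangleDiagram

open Relation

variable {p q : ℕ} {T : TangleDiagram p q} {ε : ℤˣ} {α : Finset T.Crossing}

theorem cls_eq_iff {P Q : T.Point} (ε : ℤˣ) :
    T.cls α P = T.cls α Q ↔ EqvGen (T.Next ε α) P Q := mk_eq_mk_iff

/-- The point of the diagram at a tail. -/
def tailPt (t : T.Tail ε) : T.Point := T.boundary t.1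

/-- The point of the diagram at a head. -/
def headPt (h : T.Head ε) : T.Point := T.boundary h.1

theorem tailPt_spec (α : Finset T.Crossing) (t : T.Tail ε) (Q : T.Point) :
    ¬ T.Next ε α Q (tailPt t) := boundary_next_tail t.2 Q

theorem headPt_spec (α : Finset T.Crossing) (h : T.Head ε) (Q : T.Point) :
    ¬ T.Next ε α (headPt h) Q := boundary_next_head h.2 Q

theorem exists_headPt {P : T.Point} (hP : ∀ Q, ¬ T.Next ε α P Q) : ∃ h : T.Head ε, headPt h = P :=
  let ⟨b, hb, e⟩ := (not_next_iff P).1 hP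
  ⟨⟨b, hb⟩, e⟩

theorem exists_tailPt {P : T.Point} (hP : ∀ Q, ¬ T.Next ε α Q P) : ∃ t : T.Tail ε, tailPt t = P :=
  let ⟨b, hb, e⟩ := (not_prev_iff P).1 hP
  ⟨⟨b, hb⟩, e⟩

theorem headPt_injective : Function.Injective (headPt (T := T) (ε := ε)) := fun h h' e =>
  Subtype.ext (boundary_injOn_head h.2 h'.2 e)

theorem tailPt_injective : Function.Injective (tailPt (T := T) (ε := ε)) := fun h h' e =>
  Subtype.ext (boundary_injOn_tail h.2 h'.2 e)

theorem tail_eq {t t' : T.Tail ε} (h : EqvGen (T.Next ε α) (tailPt t) (tailPt t')) : t = t' :=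
  tailPt_injective (isStrands_next.tail_unique (tailPt_spec α t) (tailPt_spec α t') h)

theorem head_eq {t t' : T.Head ε} (h : EqvGen (T.Next ε α) (headPt t) (headPt t')) : t = t' :=
  headPt_injective (isStrands_next.head_unique (headPt_spec α t) (headPt_spec α t') h)

theorem exists_head (α : Finset T.Crossing) (t : T.Tail ε) :
    ∃ h : T.Head ε, EqvGen (T.Next ε α) (tailPt t) (headPt h) := by
  obtain ⟨P, hP, h⟩ := isStrands_next.exists_head (tailPt_spec α t)
  obtain ⟨b, rfl⟩ := exists_headPt hP
  exact ⟨b, h⟩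

theorem exists_tail (α : Finset T.Crossing) (h : T.Head ε) :
    ∃ t : T.Tail ε, EqvGen (T.Next ε α) (tailPt t) (headPt h) := by
  obtain ⟨P, hP, h⟩ := isStrands_next.exists_tail (headPt_spec α h)
  obtain ⟨b, rfl⟩ := exists_tailPt hP
  exact ⟨b, h⟩

-- A boundary point that is not a tail is a head, from which the strand can be followed back to its
-- tail.
open Classical in
theorem isArc_iff_tail (ε : ℤˣ) (P : T.Point) :
    (T.family α).isArc (T.cls α P) = true ↔
      ∃ t : T.Tail ε, EqvGen (T.Next ε α) (tailPt t) P := by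
  refine (decide_eq_true_iff).trans ⟨?_, ?_⟩
  · rintro ⟨b, hb⟩
    have hb := (cls_eq_iff ε).1 hb
    by_cases h : T.IsTail ε b
    · exact ⟨⟨b, h⟩, hb⟩
    · obtain ⟨t, ht⟩ := exists_tail α ⟨b, (not_isTail b).1 h⟩
      exact ⟨t, ht.trans _ _ _ hb⟩
  · rintro ⟨t, ht⟩
    exact ⟨t.1, (cls_eq_iff ε).2 ht⟩

theorem isArc_iff_head (ε : ℤˣ) (P : T.Point) :
    (T.family α).isArc (T.cls α P) = true ↔
      ∃ h : T.Head ε, EqvGen (T.Next ε α) P (headPt h) := by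
  rw [isArc_iff_tail ε]
  constructor
  · rintro ⟨t, ht⟩
    obtain ⟨h, hh⟩ := exists_head α t
    exact ⟨h, .trans _ _ _ (ht.symm _ _) hh⟩
  · rintro ⟨h, hh⟩
    obtain ⟨t, ht⟩ := exists_tail α h
    exact ⟨t, .trans _ _ _ ht (hh.symm _ _)⟩

theorem tail_isArc (α : Finset T.Crossing) (t : T.Tail ε) :
    (T.family α).isArc (T.cls α (tailPt t)) = true := (isArc_iff_tail ε _).2 ⟨t, .refl _⟩

theorem head_isArc (α : Finset T.Crossing) (h : T.Head ε) :
    (T.family α).isArc (T.cls α (headPt h)) = true := (isArc_iff_head ε _).2 ⟨h, .refl _⟩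

end TangleDiagram

namespace OpenClosedTQFT

open TangleDiagram Relation

variable {k : Type u} [Field k] (Z : OpenClosedTQFT k)
  {p q : ℕ} {T : TangleDiagram p q} (ε : ℤˣ) (α : Finset T.Crossing) (j : T.Crossing)

attribute [local instance] ringSingle algebraSingle

/-- Multiplication by `ı(c)` from the left and from the right agree because `ı(c)` is central. -/
theorem RComm.cComm {X Y : Ob} {S : Z.val X →ₗ[k] Z.val Y} {x : X.ι} {y : Y.ι}
    (h : Z.RComm S x y) (hx : X.isArc x = true) (hy : Y.isArc y = true) : Z.CComm S x y := by
  have e : ∀ {X : Ob} {x : X.ι} (hx : X.isArc x = true) c, Z.cOp X x c = Z.rOp X x hx (Z.zip c) :=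
    fun hx c => (cOp_eq Z hx c).trans (congrArg _ (LinearMap.ext fun a => zip_central Z c a))
  intro c v
  rw [e hx, e hy, h hx hy]

open Classical in
theorem away_isArc (c : Away (T.cls α (T.in₁ ε j)) (T.cls α (T.in₂ ε j))) :
    (away (T.family (insert j α)) (T.cls _ (T.in₁ ε j)) (T.cls _ (T.in₂ ε j))).isArc
      ((T.localChange ε α j).equiv c) = (away (T.family α) (T.cls _ (T.in₁ ε j))
        (T.cls _ (T.in₂ ε j))).isArc c := by
  refine decide_eq_decide.2 ⟨?_, ?_⟩
  · rintro ⟨b, hb⟩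
    refine ⟨b, ?_⟩
    have h := (T.localChange ε α j).symm.map_mk ((T.localChange ε α j).equiv c) hb
    exact h.trans (congrArg Subtype.val ((T.localChange ε α j).equiv.left_inv c))
  · rintro ⟨b, hb⟩
    exact ⟨b, (T.localChange ε α j).map_mk c hb⟩

open Classical in
/-- The linear map of the saddle at the crossing `j`. -/
noncomputable def sadAt : Z.val (T.family α) →ₗ[k] Z.val (T.family (insert j α)) :=
  Z.sad (T.localChange ε α j).equiv (away_isArc ε α j)

variable {ε α j} {P : T.Point}

open Classical in
theorem touches_iff {β : Finset T.Crossing} (P : T.Point) :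
    Surgery.Touches (T.Next ε β) (T.in₁ ε j) (T.in₂ ε j) P ↔
      T.cls β P = T.cls β (T.in₁ ε j) ∨ T.cls β P = T.cls β (T.in₂ ε j) := by
  rw [cls_eq_iff ε, cls_eq_iff ε]
  rfl

open Classical in
/-- The three kinds of saddles. -/
theorem saddle_cases (hj : j ∉ α) :
    (T.cls α (T.in₁ ε j) ≠ T.cls α (T.in₂ ε j) ∧
      T.cls (insert j α) (T.in₁ ε j) = T.cls (insert j α) (T.in₂ ε j)) ∨
    (T.cls α (T.in₁ ε j) = T.cls α (T.in₂ ε j) ∧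
      T.cls (insert j α) (T.in₁ ε j) ≠ T.cls (insert j α) (T.in₂ ε j)) ∨
    (T.cls α (T.in₁ ε j) ≠ T.cls α (T.in₂ ε j) ∧
      T.cls (insert j α) (T.in₁ ε j) ≠ T.cls (insert j α) (T.in₂ ε j)) := by
  have h := (next_surgery ε hj).split
  simp only [← cls_eq_iff] at h
  tauto

-- Two arcs end in heads, and `Surgery.arcs` says that a surgery on two such strands does not join
-- them.
open Classical in
theorem not_arcs_of_merge (hj : j ∉ α) (hy : T.cls (insert j α) (T.in₁ ε j) =
      T.cls (insert j α) (T.in₂ ε j)) :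
    ¬ ((T.family α).isArc (T.cls α (T.in₁ ε j)) = true ∧
      (T.family α).isArc (T.cls α (T.in₂ ε j)) = true) := by
  rintro ⟨h₁, h₂⟩
  obtain ⟨a, ha⟩ := (isArc_iff_head ε _).1 h₁
  obtain ⟨b, hb⟩ := (isArc_iff_head ε _).1 h₂
  exact (next_surgery ε hj).arcs (headPt_spec α a) (headPt_spec α b) ha hb ((cls_eq_iff ε).1 hy)

open Classical in
theorem not_arcs_of_split (hj : j ∉ α) (hx : T.cls α (T.in₁ ε j) = T.cls α (T.in₂ ε j)) :
    ¬ ((T.family (insert j α)).isArc (T.cls (insert j α) (T.in₁ ε j)) = true ∧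
      (T.family (insert j α)).isArc (T.cls (insert j α) (T.in₂ ε j)) = true) := by
  rintro ⟨h₁, h₂⟩
  obtain ⟨a, ha⟩ := (isArc_iff_head ε _).1 h₁
  obtain ⟨b, hb⟩ := (isArc_iff_head ε _).1 h₂
  exact (next_surgery ε hj).symm.arcs (headPt_spec _ a) (headPt_spec _ b) ha hb
    ((cls_eq_iff ε).1 hx)

open Classical in
theorem isArc_of_touches (hj : j ∉ α)
    (hP : Surgery.Touches (T.Next ε α) (T.in₁ ε j) (T.in₂ ε j) P)
    (h : (T.family α).isArc (T.cls α P) = true) :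
    (T.family (insert j α)).isArc (T.cls (insert j α) (T.in₁ ε j)) = true ∨
      (T.family (insert j α)).isArc (T.cls (insert j α) (T.in₂ ε j)) = true := by
  obtain ⟨t, ht⟩ := (isArc_iff_tail ε _).1 h
  rw [isArc_iff_tail ε, isArc_iff_tail ε]
  exact ((next_surgery ε hj).touches (hP.congr ht)).imp (fun h => ⟨t, h⟩) (fun h => ⟨t, h⟩)

open Classical in
theorem isArc_of_touches' (hj : j ∉ α)
    (hP : Surgery.Touches (T.Next ε (insert j α)) (T.in₁ ε j) (T.in₂ ε j) P)
    (h : (T.family (insert j α)).isArc (T.cls (insert j α) P) = true) :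
    (T.family α).isArc (T.cls α (T.in₁ ε j)) = true ∨
      (T.family α).isArc (T.cls α (T.in₂ ε j)) = true := by
  obtain ⟨t, ht⟩ := (isArc_iff_tail ε _).1 h
  rw [isArc_iff_tail ε, isArc_iff_tail ε]
  exact ((next_surgery ε hj).symm.touches (hP.congr ht)).imp (fun h => ⟨t, h⟩) (fun h => ⟨t, h⟩)

-- If one of the four components were a circle, `Surgery.merge`, applied to the surgery or its
-- inverse, would make the two components on the other side equal.
open Classical in
theorem arcs_of_exchange (hj : j ∉ α) (hx : T.cls α (T.in₁ ε j) ≠ T.cls α (T.in₂ ε j))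
    (hy : T.cls (insert j α) (T.in₁ ε j) ≠ T.cls (insert j α) (T.in₂ ε j)) :
    ((T.family α).isArc (T.cls α (T.in₁ ε j)) = true ∧
      (T.family α).isArc (T.cls α (T.in₂ ε j)) = true) ∧
    ((T.family (insert j α)).isArc (T.cls (insert j α) (T.in₁ ε j)) = true ∧
      (T.family (insert j α)).isArc (T.cls (insert j α) (T.in₂ ε j)) = true) := by
  have key : ∀ {α β : Finset T.Crossing} {x₁ x₂ : T.Point},
      Surgery (T.Next ε α) (T.Next ε β) x₁ x₂ → T.cls α x₁ ≠ T.cls α x₂ →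
      T.cls β x₁ ≠ T.cls β x₂ → (T.family α).isArc (T.cls α x₁) = true := by
    intro α β x₁ x₂ H hx hy
    by_contra h
    refine hy ((cls_eq_iff ε).2 (H.merge (fun h => hx ((cls_eq_iff ε).2 h)) fun P hP h' => h ?_))
    obtain ⟨b, rfl⟩ := exists_headPt hP
    exact (isArc_iff_head ε _).2 ⟨b, h'⟩
  have H := next_surgery ε hj
  exact ⟨⟨key H hx hy, key H.exchange hx.symm hy.symm⟩,
    key H.symm hy hx, key H.symm.exchange hy.symm hx.symm⟩

open Classical in
theorem cls_away (hP : ¬ Surgery.Touches (T.Next ε α) (T.in₁ ε j) (T.in₂ ε j) P) :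
    ∃ z : Away (T.cls α (T.in₁ ε j)) (T.cls α (T.in₂ ε j)), z.1 = T.cls α P ∧
      ((T.localChange ε α j).equiv z).1 = T.cls (insert j α) P := by
  rw [touches_iff, not_or] at hP
  exact ⟨⟨T.cls α P, hP⟩, rfl, ((T.localChange ε α j).map_mk ⟨T.cls α P, hP⟩ rfl).symm⟩

open Classical in
theorem sadAt_away (hj : j ∉ α) (hP : ¬ Surgery.Touches (T.Next ε α) (T.in₁ ε j) (T.in₂ ε j) P) :
    Z.CComm (Z.sadAt ε α j) (T.cls α P) (T.cls _ P) ∧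
    Z.LComm (Z.sadAt ε α j) (T.cls α P) (T.cls _ P) ∧
    Z.RComm (Z.sadAt ε α j) (T.cls α P) (T.cls _ P) := by
  obtain ⟨z, hz, hz'⟩ := cls_away hP
  rw [← hz, ← hz']
  rcases saddle_cases hj with ⟨hx, hy⟩ | ⟨hx, hy⟩ | ⟨hx, hy⟩
  · exact Z.sad_merge_away _ _ hx hy z
  · exact Z.sad_split_away _ _ hx hy z
  · obtain ⟨⟨h₁, h₂⟩, h₃, h₄⟩ := arcs_of_exchange hj hx hy
    exact Z.sad_arc_away _ _ hx hy h₁ h₂ h₃ h₄ z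

open Classical in
theorem isArc_merge (hj : j ∉ α)
    (hy : T.cls (insert j α) (T.in₁ ε j) = T.cls (insert j α) (T.in₂ ε j)) :
    ((T.family α).isArc (T.cls α (T.in₁ ε j)) = true →
      (T.family (insert j α)).isArc (T.cls (insert j α) (T.in₁ ε j)) = true) ∧
    ((T.family α).isArc (T.cls α (T.in₂ ε j)) = true →
      (T.family (insert j α)).isArc (T.cls (insert j α) (T.in₁ ε j)) = true) := by
  have h : ∀ {P}, _ → _ → _ := fun {P} => isArc_of_touches (ε := ε) (P := P) hj
  rw [← hy, or_self] at h
  exact ⟨h (Or.inl (.refl _)), h (Or.inr (.refl _))⟩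

open Classical in
theorem isArc_split (hj : j ∉ α) (hx : T.cls α (T.in₁ ε j) = T.cls α (T.in₂ ε j)) :
    (T.family α).isArc (T.cls α (T.in₁ ε j)) =
      ((T.family (insert j α)).isArc (T.cls (insert j α) (T.in₁ ε j)) ||
        (T.family (insert j α)).isArc (T.cls (insert j α) (T.in₂ ε j))) := by
  have h : ∀ {P}, _ → _ → _ := fun {P} => isArc_of_touches' (ε := ε) (P := P) hj
  rw [← hx, or_self] at h
  rw [Bool.eq_iff_iff, Bool.or_eq_true]
  refine ⟨isArc_of_touches hj (Or.inl (.refl _)), ?_⟩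
  rintro (h' | h')
  exacts [h (Or.inl (.refl _)) h', h (Or.inr (.refl _)) h']

open Classical in
theorem sadAt_cComm (hj : j ∉ α) (P : T.Point) :
    Z.CComm (Z.sadAt ε α j) (T.cls α P) (T.cls _ P) := by
  by_cases hP : Surgery.Touches (T.Next ε α) (T.in₁ ε j) (T.in₂ ε j) P
  · have hP' := (touches_iff P).1 ((next_surgery ε hj).touches hP)
    rw [touches_iff] at hP
    rcases saddle_cases hj with ⟨hx, hy⟩ | ⟨hx, hy⟩ | ⟨hx, hy⟩
    · rw [← hy, or_self] at hP'
      have h := Z.sad_merge_cComm (T.localChange ε α j).equiv (away_isArc ε α j) hx hy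
        (isArc_merge hj hy).1 (isArc_merge hj hy).2
      rw [hP']
      rcases hP with hP | hP <;> rw [hP]
      exacts [h.1, h.2]
    · rw [← hx, or_self] at hP
      have hs := isArc_split hj hx
      have h := Z.sad_split_cComm (T.localChange ε α j).equiv (away_isArc ε α j) hx hy
        (fun h => by rw [hs, h, Bool.true_or]) (fun h => by rw [hs, h, Bool.or_true])
      rw [hP]
      rcases hP' with hP' | hP' <;> rw [hP']
      exacts [h.1, h.2]
    · obtain ⟨⟨h₁, h₂⟩, h₃, h₄⟩ := arcs_of_exchange hj hx hy
      have h := Z.sad_arc_cComm (T.localChange ε α j).equiv (away_isArc ε α j) hx hy h₁ h₂ h₃ h₄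
      have h' := Z.sad_arc_rComm (T.localChange ε α j).equiv (away_isArc ε α j) hx hy h₁ h₂ h₃ h₄
      -- In an exchange `P` may lie before or behind the saddle on its old arc. In the first case it
      -- stays with the tail and `sad_arc_cComm` applies; in the second it moves with the head, and
      -- the right multiplications of `sad_arc_rComm` are used.
      rcases hP with hP | hP <;> rcases hP' with hP' | hP' <;> rw [hP, hP']
      · exact h.1
      · exact h'.1.cComm Z h₁ h₄
      · exact h'.2.cComm Z h₂ h₃
      · exact h.2
  · exact (Z.sadAt_away hj hP).1

-- Left multiplication belongs to the tail: in an exchange the tail stays on its strand by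
-- `Surgery.tail_stays`, in accordance with `sad_arc_lComm`.
open Classical in
theorem sadAt_lComm (hj : j ∉ α) (t : T.Tail ε) :
    Z.LComm (Z.sadAt ε α j) (T.cls α (tailPt t)) (T.cls _ (tailPt t)) := by
  by_cases hP : Surgery.Touches (T.Next ε α) (T.in₁ ε j) (T.in₂ ε j) (tailPt t)
  · have hP' := (touches_iff (tailPt t)).1 ((next_surgery ε hj).touches hP)
    have hP₀ := hP
    rw [touches_iff] at hP
    rcases saddle_cases hj with ⟨hx, hy⟩ | ⟨hx, hy⟩ | ⟨hx, hy⟩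
    · rw [← hy, or_self] at hP'
      have h := (Z.sad_merge_lComm (T.localChange ε α j).equiv (away_isArc ε α j) hx hy
        (not_arcs_of_merge hj hy)).1
      rw [hP']
      rcases hP with hP | hP <;> rw [hP]
      exacts [h.1, h.2]
    · rw [← hx, or_self] at hP
      have hn := not_arcs_of_split hj hx
      have ht := tail_isArc (insert j α) t
      rw [hP]
      -- The piece that contains the tail is an arc, so the other piece of the splitting is a
      -- circle.
      rcases hP' with hP' | hP' <;> rw [hP'] at ht ⊢
      · have h := Z.sad_split_lComm₁ (T.localChange ε α j).equiv (away_isArc ε α j) hx hy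
          (Bool.eq_false_of_not_eq_true fun h => hn ⟨ht, h⟩)
        exact h.1
      · have h := Z.sad_split_lComm₂ (T.localChange ε α j).equiv (away_isArc ε α j) hx hy
          (Bool.eq_false_of_not_eq_true fun h => hn ⟨h, ht⟩)
        exact h.1
    · obtain ⟨⟨h₁, h₂⟩, h₃, h₄⟩ := arcs_of_exchange hj hx hy
      have h := Z.sad_arc_lComm (T.localChange ε α j).equiv (away_isArc ε α j) hx hy h₁ h₂ h₃ h₄
      have hx' := fun h => hx ((cls_eq_iff ε).2 h)
      rcases hP₀ with hP₀ | hP₀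
      · have := (next_surgery ε hj).tail_stays hx' (tailPt_spec α t) hP₀
        have e₁ : T.cls α (tailPt t) = T.cls α (T.in₁ ε j) := (cls_eq_iff ε).2 hP₀
        have e₂ : T.cls (insert j α) (tailPt t) = T.cls _ (T.in₁ ε j) := (cls_eq_iff ε).2 this
        rw [e₁, e₂]
        exact h.1
      · have := (next_surgery ε hj).exchange.tail_stays (fun h => hx' (h.symm _ _))
          (tailPt_spec α t) hP₀
        have e₁ : T.cls α (tailPt t) = T.cls α (T.in₂ ε j) := (cls_eq_iff ε).2 hP₀
        have e₂ : T.cls (insert j α) (tailPt t) = T.cls _ (T.in₂ ε j) := (cls_eq_iff ε).2 this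
        rw [e₁, e₂]
        exact h.2
  · exact (Z.sadAt_away hj hP).2.1

-- Right multiplication belongs to the head: in an exchange the head passes to the other arc by
-- `Surgery.head_moves`, in accordance with `sad_arc_rComm`.
open Classical in
theorem sadAt_rComm (hj : j ∉ α) (t : T.Head ε) :
    Z.RComm (Z.sadAt ε α j) (T.cls α (headPt t)) (T.cls _ (headPt t)) := by
  by_cases hP : Surgery.Touches (T.Next ε α) (T.in₁ ε j) (T.in₂ ε j) (headPt t)
  · have hP' := (touches_iff (headPt t)).1 ((next_surgery ε hj).touches hP)
    have hP₀ := hP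
    rw [touches_iff] at hP
    rcases saddle_cases hj with ⟨hx, hy⟩ | ⟨hx, hy⟩ | ⟨hx, hy⟩
    · rw [← hy, or_self] at hP'
      have h := (Z.sad_merge_lComm (T.localChange ε α j).equiv (away_isArc ε α j) hx hy
        (not_arcs_of_merge hj hy)).2
      rw [hP']
      rcases hP with hP | hP <;> rw [hP]
      exacts [h.1, h.2]
    · rw [← hx, or_self] at hP
      have hn := not_arcs_of_split hj hx
      have ht := head_isArc (insert j α) t
      rw [hP]
      rcases hP' with hP' | hP' <;> rw [hP'] at ht ⊢
      · have h := Z.sad_split_lComm₁ (T.localChange ε α j).equiv (away_isArc ε α j) hx hy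
          (Bool.eq_false_of_not_eq_true fun h => hn ⟨ht, h⟩)
        exact h.2
      · have h := Z.sad_split_lComm₂ (T.localChange ε α j).equiv (away_isArc ε α j) hx hy
          (Bool.eq_false_of_not_eq_true fun h => hn ⟨h, ht⟩)
        exact h.2
    · obtain ⟨⟨h₁, h₂⟩, h₃, h₄⟩ := arcs_of_exchange hj hx hy
      have h := Z.sad_arc_rComm (T.localChange ε α j).equiv (away_isArc ε α j) hx hy h₁ h₂ h₃ h₄
      have hx' := fun h => hx ((cls_eq_iff ε).2 h)
      rcases hP₀ with hP₀ | hP₀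
      · have := (next_surgery ε hj).head_moves hx' (headPt_spec α t) (hP₀.symm _ _)
        have e₁ : T.cls α (headPt t) = T.cls α (T.in₁ ε j) := (cls_eq_iff ε).2 hP₀
        have e₂ : T.cls (insert j α) (T.in₂ ε j) = T.cls _ (headPt t) := (cls_eq_iff ε).2 this
        rw [e₁, ← e₂]
        exact h.1
      · have := (next_surgery ε hj).exchange.head_moves (fun h => hx' (h.symm _ _))
          (headPt_spec α t) (hP₀.symm _ _)
        have e₁ : T.cls α (headPt t) = T.cls α (T.in₂ ε j) := (cls_eq_iff ε).2 hP₀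
        have e₂ : T.cls (insert j α) (T.in₁ ε j) = T.cls _ (headPt t) := (cls_eq_iff ε).2 this
        rw [e₁, ← e₂]
        exact h.2
  · exact (Z.sadAt_away hj hP).2.2

end OpenClosedTQFT

/-! ### Products of transpositions -/

namespace TranspositionProduct

open Equiv

variable {τ : Type*} [DecidableEq τ]

/-- A product of two disjoint transpositions has no other factorization into two transpositions, up
to their order. It suffices to evaluate at the four points. -/
theorem cases_disjoint {a b c d a' b' c' d' : τ} (hab : a ≠ b)
    (hcd : c ≠ d) (hac : a ≠ c) (had : a ≠ d) (hbc : b ≠ c) (hbd : b ≠ d)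
    (h : ∀ x, swap a b (swap c d x) = swap a' b' (swap c' d' x)) :
    ((a' = a ∧ b' = b ∨ a' = b ∧ b' = a) ∧ (c' = c ∧ d' = d ∨ c' = d ∧ d' = c)) ∨
    ((c' = a ∧ d' = b ∨ c' = b ∧ d' = a) ∧ (a' = c ∧ b' = d ∨ a' = d ∧ b' = c)) := by
  have h₁ := h a
  have h₂ := h b
  have h₃ := h c
  have h₄ := h d
  simp only [swap_apply_def] at h₁ h₂ h₃ h₄
  grind (splits := 30)

/-- A 3-cycle has exactly three factorizations into two transpositions, permuted cyclically. -/
theorem cases_cycle {a b d a' b' c' d' : τ} (hab : a ≠ b)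
    (hbd : b ≠ d) (had : a ≠ d) (hne : a' ≠ b')
    (h : ∀ x, swap a b (swap b d x) = swap a' b' (swap c' d' x)) :
    ((a' = a ∧ b' = b ∨ a' = b ∧ b' = a) ∧ (c' = b ∧ d' = d ∨ c' = d ∧ d' = b)) ∨
    ((a' = b ∧ b' = d ∨ a' = d ∧ b' = b) ∧ (c' = d ∧ d' = a ∨ c' = a ∧ d' = d)) ∨
    ((a' = d ∧ b' = a ∨ a' = a ∧ b' = d) ∧ (c' = a ∧ d' = b ∨ c' = b ∧ d' = a)) := by
  have h₁ := h a
  have h₂ := h b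
  have h₄ := h d
  simp only [swap_apply_def] at h₁ h₂ h₄
  grind (splits := 30)

theorem swap_eq_swap {a b c d : τ} (hab : a ≠ b) (h : swap a b = swap c d) :
    c = a ∧ d = b ∨ c = b ∧ d = a := by
  have h₁ := congrArg (· a) h
  simp only [swap_apply_left, swap_apply_def] at h₁
  grind

theorem congr_swap {M : Type*} (D : τ → τ → M) (symm : ∀ a b, a ≠ b → D a b = D b a) {a b c d : τ} (hab : a ≠ b)
    (h : swap a b = swap c d) : D a b = D c d := by
  rcases swap_eq_swap hab h with ⟨rfl, rfl⟩ | ⟨rfl, rfl⟩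
  exacts [rfl, symm _ _ hab]

variable {M : Type*} [Monoid M] (D : τ → τ → M)

/-- A product of two transpositions other than `1` determines the product of the elements assigned
to the transpositions. -/
theorem mul_eq_mul (symm : ∀ a b, a ≠ b → D a b = D b a)
    (comm : ∀ a b c d, a ≠ b → c ≠ d → a ≠ c → a ≠ d → b ≠ c → b ≠ d →
      D a b * D c d = D c d * D a b)
    (cyclic : ∀ a b c, a ≠ b → b ≠ c → a ≠ c → D a b * D b c = D b c * D c a)
    {a b c d a' b' c' d' : τ} (hab : a ≠ b) (hcd : c ≠ d) (hab' : a' ≠ b')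
    (hne : swap a b ≠ swap c d) (h : swap a b * swap c d = swap a' b' * swap c' d') :
    D a b * D c d = D a' b' * D c' d' := by
  -- The 3-cycle in normal form: two applications of `cyclic` identify the products of all three
  -- factorizations. The other positions of the common point are brought to this form by `symm`.
  have key : ∀ {a b d : τ}, a ≠ b → b ≠ d → a ≠ d →
      swap a b * swap b d = swap a' b' * swap c' d' → D a b * D b d = D a' b' * D c' d' := by
    intro a b d hab hbd had h
    have c₁ := cyclic a b d hab hbd had
    have c₂ := cyclic b d a hbd had.symm hab.symm
    rcases cases_cycle hab hbd had hab' (fun x => congrArg (· x) h) with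
      ⟨h₁, h₂⟩ | ⟨h₁, h₂⟩ | ⟨h₁, h₂⟩ <;> rcases h₁ with ⟨rfl, rfl⟩ | ⟨rfl, rfl⟩ <;>
      rcases h₂ with ⟨rfl, rfl⟩ | ⟨rfl, rfl⟩ <;> grind
  by_cases h₁ : b = c
  · subst h₁
    exact key hab hcd (fun h => hne (by rw [h, swap_comm])) h
  by_cases h₂ : b = d
  · subst h₂
    rw [symm c b hcd]
    exact key hab hcd.symm (fun h => hne (by rw [h])) (by rw [swap_comm b c, h])
  by_cases h₃ : a = c
  · subst h₃
    rw [symm a b hab]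
    exact key hab.symm hcd h₂ (by rw [swap_comm b a, h])
  by_cases h₄ : a = d
  · subst h₄
    rw [symm a b hab, symm c a hcd]
    exact key hab.symm hcd.symm h₁ (by rw [swap_comm b a, swap_comm a c, h])
  have c₁ := comm a b c d hab hcd h₃ h₄ h₁ h₂
  rcases cases_disjoint hab hcd h₃ h₄ h₁ h₂ (fun x => congrArg (· x) h) with
    ⟨e₁, e₂⟩ | ⟨e₁, e₂⟩ <;> rcases e₁ with ⟨rfl, rfl⟩ | ⟨rfl, rfl⟩ <;>
    rcases e₂ with ⟨rfl, rfl⟩ | ⟨rfl, rfl⟩ <;> grind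

end TranspositionProduct

/-! ### Two surgeries -/

namespace Surgery

open Relation IsStrands

variable {P : Type} {r r₁ r₂ s : P → P → Prop} {x₁ x₂ y₁ y₂ : P}

/-- The contrapositive of `Surgery.arcs`, with each arc recognized by its tail instead of its head.
-/
theorem not_arcs_of_eqvGen' [Finite P] (H : Surgery r r₁ x₁ x₂) (h : EqvGen r₁ x₁ x₂) {t t' : P}
    (ht : ∀ a, ¬ r a t) (ht' : ∀ a, ¬ r a t') (h₁ : EqvGen r t x₁) (h₂ : EqvGen r t' x₂) :
    False := by
  obtain ⟨p, hp, e⟩ := H.strands.exists_head ht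
  obtain ⟨p', hp', e'⟩ := H.strands.exists_head ht'
  exact H.arcs hp hp' (.trans _ _ _ (h₁.symm _ _) e) (.trans _ _ _ (h₂.symm _ _) e') h

/-- As the first surgery separates `y₁` from `y₂`, they lie on the two pieces that it produces from
one component. These pieces are not both arcs, so they cannot both have a tail. -/
theorem not_split_exchange [Finite P] (H : Surgery r r₁ x₁ x₂) (hx : EqvGen r x₁ x₂) (hy : EqvGen r y₁ y₂)
    (hy' : ¬ EqvGen r₁ y₁ y₂) {t t' : P} (ht : ∀ a, ¬ r₁ a t) (ht' : ∀ a, ¬ r₁ a t')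
    (h₁ : EqvGen r₁ t y₁) (h₂ : EqvGen r₁ t' y₂) : False := by
  rcases H.step hy with h | ⟨h | h, h' | h'⟩
  · exact hy' h
  · exact hy' (.trans _ _ _ h (h'.symm _ _))
  · exact H.symm.not_arcs_of_eqvGen' hx ht ht' (.trans _ _ _ h₁ h) (.trans _ _ _ h₂ h')
  · exact H.symm.not_arcs_of_eqvGen' hx ht' ht (.trans _ _ _ h₂ h') (.trans _ _ _ h₁ h)
  · exact hy' (.trans _ _ _ h (h'.symm _ _))

/-- If a strand has a tail among the tails of the strands of the surgery, then it takes part in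
the surgery. -/
theorem touches_of_tail (H : Surgery r r₁ x₁ x₂) {t : P} (ht : EqvGen r₁ t x₁ ∨ EqvGen r₁ t x₂)
    {y : P} (hy : EqvGen r₁ t y) : Touches r x₁ x₂ y :=
  H.symm.touches (Touches.congr (p := t) ht (hy.symm _ _))

/-- Two mergers of the same two components. -/
theorem merge_split (H₁ : Surgery r r₁ x₁ x₂) (H₂ : Surgery r₁ s y₁ y₂) (hx : EqvGen r₁ x₁ x₂)
    (hy : ¬ EqvGen r y₁ y₂) (hy' : EqvGen r₁ y₁ y₂) (hs : ¬ EqvGen s x₁ x₂) :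
    (EqvGen s x₁ y₁ ∧ EqvGen s x₂ y₂) ∨ (EqvGen s x₁ y₂ ∧ EqvGen s x₂ y₁) := by
  have h₁ : EqvGen r₁ x₁ y₁ := by
    rcases H₁.symm.step hy' with h | ⟨h, -⟩
    · exact absurd h hy
    · rcases H₁.touches h with h | h
      · exact h.symm _ _
      · exact .trans _ _ _ hx (h.symm _ _)
  have h₂ : EqvGen r₁ x₂ y₁ := .trans _ _ _ (hx.symm _ _) h₁
  rcases H₂.touches (Or.inl h₁) with h | h <;> rcases H₂.touches (Or.inl h₂) with h' | h'
  · exact absurd (.trans _ _ _ h (h'.symm _ _)) hs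
  · exact Or.inl ⟨h, h'⟩
  · exact Or.inr ⟨h, h'⟩
  · exact absurd (.trans _ _ _ h (h'.symm _ _)) hs

/-- The first surgery separates `y₁` from `y₂`, so it touches the component of `y₁`. After the
second one has joined `y₁` to `y₂`, all four points lie on one component. -/
theorem split_merge (H₁ : Surgery r r₁ x₁ x₂) (H₂ : Surgery r₁ s y₁ y₂)
    (hy : EqvGen r y₁ y₂) (hy' : ¬ EqvGen r₁ y₁ y₂) (hs : EqvGen s y₁ y₂) (hs' : EqvGen s x₁ x₂) :
    EqvGen s x₁ y₁ := by
  rcases H₁.step hy with h | ⟨h | h, -⟩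
  · exact absurd h hy'
  · rcases H₂.touches (Or.inl (h.symm _ _)) with h | h
    · exact h
    · exact .trans _ _ _ h (hs.symm _ _)
  · rcases H₂.touches (Or.inl (h.symm _ _)) with h | h
    · exact .trans _ _ _ hs' h
    · exact .trans _ _ _ hs' (.trans _ _ _ h (hs.symm _ _))

/-- A surgery on one arc splits off a circle. -/
theorem split_arc [Finite P] (H : Surgery r r₁ x₁ x₂) (hx : EqvGen r x₁ x₂) {t : P} (ht : ∀ a, ¬ r a t)
    (h : EqvGen r t x₁) :
    (EqvGen r₁ t x₁ ∧ ∀ t', (∀ a, ¬ r₁ a t') → ¬ EqvGen r₁ t' x₂) ∨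
      (EqvGen r₁ t x₂ ∧ ∀ t', (∀ a, ¬ r₁ a t') → ¬ EqvGen r₁ t' x₁) := by
  have ht₁ := (H.tail_iff t).2 ht
  rcases H.touches (Or.inl h) with h | h
  · exact Or.inl ⟨h, fun t' ht' h' => H.symm.not_arcs_of_eqvGen' hx ht₁ ht' h h'⟩
  · exact Or.inr ⟨h, fun t' ht' h' => H.symm.not_arcs_of_eqvGen' hx ht' ht₁ h' h⟩

/-- The circle that an exchange of two arcs and a splitting produce. -/
theorem exchange_split [Finite P] (H₁ : Surgery r r₁ x₁ x₂) (H₂ : Surgery r₁ s y₁ y₂)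
    (hy' : EqvGen r₁ y₁ y₂) {t₁ t₂ : P} (ht₁ : ∀ a, ¬ r a t₁) (ht₂ : ∀ a, ¬ r a t₂)
    (h₁ : EqvGen r₁ t₁ x₁) (h₂ : EqvGen r₁ t₂ x₂) (hy₁ : EqvGen r t₁ y₁ ∨ EqvGen r t₂ y₁)
    (g₁ : EqvGen r t₁ x₁) (g₂ : EqvGen r t₂ x₂) :
    ∃ z t, (t = t₁ ∨ t = t₂) ∧ (∀ t', (∀ a, ¬ s a t') → ¬ EqvGen s t' z) ∧
      (EqvGen s z y₁ ∧ EqvGen s t y₂ ∨ EqvGen s z y₂ ∧ EqvGen s t y₁) ∧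
      ∀ x, (EqvGen r₁ t₁ x ∨ EqvGen r₁ t₂ x) → (∀ t', (∀ a, ¬ s a t') → ¬ EqvGen s t' x) →
        EqvGen s x z := by
  have ht₁' := (H₁.tail_iff t₁).2 ht₁
  have ht₂' := (H₁.tail_iff t₂).2 ht₂
  have hy : EqvGen r₁ t₁ y₁ ∨ EqvGen r₁ t₂ y₁ := by
    have : Touches r x₁ x₂ y₁ := hy₁.imp (fun h => .trans _ _ _ (h.symm _ _) g₁)
      (fun h => .trans _ _ _ (h.symm _ _) g₂)
    exact (H₁.touches this).imp (fun h => .trans _ _ _ h₁ (h.symm _ _))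
      (fun h => .trans _ _ _ h₂ (h.symm _ _))
  -- Here `t` is the tail of the arc that is split. One of `y₁`, `y₂` stays with `t`, the other lies
  -- on the new circle `z`. A point of either old arc that no longer lies on an arc has left its
  -- tail, so the second surgery touched it and it lies on `z`.
  have key : ∀ t, (t = t₁ ∨ t = t₂) → (∀ a, ¬ r₁ a t) → EqvGen r₁ t y₁ →
      ∃ z, (∀ t', (∀ a, ¬ s a t') → ¬ EqvGen s t' z) ∧
      (EqvGen s z y₁ ∧ EqvGen s t y₂ ∨ EqvGen s z y₂ ∧ EqvGen s t y₁) ∧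
      ∀ x, (EqvGen r₁ t₁ x ∨ EqvGen r₁ t₂ x) → (∀ t', (∀ a, ¬ s a t') → ¬ EqvGen s t' x) →
        EqvGen s x z := by
    intro t _ ht hty
    have hts := (H₂.tail_iff t).2 ht
    have h₁s := (H₂.tail_iff t₁).2 ht₁'
    have h₂s := (H₂.tail_iff t₂).2 ht₂'
    have hx : ∀ x, (EqvGen r₁ t₁ x ∨ EqvGen r₁ t₂ x) →
        (∀ t', (∀ a, ¬ s a t') → ¬ EqvGen s t' x) → Touches s y₁ y₂ x := by
      rintro x (h | h) hc
      · exact ((H₂.step h).resolve_left (hc t₁ h₁s)).2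
      · exact ((H₂.step h).resolve_left (hc t₂ h₂s)).2
    rcases H₂.split_arc hy' ht hty with ⟨h, hz⟩ | ⟨h, hz⟩
    · refine ⟨y₂, hz, Or.inr ⟨.refl _, h⟩, fun x hx₁ hx₂ => ?_⟩
      exact (hx x hx₁ hx₂).resolve_left fun h' => hx₂ t hts (.trans _ _ _ h (h'.symm _ _))
    · refine ⟨y₁, hz, Or.inl ⟨.refl _, h⟩, fun x hx₁ hx₂ => ?_⟩
      exact (hx x hx₁ hx₂).resolve_right fun h' => hx₂ t hts (.trans _ _ _ h (h'.symm _ _))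
  rcases hy with hy | hy
  · obtain ⟨z, h⟩ := key t₁ (Or.inl rfl) ht₁' hy
    exact ⟨z, t₁, Or.inl rfl, h⟩
  · obtain ⟨z, h⟩ := key t₂ (Or.inr rfl) ht₂' hy
    exact ⟨z, t₂, Or.inr rfl, h⟩

end Surgery

/-! ### The unit vectors under saddles -/

namespace TangleDiagram

open Relation

variable {p q : ℕ} {T : TangleDiagram p q} {ε : ℤˣ} {α : Finset T.Crossing}

/-- The head of the arc of `D_α` with the given tail. -/
noncomputable def headOf (ε : ℤˣ) (α : Finset T.Crossing) (t : T.Tail ε) : T.Head ε :=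
  (exists_head α t).choose

theorem headOf_spec (t : T.Tail ε) :
    EqvGen (T.Next ε α) (tailPt t) (headPt (headOf ε α t)) := (exists_head α t).choose_spec

theorem headOf_eq {t : T.Tail ε} {h : T.Head ε} (e : EqvGen (T.Next ε α) (tailPt t) (headPt h)) :
    headOf ε α t = h := head_eq (.trans _ _ _ ((headOf_spec t).symm _ _) e)

theorem headOf_injective : Function.Injective (headOf ε α) := fun t t' h =>
  tail_eq (.trans _ _ _ (headOf_spec t) (h ▸ (headOf_spec (α := α) t').symm _ _))

theorem card_component_of_eq {P Q : T.Point} (h : T.cls α P = T.cls α Q) :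
    Nat.card (T.Component α) = 1 + Nat.card (Away (T.cls α P) (T.cls α Q)) := by
  refine (Nat.card_congr (onceEquiv _ _ h)).symm.trans ?_
  rw [Nat.card_sum, Nat.card_unique]

theorem card_component_of_ne {P Q : T.Point} (h : T.cls α P ≠ T.cls α Q) :
    Nat.card (T.Component α) = 2 + Nat.card (Away (T.cls α P) (T.cls α Q)) := by
  refine (Nat.card_congr (pairEquiv _ _ h)).symm.trans ?_
  rw [Nat.card_sum, Nat.card_sum, Nat.card_unique]

open Classical in
theorem card_away (ε : ℤˣ) (α : Finset T.Crossing) (j : T.Crossing) :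
    Nat.card (Away (T.cls α (T.in₁ ε j)) (T.cls α (T.in₂ ε j))) =
      Nat.card (Away (T.cls (insert j α) (T.in₁ ε j)) (T.cls (insert j α) (T.in₂ ε j))) :=
  Nat.card_congr (T.localChange ε α j).equiv

end TangleDiagram

namespace OpenClosedTQFT

open TangleDiagram Relation

variable {k : Type u} [Field k] (Z : OpenClosedTQFT k)
  {p q : ℕ} {T : TangleDiagram p q} {ε : ℤˣ} {α γ : Finset T.Crossing} {j : T.Crossing}

attribute [local instance] ringSingle algebraSingle

/-- The copairing of the circle on the components of two points. -/
noncomputable def hAt (α : Finset T.Crossing) (P Q : T.Point) : Module.End k (Z.val (T.family α)) :=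
  Z.hOp _ (T.cls α P) (T.cls α Q)

/-- The copairing of the arc on the arcs with two given tails. -/
noncomputable def dAt (α : Finset T.Crossing) (t t' : T.Tail ε) :
    Module.End k (Z.val (T.family α)) :=
  Z.dOp _ (T.cls α (tailPt t)) (T.cls α (tailPt t')) (tail_isArc α t) (tail_isArc α t')

theorem hAt_congr {P P' Q Q' : T.Point} (hP : EqvGen (T.Next ε α) P P')
    (hQ : EqvGen (T.Next ε α) Q Q') : Z.hAt α P Q = Z.hAt α P' Q' := by
  rw [hAt, hAt, (cls_eq_iff ε).2 hP, (cls_eq_iff ε).2 hQ]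

theorem hAt_symm (P Q : T.Point) : Z.hAt α P Q = Z.hAt α Q P := hOp_symm Z _ _

theorem dOp_congr {X : Ob} {x y x' y' : X.ι} {hx : X.isArc x = true} {hy : X.isArc y = true}
    (hx' : X.isArc x' = true) (hy' : X.isArc y' = true) (e : x = x') (e' : y = y') :
    Z.dOp X x y hx hy = Z.dOp X x' y' hx' hy' := by
  subst e e'
  rfl

theorem cls_tail_ne {t t' : T.Tail ε} (h : t ≠ t') :
    T.cls α (tailPt t) ≠ T.cls α (tailPt t') := fun e => h (tail_eq ((cls_eq_iff ε).1 e))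

theorem dAt_symm (t t' : T.Tail ε) (h : t ≠ t') : Z.dAt α t t' = Z.dAt α t' t :=
  dOp_symm Z (cls_tail_ne h) _ _

/-- A linear map with the compatibilities of a saddle. -/
structure Step (ε : ℤˣ) (α γ : Finset T.Crossing) (j : T.Crossing)
    (S : Z.val (T.family α) →ₗ[k] Z.val (T.family γ)) : Prop where
  surgery : Surgery (T.Next ε α) (T.Next ε γ) (T.in₁ ε j) (T.in₂ ε j)
  cComm : ∀ P, Z.CComm S (T.cls α P) (T.cls γ P)
  lComm : ∀ t : T.Tail ε, Z.LComm S (T.cls α (tailPt t)) (T.cls γ (tailPt t))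

/-- A saddle that merges two components. -/
structure MergeStep (ε : ℤˣ) (α γ : Finset T.Crossing) (j : T.Crossing)
    (S : Z.val (T.family α) →ₗ[k] Z.val (T.family γ)) : Prop extends Z.Step ε α γ j S where
  src : ¬ EqvGen (T.Next ε α) (T.in₁ ε j) (T.in₂ ε j)
  tgt : EqvGen (T.Next ε γ) (T.in₁ ε j) (T.in₂ ε j)
  card : Nat.card (T.Component γ) + 1 = Nat.card (T.Component α)
  head : ∀ t, headOf ε γ t = headOf ε α t
  one : S (Z.one _) = Z.one _

/-- A saddle that splits a component. -/
structure SplitStep (ε : ℤˣ) (α γ : Finset T.Crossing) (j : T.Crossing)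
    (S : Z.val (T.family α) →ₗ[k] Z.val (T.family γ)) : Prop extends Z.Step ε α γ j S where
  src : EqvGen (T.Next ε α) (T.in₁ ε j) (T.in₂ ε j)
  tgt : ¬ EqvGen (T.Next ε γ) (T.in₁ ε j) (T.in₂ ε j)
  card : Nat.card (T.Component γ) = Nat.card (T.Component α) + 1
  head : ∀ t, headOf ε γ t = headOf ε α t
  one : S (Z.one _) = Z.hAt γ (T.in₁ ε j) (T.in₂ ε j) (Z.one _)

open Classical in
/-- A saddle between two arcs with the tails `t` and `t'`. -/
structure ExchangeStep (ε : ℤˣ) (α γ : Finset T.Crossing) (j : T.Crossing)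
    (S : Z.val (T.family α) →ₗ[k] Z.val (T.family γ)) (t t' : T.Tail ε) : Prop
    extends Z.Step ε α γ j S where
  ne : t ≠ t'
  src : ¬ EqvGen (T.Next ε α) (T.in₁ ε j) (T.in₂ ε j)
  tgt : ¬ EqvGen (T.Next ε γ) (T.in₁ ε j) (T.in₂ ε j)
  src₁ : EqvGen (T.Next ε α) (tailPt t) (T.in₁ ε j)
  src₂ : EqvGen (T.Next ε α) (tailPt t') (T.in₂ ε j)
  tgt₁ : EqvGen (T.Next ε γ) (tailPt t) (T.in₁ ε j)
  tgt₂ : EqvGen (T.Next ε γ) (tailPt t') (T.in₂ ε j)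
  card : Nat.card (T.Component γ) = Nat.card (T.Component α)
  head : ∀ u, headOf ε γ u = headOf ε α (Equiv.swap t t' u)
  one : S (Z.one _) = Z.dAt γ t t' (Z.one _)

theorem Step.h_apply {S : Z.val (T.family α) →ₗ[k] Z.val (T.family γ)} (H : Z.Step ε α γ j S)
    (P Q : T.Point) (v : Z.val (T.family α)) : S (Z.hAt α P Q v) = Z.hAt γ P Q (S v) := by
  simp only [hAt, hOp, LinearMap.sum_apply, map_sum, Module.End.mul_apply]
  exact Finset.sum_congr rfl fun i _ => by rw [H.cComm P, H.cComm Q]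

theorem Step.d_apply {S : Z.val (T.family α) →ₗ[k] Z.val (T.family γ)} (H : Z.Step ε α γ j S)
    (t t' : T.Tail ε) (v : Z.val (T.family α)) : S (Z.dAt α t t' v) = Z.dAt γ t t' (S v) := by
  simp only [dAt, dOp, LinearMap.sum_apply, map_sum, Module.End.mul_apply]
  exact Finset.sum_congr rfl fun i _ => by rw [H.lComm t _ (tail_isArc γ t),
    H.lComm t' _ (tail_isArc γ t')]

open Classical in
theorem sadAt_step (hj : j ∉ α) : Z.Step ε α (insert j α) j (Z.sadAt ε α j) :=
  ⟨next_surgery ε hj, Z.sadAt_cComm hj, Z.sadAt_lComm hj⟩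

open Classical in
theorem sadAt_merge (hj : j ∉ α) (hx : T.cls α (T.in₁ ε j) ≠ T.cls α (T.in₂ ε j))
    (hy : T.cls (insert j α) (T.in₁ ε j) = T.cls (insert j α) (T.in₂ ε j)) :
    Z.MergeStep ε α (insert j α) j (Z.sadAt ε α j) where
  toStep := Z.sadAt_step hj
  src h := hx ((cls_eq_iff ε).2 h)
  tgt := (cls_eq_iff ε).1 hy
  card := by
    rw [card_component_of_eq hy, card_component_of_ne hx, card_away ε α j]
    omega
  head t := by
    -- A tail and a head can be separated only if both now lie on touched strands, and after the
    -- merger those form a single component. For a splitting the same argument runs backwards.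
    have hy := (cls_eq_iff ε).1 hy
    refine headOf_eq ?_
    rcases (next_surgery ε hj).step (headOf_spec t) with h | ⟨h | h, h' | h'⟩
    · exact h
    · exact .trans _ _ _ h (h'.symm _ _)
    · exact .trans _ _ _ h (.trans _ _ _ hy (h'.symm _ _))
    · exact .trans _ _ _ h (.trans _ _ _ (hy.symm _ _) (h'.symm _ _))
    · exact .trans _ _ _ h (h'.symm _ _)
  one := Z.sad_merge_one _ _ hx hy (isArc_merge hj hy).1 (isArc_merge hj hy).2

open Classical in
theorem sadAt_split (hj : j ∉ α) (hx : T.cls α (T.in₁ ε j) = T.cls α (T.in₂ ε j))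
    (hy : T.cls (insert j α) (T.in₁ ε j) ≠ T.cls (insert j α) (T.in₂ ε j)) :
    Z.SplitStep ε α (insert j α) j (Z.sadAt ε α j) where
  toStep := Z.sadAt_step hj
  src := (cls_eq_iff ε).1 hx
  tgt h := hy ((cls_eq_iff ε).2 h)
  card := by
    rw [card_component_of_eq hx, card_component_of_ne hy, card_away ε α j]
    omega
  head t := by
    have hx := (cls_eq_iff ε).1 hx
    refine (headOf_eq ?_).symm
    rcases (next_surgery ε hj).symm.step (headOf_spec t) with h | ⟨h | h, h' | h'⟩
    · exact h
    · exact .trans _ _ _ h (h'.symm _ _)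
    · exact .trans _ _ _ h (.trans _ _ _ hx (h'.symm _ _))
    · exact .trans _ _ _ h (.trans _ _ _ (hx.symm _ _) (h'.symm _ _))
    · exact .trans _ _ _ h (h'.symm _ _)
  one := Z.sad_split_one _ _ hx hy (isArc_split hj hx) (not_arcs_of_split hj hx)

open Classical in
theorem sadAt_exchange (hj : j ∉ α) (hx : T.cls α (T.in₁ ε j) ≠ T.cls α (T.in₂ ε j))
    (hy : T.cls (insert j α) (T.in₁ ε j) ≠ T.cls (insert j α) (T.in₂ ε j)) :
    ∃ t t', Z.ExchangeStep ε α (insert j α) j (Z.sadAt ε α j) t t' := by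
  obtain ⟨⟨h₁, h₂⟩, h₃, h₄⟩ := arcs_of_exchange hj hx hy
  obtain ⟨t, ht⟩ := (isArc_iff_tail ε _).1 h₁
  obtain ⟨t', ht'⟩ := (isArc_iff_tail ε _).1 h₂
  have hx' : ¬ EqvGen (T.Next ε α) (T.in₁ ε j) (T.in₂ ε j) := fun h => hx ((cls_eq_iff ε).2 h)
  have hy' : ¬ EqvGen (T.Next ε (insert j α)) (T.in₁ ε j) (T.in₂ ε j) :=
    fun h => hy ((cls_eq_iff ε).2 h)
  have H := next_surgery ε hj
  have hg := H.tail_stays hx' (tailPt_spec α t) ht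
  have hg' := H.exchange.tail_stays (fun h => hx' (h.symm _ _)) (tailPt_spec α t') ht'
  have hne : t ≠ t' := fun h => hx' (.trans _ _ _ (ht.symm _ _) (h ▸ ht'))
  refine ⟨t, t', ⟨Z.sadAt_step hj, hne, hx', hy', ht, ht', hg, hg', ?_, fun u => headOf_eq ?_, ?_⟩⟩
  · rw [card_component_of_ne hx, card_component_of_ne hy, card_away ε α j]
  -- The tails `t` and `t'` stay while the heads of their arcs move to the other arc; arcs with
  -- another tail are not touched.
  · by_cases hu : u = t
    · subst hu
      rw [Equiv.swap_apply_left]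
      exact .trans _ _ _ hg (H.exchange.head_moves (fun h => hx' (h.symm _ _)) (headPt_spec α _)
        (.trans _ _ _ (ht'.symm _ _) (headOf_spec _)))
    · by_cases hu' : u = t'
      · subst hu'
        rw [Equiv.swap_apply_right]
        exact .trans _ _ _ hg' (H.head_moves hx' (headPt_spec α _)
          (.trans _ _ _ (ht.symm _ _) (headOf_spec _)))
      · rw [Equiv.swap_apply_of_ne_of_ne hu hu']
        rcases H.step (headOf_spec u) with h | ⟨h, -⟩
        · exact h
        · rcases H.symm.touches h with h | h
          · exact absurd (tail_eq (.trans _ _ _ h (ht.symm _ _))) hu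
          · exact absurd (tail_eq (.trans _ _ _ h (ht'.symm _ _))) hu'
  · refine (Z.sad_arc_one _ _ hx hy h₁ h₂ h₃ h₄).trans ?_
    exact congrArg (fun D => D (Z.one _)) (Z.dOp_congr _ _ ((cls_eq_iff ε).2 (hg.symm _ _))
      ((cls_eq_iff ε).2 (hg'.symm _ _)))

open Classical in
/-- The linear map of the saddle at the crossing `j`, with values in the space of a smoothing
equal to `D_{α ⊔ {j}}`. -/
noncomputable def sadTo (ε : ℤˣ) (h : insert j α = γ) :
    Z.val (T.family α) →ₗ[k] Z.val (T.family γ) :=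
  h ▸ Z.sadAt ε α j

open Classical in
theorem sadTo_cases (hj : j ∉ α) (h : insert j α = γ) :
    Z.MergeStep ε α γ j (Z.sadTo ε h) ∨ Z.SplitStep ε α γ j (Z.sadTo ε h) ∨
      ∃ t t', Z.ExchangeStep ε α γ j (Z.sadTo ε h) t t' := by
  subst h
  rcases saddle_cases (ε := ε) hj with ⟨hx, hy⟩ | ⟨hx, hy⟩ | ⟨hx, hy⟩
  · exact Or.inl (Z.sadAt_merge hj hx hy)
  · exact Or.inr (Or.inl (Z.sadAt_split hj hx hy))
  · exact Or.inr (Or.inr (Z.sadAt_exchange hj hx hy))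

open Classical in
theorem sadTo_step (hj : j ∉ α) (h : insert j α = γ) : Z.Step ε α γ j (Z.sadTo ε h) := by
  subst h
  exact Z.sadAt_step hj

end OpenClosedTQFT

/-! ### Commutation of two saddles -/

namespace OpenClosedTQFT

open TangleDiagram Relation

variable {k : Type u} [Field k] {Z : OpenClosedTQFT k}
  {p q : ℕ} {T : TangleDiagram p q} {ε : ℤˣ} {α β β' γ : Finset T.Crossing} {i j : T.Crossing}

attribute [local instance] ringSingle algebraSingle

section squares

variable {S₁ : Z.val (T.family α) →ₗ[k] Z.val (T.family β)}
  {S₂ : Z.val (T.family β) →ₗ[k] Z.val (T.family γ)}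
  {S₃ : Z.val (T.family α) →ₗ[k] Z.val (T.family β')}
  {S₄ : Z.val (T.family β') →ₗ[k] Z.val (T.family γ)} {t t' u u' v v' w w' : T.Tail ε}

-- `headOf` is injective, so a transposition is determined by the way in which it rearranges the
-- heads, and D depends on the transposition only.
open Classical in
theorem dAt_eq_of_swap (h : t ≠ t')
    (e : ∀ x, headOf ε α (Equiv.swap t t' x) = headOf ε α (Equiv.swap u u' x)) :
    Z.dAt γ t t' = Z.dAt γ u u' :=
  TranspositionProduct.congr_swap (Z.dAt γ) Z.dAt_symm h
    (Equiv.ext fun x => headOf_injective (e x))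

theorem dAt_mul_hAt (P Q : T.Point) (v : Z.val (T.family γ)) :
    Z.dAt γ t t' (Z.hAt γ P Q v) = Z.hAt γ P Q (Z.dAt γ t t' v) :=
  (LinearMap.congr_fun (Z.hOp_dOp_commute _ _ _ _ _ _).eq v).symm

theorem hAt_mul_hAt (P Q P' Q' : T.Point) (v : Z.val (T.family γ)) :
    Z.hAt γ P Q (Z.hAt γ P' Q' v) = Z.hAt γ P' Q' (Z.hAt γ P Q v) :=
  LinearMap.congr_fun (Z.hOp_commute _ _ _ _).eq v

/-- Merging and splitting in both orders. -/
theorem square_MS_MS (h₁ : Z.MergeStep ε α β i S₁) (h₂ : Z.SplitStep ε β γ j S₂)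
    (h₃ : Z.MergeStep ε α β' j S₃) (h₄ : Z.SplitStep ε β' γ i S₄) :
    S₂ (S₁ (Z.one _)) = S₄ (S₃ (Z.one _)) := by
  rw [h₁.one, h₂.one, h₃.one, h₄.one]
  rcases h₁.surgery.merge_split h₂.surgery h₁.tgt h₃.src h₂.src h₄.tgt with ⟨h, h'⟩ | ⟨h, h'⟩
  · rw [Z.hAt_congr h h']
  · rw [Z.hAt_congr h h', hAt_symm]

/-- By `Surgery.split_merge` all four incoming points lie on one component of `D_γ`, so both sides
apply the copairing with both legs on that component. -/
theorem square_SM_SM (h₁ : Z.SplitStep ε α β i S₁) (h₂ : Z.MergeStep ε β γ j S₂)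
    (h₃ : Z.SplitStep ε α β' j S₃) (h₄ : Z.MergeStep ε β' γ i S₄) :
    S₂ (S₁ (Z.one _)) = S₄ (S₃ (Z.one _)) := by
  rw [h₁.one, h₂.h_apply, h₂.one, h₃.one, h₄.h_apply, h₄.one]
  have h := h₁.surgery.split_merge h₂.surgery h₃.src h₂.src h₂.tgt h₄.tgt
  rw [Z.hAt_congr h (.trans _ _ _ (h₄.tgt.symm _ _) (.trans _ _ _ h h₂.tgt))]

theorem square_MS_SM (h₁ : Z.MergeStep ε α β i S₁) (h₂ : Z.SplitStep ε β γ j S₂)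
    (h₃ : Z.SplitStep ε α β' j S₃) (h₄ : Z.MergeStep ε β' γ i S₄) :
    S₂ (S₁ (Z.one _)) = S₄ (S₃ (Z.one _)) := by
  rw [h₁.one, h₂.one, h₃.one, h₄.h_apply, h₄.one]

theorem square_MX_MX (h₁ : Z.MergeStep ε α β i S₁) (h₂ : Z.ExchangeStep ε β γ j S₂ t t')
    (h₃ : Z.MergeStep ε α β' j S₃) (h₄ : Z.ExchangeStep ε β' γ i S₄ u u') :
    S₂ (S₁ (Z.one _)) = S₄ (S₃ (Z.one _)) := by
  rw [h₁.one, h₂.one, h₃.one, h₄.one,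
    dAt_eq_of_swap (α := α) (u := u) (u' := u') h₂.ne fun x => by
      rw [← h₁.head, ← h₂.head, ← h₃.head, ← h₄.head]]

theorem square_MX_XM (h₁ : Z.MergeStep ε α β i S₁) (h₂ : Z.ExchangeStep ε β γ j S₂ t t')
    (h₃ : Z.ExchangeStep ε α β' j S₃ u u') (h₄ : Z.MergeStep ε β' γ i S₄) :
    S₂ (S₁ (Z.one _)) = S₄ (S₃ (Z.one _)) := by
  rw [h₁.one, h₂.one, h₃.one, h₄.d_apply, h₄.one,
    dAt_eq_of_swap (α := α) (u := u) (u' := u') h₂.ne fun x => by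
      rw [← h₁.head, ← h₂.head, ← h₃.head, ← h₄.head]]

theorem square_XM_XM (h₁ : Z.ExchangeStep ε α β i S₁ t t') (h₂ : Z.MergeStep ε β γ j S₂)
    (h₃ : Z.ExchangeStep ε α β' j S₃ u u') (h₄ : Z.MergeStep ε β' γ i S₄) :
    S₂ (S₁ (Z.one _)) = S₄ (S₃ (Z.one _)) := by
  rw [h₁.one, h₂.d_apply, h₂.one, h₃.one, h₄.d_apply, h₄.one,
    dAt_eq_of_swap (α := α) (u := u) (u' := u') h₁.ne fun x => by
      rw [← h₁.head, ← h₂.head, ← h₃.head, ← h₄.head]]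

theorem square_SX_XS (h₁ : Z.SplitStep ε α β i S₁) (h₂ : Z.ExchangeStep ε β γ j S₂ t t')
    (h₃ : Z.ExchangeStep ε α β' j S₃ u u') (h₄ : Z.SplitStep ε β' γ i S₄) :
    S₂ (S₁ (Z.one _)) = S₄ (S₃ (Z.one _)) := by
  rw [h₁.one, h₂.h_apply, h₂.one, h₃.one, h₄.d_apply, h₄.one, dAt_mul_hAt,
    dAt_eq_of_swap (α := α) (u := u) (u' := u') h₂.ne fun x => by
      rw [← h₁.head, ← h₂.head, ← h₃.head, ← h₄.head]]

/-- Both crossings split one component of `D_α`; if the second did not do so after the first, it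
would meet the two pieces of that splitting, of which one is a circle, and could not be an exchange.
-/
theorem square_SX_SX (h₁ : Z.SplitStep ε α β i S₁) (h₂ : Z.ExchangeStep ε β γ j S₂ t t')
    (h₃ : Z.SplitStep ε α β' j S₃) : False :=
  h₁.surgery.not_split_exchange h₁.src h₃.src h₂.src (tailPt_spec β t) (tailPt_spec β t')
    h₂.src₁ h₂.src₂

theorem hAt_dAt_tail (P : T.Point) (h : t ≠ t') (w : T.Tail ε) (hw : w = t ∨ w = t') :
    Z.hAt γ P (tailPt w) * Z.dAt γ t t' = Z.hAt γ P (tailPt t) * Z.dAt γ t t' := by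
  rcases hw with rfl | rfl
  · rfl
  · exact (Z.hOp_mul_dOp _ _ _).symm

/-- Normal form for an exchange combined with the splitting of a circle `z` from one of the two
arcs: by `hAt_dAt_tail` it does not matter from which. -/
theorem hAt_dAt_circle {z y₁ y₂ : T.Point} (h : t ≠ t') (hw : w = t ∨ w = t')
    (e : EqvGen (T.Next ε γ) z y₁ ∧ EqvGen (T.Next ε γ) (tailPt w) y₂ ∨
      EqvGen (T.Next ε γ) z y₂ ∧ EqvGen (T.Next ε γ) (tailPt w) y₁) :
    Z.hAt γ y₁ y₂ * Z.dAt γ t t' = Z.hAt γ z (tailPt t) * Z.dAt γ t t' := by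
  rw [← hAt_dAt_tail z h w hw]
  rcases e with ⟨h, h'⟩ | ⟨h, h'⟩
  · rw [Z.hAt_congr h h']
  · rw [Z.hAt_congr h h', hAt_symm]

/-- Equality of the maps from tails to heads makes the two exchanges act on the same pair of arcs.
By `Surgery.exchange_split` each order splits off a circle, the two circles are the same component
of `D_γ`, and both sides have the normal form of `hAt_dAt_circle`. -/
theorem square_XS_XS (h₁ : Z.ExchangeStep ε α β i S₁ t t') (h₂ : Z.SplitStep ε β γ j S₂)
    (h₃ : Z.ExchangeStep ε α β' j S₃ u u') (h₄ : Z.SplitStep ε β' γ i S₄) :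
    S₂ (S₁ (Z.one _)) = S₄ (S₃ (Z.one _)) := by
  classical
  have hs : ∀ x, headOf ε α (Equiv.swap t t' x) = headOf ε α (Equiv.swap u u' x) := fun x => by
    rw [← h₁.head, ← h₂.head, ← h₃.head, ← h₄.head]
  have hD := dAt_eq_of_swap (Z := Z) (γ := γ) h₁.ne hs
  have hu := TranspositionProduct.swap_eq_swap h₁.ne (Equiv.ext fun x => headOf_injective (hs x))
  have hu₁ : u = t ∨ u = t' := hu.imp And.left And.left
  have ht₁ : t = u ∨ t = u' := hu.imp (fun h => h.1.symm) (fun h => h.2.symm)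
  have hs₁ : ∀ w, (w = t ∨ w = t') → EqvGen (T.Next ε α) (tailPt w) (T.in₁ ε j) →
      EqvGen (T.Next ε α) (tailPt t) (T.in₁ ε j) ∨
        EqvGen (T.Next ε α) (tailPt t') (T.in₁ ε j) := by
    rintro w (rfl | rfl) h
    exacts [Or.inl h, Or.inr h]
  have hs₂ : ∀ w, (w = u ∨ w = u') → EqvGen (T.Next ε α) (tailPt w) (T.in₁ ε i) →
      EqvGen (T.Next ε α) (tailPt u) (T.in₁ ε i) ∨
        EqvGen (T.Next ε α) (tailPt u') (T.in₁ ε i) := by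
    rintro w (rfl | rfl) h
    exacts [Or.inl h, Or.inr h]
  rw [h₁.one, h₂.d_apply, h₂.one, h₃.one, h₄.d_apply, h₄.one, dAt_mul_hAt, dAt_mul_hAt, ← hD]
  obtain ⟨z, x, hx, hz, e, hc⟩ := h₁.surgery.exchange_split h₂.surgery h₂.src (tailPt_spec α t)
    (tailPt_spec α t') h₁.tgt₁ h₁.tgt₂ (hs₁ u hu₁ h₃.src₁)
    h₁.src₁ h₁.src₂
  obtain ⟨z', x', hx', hz', e', -⟩ := h₃.surgery.exchange_split h₄.surgery h₄.src (tailPt_spec α u)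
    (tailPt_spec α u') h₃.tgt₁ h₃.tgt₂ (hs₂ t ht₁ h₁.src₁)
    h₃.src₁ h₃.src₂
  have hzz : EqvGen (T.Next ε γ) z' z := by
    rcases e' with ⟨h, -⟩ | ⟨h, -⟩
    · exact .trans _ _ _ h (hc _ (Or.inl h₁.tgt₁) fun a ha ha' =>
        hz' a ha (.trans _ _ _ ha' (h.symm _ _)))
    · exact .trans _ _ _ h (hc _ (Or.inr h₁.tgt₂) fun a ha ha' =>
        hz' a ha (.trans _ _ _ ha' (h.symm _ _)))
  have hw : ∃ w, (w = t ∨ w = t') ∧ tailPt w = x := by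
    rcases hx with h | h
    exacts [⟨t, Or.inl rfl, h.symm⟩, ⟨t', Or.inr rfl, h.symm⟩]
  have hw' : ∃ w, (w = t ∨ w = t') ∧ tailPt w = x' := by
    rcases hx' with h | h <;> rcases hu with ⟨a, b⟩ | ⟨a, b⟩
    exacts [⟨u, Or.inl a, h.symm⟩, ⟨u, Or.inr a, h.symm⟩, ⟨u', Or.inr b, h.symm⟩,
      ⟨u', Or.inl b, h.symm⟩]
  obtain ⟨w, hw, rfl⟩ := hw
  obtain ⟨w', hw', rfl⟩ := hw'
  have g := hAt_dAt_circle (Z := Z) h₁.ne hw e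
  have g' := hAt_dAt_circle (Z := Z) h₁.ne hw' e'
  rw [Z.hAt_congr hzz (.refl _), ← g] at g'
  exact (LinearMap.congr_fun g' (Z.one _)).symm

/-- A merger and a splitting do not move heads, so the two exchanges use the same pair of arcs. Then
the second crossing already lies on these two arcs in `D_α`, where it cannot be a merger. -/
theorem square_XX_MS (h₁ : Z.ExchangeStep ε α β i S₁ t t') (h₂ : Z.ExchangeStep ε β γ j S₂ u u')
    (h₃ : Z.MergeStep ε α β' j S₃) (h₄ : Z.SplitStep ε β' γ i S₄) : False := by
  classical
  have hs : ∀ x, Equiv.swap t t' (Equiv.swap u u' x) = x := fun x => headOf_injective (by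
    rw [← h₁.head, ← h₂.head, h₄.head, h₃.head])
  have hu := TranspositionProduct.swap_eq_swap h₁.ne (c := u) (d := u') (Equiv.ext fun x => by
    rw [← hs x, Equiv.swap_apply_self, hs])
  have hT : ∀ w, (w = t ∨ w = t') → EqvGen (T.Next ε β) (tailPt w) (T.in₁ ε i) ∨
      EqvGen (T.Next ε β) (tailPt w) (T.in₂ ε i) := by
    rintro w (rfl | rfl)
    exacts [Or.inl h₁.tgt₁, Or.inr h₁.tgt₂]
  have h₅ := h₁.surgery.touches_of_tail (hT u (hu.imp And.left And.left)) h₂.src₁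
  have h₆ := h₁.surgery.touches_of_tail (hT u' (hu.symm.imp And.right And.right)) h₂.src₂
  have key : ∀ y, Surgery.Touches (T.Next ε α) (T.in₁ ε i) (T.in₂ ε i) y →
      ∃ w : T.Tail ε, EqvGen (T.Next ε α) (tailPt w) y := by
    rintro y (h | h)
    exacts [⟨t, .trans _ _ _ h₁.src₁ (h.symm _ _)⟩, ⟨t', .trans _ _ _ h₁.src₂ (h.symm _ _)⟩]
  obtain ⟨w, hw⟩ := key _ h₅
  obtain ⟨w', hw'⟩ := key _ h₆
  exact h₃.surgery.not_arcs_of_eqvGen' h₃.tgt (tailPt_spec α w) (tailPt_spec α w') hw hw'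

/-- Again the two transpositions coincide, and the square of D is H by the Cardy condition. -/
theorem square_XX_SM (h₁ : Z.ExchangeStep ε α β i S₁ t t') (h₂ : Z.ExchangeStep ε β γ j S₂ u u')
    (h₃ : Z.SplitStep ε α β' j S₃) (h₄ : Z.MergeStep ε β' γ i S₄) :
    S₂ (S₁ (Z.one _)) = S₄ (S₃ (Z.one _)) := by
  classical
  have hs : ∀ x, Equiv.swap t t' (Equiv.swap u u' x) = x := fun x => headOf_injective (by
    rw [← h₁.head, ← h₂.head, h₄.head, h₃.head])
  have hD : Z.dAt γ t t' = Z.dAt γ u u' := dAt_eq_of_swap (α := α) h₁.ne fun x => by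
    rw [← hs x, Equiv.swap_apply_self, hs]
  rw [h₁.one, h₂.d_apply, h₂.one, h₃.one, h₄.h_apply, h₄.one, hD,
    ← Z.hAt_congr h₂.tgt₁ h₂.tgt₂]
  exact LinearMap.congr_fun (Z.dOp_mul_self (cls_tail_ne h₂.ne) _ _) _

/-- The two products of transpositions agree, and `TranspositionProduct.mul_eq_mul` applies unless
they are `1`. In that case the permutation alone does not identify the arcs of the second route; but
the second crossing lies on the arcs with tails `t`, `t'`, so all four exchanges use this pair. -/
theorem square_XX_XX (h₁ : Z.ExchangeStep ε α β i S₁ t t') (h₂ : Z.ExchangeStep ε β γ j S₂ u u')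
    (h₃ : Z.ExchangeStep ε α β' j S₃ v v') (h₄ : Z.ExchangeStep ε β' γ i S₄ w w') :
    S₂ (S₁ (Z.one _)) = S₄ (S₃ (Z.one _)) := by
  classical
  have hs : Equiv.swap t t' * Equiv.swap u u' = Equiv.swap v v' * Equiv.swap w w' :=
    Equiv.ext fun x => headOf_injective (α := α) (by
      rw [Equiv.Perm.mul_apply, Equiv.Perm.mul_apply, ← h₁.head, ← h₂.head, ← h₃.head, ← h₄.head])
  rw [h₁.one, h₂.d_apply, h₂.one, h₃.one, h₄.d_apply, h₄.one]
  suffices h : Z.dAt γ t t' * Z.dAt γ u u' = Z.dAt γ v v' * Z.dAt γ w w' from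
    LinearMap.congr_fun h _
  by_cases hne : Equiv.swap t t' = Equiv.swap u u'
  · have hu := TranspositionProduct.swap_eq_swap h₁.ne hne
    have hT : ∀ w, (w = t ∨ w = t') → EqvGen (T.Next ε β) (tailPt w) (T.in₁ ε i) ∨
        EqvGen (T.Next ε β) (tailPt w) (T.in₂ ε i) := by
      rintro w (rfl | rfl)
      exacts [Or.inl h₁.tgt₁, Or.inr h₁.tgt₂]
    have h₅ := h₁.surgery.touches_of_tail (hT u (hu.imp And.left And.left)) h₂.src₁
    have h₆ := h₁.surgery.touches_of_tail (hT u' (hu.symm.imp And.right And.right)) h₂.src₂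
    have key : ∀ x y, Surgery.Touches (T.Next ε α) (T.in₁ ε i) (T.in₂ ε i) y →
        EqvGen (T.Next ε α) (tailPt x) y → x = t ∨ x = t' := by
      rintro x y (h | h) hx
      exacts [Or.inl (tail_eq (.trans _ _ _ (.trans _ _ _ hx h) (h₁.src₁.symm _ _))),
        Or.inr (tail_eq (.trans _ _ _ (.trans _ _ _ hx h) (h₁.src₂.symm _ _)))]
    have hv := key v _ h₅ h₃.src₁
    have hv' := key v' _ h₆ h₃.src₂
    have hvt : Equiv.swap t t' = Equiv.swap v v' := by
      have := h₃.ne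
      rcases hv with rfl | rfl <;> rcases hv' with rfl | rfl
      · exact absurd rfl this
      · rfl
      · exact Equiv.swap_comm _ _
      · exact absurd rfl this
    have hwu : Equiv.swap u u' = Equiv.swap w w' := by
      rw [hvt] at hs
      exact mul_left_cancel hs
    rw [TranspositionProduct.congr_swap (Z.dAt γ) Z.dAt_symm h₁.ne hvt,
      TranspositionProduct.congr_swap (Z.dAt γ) Z.dAt_symm h₂.ne hwu]
  · exact TranspositionProduct.mul_eq_mul (Z.dAt γ) Z.dAt_symm
      (fun a b c d _ _ h₁ h₂ h₃ h₄ => Z.dOp_commute _ _ _ _ (cls_tail_ne h₁) (cls_tail_ne h₂)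
        (cls_tail_ne h₃) (cls_tail_ne h₄))
      (fun a b c h₁ _ h₃ => Z.dOp_mul_dOp_cyclic _ _ _ (cls_tail_ne h₁) (cls_tail_ne h₃))
      h₁.ne h₂.ne h₃.ne hne hs

end squares

-- The comparison on the unit vector for all types of the four saddles: M merges, S splits and X
-- exchanges. The two letters before the underscore in the lemmas `square_MS_SM` and the like are
-- one route, those behind it the other.
open Classical in
theorem sadTo_one_comm (hi : i ∉ α) (hj : j ∉ α) (hij : i ≠ j) (h₁ : insert i α = β)
    (h₂ : insert j β = γ) (h₃ : insert j α = β') (h₄ : insert i β' = γ) :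
    Z.sadTo ε h₂ (Z.sadTo ε h₁ (Z.one _)) = Z.sadTo ε h₄ (Z.sadTo ε h₃ (Z.one _)) := by
  have hj' : j ∉ β := by simp [← h₁, hj, hij.symm]
  have hi' : i ∉ β' := by simp [← h₃, hi, hij]
  rcases Z.sadTo_cases (ε := ε) hi h₁ with s₁ | s₁ | ⟨t, t', s₁⟩ <;>
    rcases Z.sadTo_cases (ε := ε) hj' h₂ with s₂ | s₂ | ⟨u, u', s₂⟩ <;>
    rcases Z.sadTo_cases (ε := ε) hj h₃ with s₃ | s₃ | ⟨v, v', s₃⟩ <;>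
    rcases Z.sadTo_cases (ε := ε) hi' h₄ with s₄ | s₄ | ⟨w, w', s₄⟩ <;>
    have c₁ := s₁.card <;> have c₂ := s₂.card <;> have c₃ := s₃.card <;> have c₄ := s₄.card <;>
    -- The number of components changes by -1, +1 or 0, and both routes have the same total change.
    -- This leaves 19 of the 81 combinations.
    first
    | (exfalso; omega)
    | skip
  · rw [s₁.one, s₂.one, s₃.one, s₄.one]
  · exact square_MS_MS s₁ s₂ s₃ s₄
  · exact square_MS_SM s₁ s₂ s₃ s₄
  · exact (square_XX_MS s₃ s₄ s₁ s₂).elim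
  · exact square_MX_MX s₁ s₂ s₃ s₄
  · exact square_MX_XM s₁ s₂ s₃ s₄
  · exact (square_MS_SM s₃ s₄ s₁ s₂).symm
  · exact square_SM_SM s₁ s₂ s₃ s₄
  · exact (square_XX_SM s₃ s₄ s₁ s₂).symm
  · rw [s₁.one, s₂.h_apply, s₂.one, s₃.one, s₄.h_apply, s₄.one, hAt_mul_hAt]
  · exact (square_SX_SX s₁ s₂ s₃).elim
  · exact square_SX_XS s₁ s₂ s₃ s₄
  · exact (square_MX_XM s₃ s₄ s₁ s₂).symm
  · exact square_XM_XM s₁ s₂ s₃ s₄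
  · exact (square_SX_XS s₃ s₄ s₁ s₂).symm
  · exact square_XS_XS s₁ s₂ s₃ s₄
  · exact (square_XX_MS s₁ s₂ s₃ s₄).elim
  · exact square_XX_SM s₁ s₂ s₃ s₄
  · exact square_XX_XX s₁ s₂ s₃ s₄

open Classical in
/-- Two saddles commute. -/
theorem sadTo_comm (hi : i ∉ α) (hj : j ∉ α) (hij : i ≠ j) (h₁ : insert i α = β)
    (h₂ : insert j β = γ) (h₃ : insert j α = β') (h₄ : insert i β' = γ) :
    Z.sadTo ε h₂ ∘ₗ Z.sadTo ε h₁ = Z.sadTo ε h₄ ∘ₗ Z.sadTo ε h₃ := by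
  have hj' : j ∉ β := by simp [← h₁, hj, hij.symm]
  have hi' : i ∉ β' := by simp [← h₃, hi, hij]
  have s₁ := Z.sadTo_step (ε := ε) hi h₁
  have s₂ := Z.sadTo_step (ε := ε) hj' h₂
  have s₃ := Z.sadTo_step (ε := ε) hj h₃
  have s₄ := Z.sadTo_step (ε := ε) hi' h₄
  -- The equalizer of the two composites contains the unit vector, so it is everything once it is
  -- closed under left multiplications.
  refine LinearMap.eqLocus_eq_top.1 (Z.eq_top_of_one_mem _ (T.family α) rfl _
    (sadTo_one_comm hi hj hij h₁ h₂ h₃ h₄) ?_)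
  intro x s h a v hv
  have hv : Z.sadTo ε h₂ (Z.sadTo ε h₁ v) = Z.sadTo ε h₄ (Z.sadTo ε h₃ v) := hv
  change Z.sadTo ε h₂ (Z.sadTo ε h₁ _) = Z.sadTo ε h₄ (Z.sadTo ε h₃ _)
  obtain ⟨P, rfl⟩ := Quot.exists_rep x
  cases s
  · have e : Z.opAt (T.family α) (T.cls α P) false h (LinearMap.mulLeft k a) =
        Z.cOp (T.family α) (T.cls α P) a := by
      rw [cOp_eq Z h, conv_false_false]
    rw [e, s₁.cComm P, s₂.cComm P, s₃.cComm P, s₄.cComm P, hv]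
  -- Left multiplications by the arc algebra are transported along tails, so the arc is represented
  -- by its tail.
  · obtain ⟨t, ht⟩ := (isArc_iff_tail ε P).1 h
    have ht := (cls_eq_iff ε).2 ht
    have e : Z.opAt (T.family α) (T.cls α P) true h (LinearMap.mulLeft k a) =
        Z.lOp (T.family α) (T.cls α (tailPt t)) (tail_isArc α t) a := by
      have key : ∀ {x y : (T.family α).ι} (h : (T.family α).isArc x = true)
          (h' : (T.family α).isArc y = true), x = y →
          Z.opAt (T.family α) x true h (LinearMap.mulLeft k a) = Z.lOp (T.family α) y h' a := by
        rintro x _ h h' rfl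
        rfl
      exact key h _ ht.symm
    rw [e, s₁.lComm t _ (tail_isArc β t), s₂.lComm t _ (tail_isArc γ t),
      s₃.lComm t _ (tail_isArc β' t), s₄.lComm t _ (tail_isArc γ t), hv]

end OpenClosedTQFT

/-! ### Homomorphisms from a tensor power of an algebra -/

namespace PiTensorProduct

variable {R : Type*} [CommSemiring R] {n : ℕ} {B E : Type*} [Semiring B] [Algebra R B] [Semiring E]
  [Algebra R E]

/-- The target of `commLift` is not commutative; only values at different factors commute, which
suffices to sort the ordered product. -/
theorem prod_ofFn_mul {M : Type*} [Monoid M] : ∀ {n : ℕ} (g h : Fin n → M)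
    (_ : ∀ i j, i ≠ j → Commute (g i) (h j)),
    (List.ofFn fun i => g i * h i).prod = (List.ofFn g).prod * (List.ofFn h).prod
  | 0, _, _, _ => by simp
  | n + 1, g, h, H => by
    have hc : Commute (List.ofFn fun i : Fin n => g i.succ).prod (h 0) :=
      Commute.list_prod_left _ _ fun x hx => by
        obtain ⟨i, rfl⟩ := (List.mem_ofFn' _ _).1 hx
        exact H _ _ (Fin.succ_ne_zero i)
    rw [List.ofFn_succ, List.ofFn_succ, List.ofFn_succ, List.prod_cons, List.prod_cons,
      List.prod_cons, prod_ofFn_mul (fun i => g i.succ) (fun i => h i.succ) fun i j hij =>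
        H _ _ fun e => hij (Fin.succ_injective _ e)]
    exact hc.symm.mul_mul_mul_comm _ _

theorem prod_ofFn_eq {M : Type*} [Monoid M] : ∀ {n : ℕ} (g : Fin n → M) (j : Fin n)
    (_ : ∀ i, i ≠ j → g i = 1), (List.ofFn g).prod = g j
  | 0, _, j, _ => j.elim0
  | n + 1, g, j, H => by
    rw [List.ofFn_succ, List.prod_cons]
    cases j using Fin.cases with
    | zero =>
      have e : (fun i : Fin n => g i.succ) = fun _ => 1 := funext fun i => H _ (Fin.succ_ne_zero i)
      rw [e, List.ofFn_const, List.prod_replicate, one_pow, mul_one]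
    | succ j =>
      rw [H 0 (Fin.succ_ne_zero j).symm, one_mul]
      exact prod_ofFn_eq (fun i => g i.succ) j fun i hi => H _ fun e => hi (Fin.succ_injective _ e)

/-- The homomorphism given by homomorphisms on the factors with commuting values. -/
noncomputable def commLift (f : Fin n → B →ₐ[R] E)
    (hf : ∀ i j, i ≠ j → ∀ a b, Commute (f i a) (f j b)) : (⨂[R] _ : Fin n, B) →ₐ[R] E :=
  liftAlgHom ((MultilinearMap.mkPiAlgebraFin R n E).compLinearMap fun i => (f i).toLinearMap)
    (by simp)
    (fun x y => by
      simp only [MultilinearMap.compLinearMap_apply, MultilinearMap.mkPiAlgebraFin_apply,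
        AlgHom.toLinearMap_apply, Pi.mul_apply, map_mul]
      exact prod_ofFn_mul _ _ fun i j hij => hf i j hij _ _)

theorem commLift_single (f : Fin n → B →ₐ[R] E)
    (hf : ∀ i j, i ≠ j → ∀ a b, Commute (f i a) (f j b)) (j : Fin n) (b : B) :
    commLift f hf (singleAlgHom j b) = f j b := by
  have h : commLift f hf (singleAlgHom j b) =
      (List.ofFn fun i => f i (Pi.mulSingle (M := fun _ : Fin n => B) j b i)).prod := by
    refine (PiTensorProduct.lift.tprod _).trans ?_
    rfl
  rw [h, prod_ofFn_eq _ j, Pi.mulSingle_eq_same]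
  intro i hi
  rw [Pi.mulSingle_eq_of_ne hi, map_one]

/-- A pure tensor is the product of its factors, each placed in its own position. -/
theorem eq_top_of_single_mem (S : Subalgebra R (⨂[R] _ : Fin n, B))
    (h : ∀ j b, singleAlgHom j b ∈ S) (x : ⨂[R] _ : Fin n, B) : x ∈ S := by
  induction x using PiTensorProduct.induction_on with
  | smul_tprod r x =>
    refine S.smul_mem ?_ r
    rw [(congrArg (tprod R) (Finset.noncommProd_mulSingle x)).symm.trans (tprod_noncommProd _ _ _)]
    exact S.toSubmonoid.noncommProd_mem _ _ _ fun j _ => h j (x j)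
  | add x y hx hy => exact S.add_mem hx hy

/-- An operator which intertwines the actions of the factors intertwines the action of the tensor
power. -/
theorem intertwine {M N : Type*} [AddCommMonoid M] [AddCommMonoid N] [Module R M] [Module R N]
    (S : M →ₗ[R] N) (f : (⨂[R] _ : Fin n, B) →ₐ[R] Module.End R M)
    (g : (⨂[R] _ : Fin n, B) →ₐ[R] Module.End R N)
    (h : ∀ j b v, S (f (singleAlgHom j b) v) = g (singleAlgHom j b) (S v))
    (x : ⨂[R] _ : Fin n, B) (v : M) : S (f x v) = g x (S v) := by
  let U : Subalgebra R (⨂[R] _ : Fin n, B) :=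
    { carrier := {x | ∀ v, S (f x v) = g x (S v)}
      mul_mem' := fun {x y} hx hy v => by
        rw [map_mul, map_mul, Module.End.mul_apply, Module.End.mul_apply, hx, hy]
      add_mem' := fun {x y} hx hy v => by
        rw [map_add, map_add, LinearMap.add_apply, LinearMap.add_apply, map_add, hx, hy]
      algebraMap_mem' := fun r v => by
        rw [AlgHom.commutes, AlgHom.commutes, Module.algebraMap_end_apply,
          Module.algebraMap_end_apply, map_smul] }
  exact eq_top_of_single_mem U h x v

/-- The subalgebra is taken before passing to the opposite algebra, hence the reversed use of the
two factors in the product. -/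
theorem intertwine_op {M N : Type*} [AddCommMonoid M] [AddCommMonoid N] [Module R M] [Module R N]
    (S : M →ₗ[R] N) (f : (⨂[R] _ : Fin n, B)ᵐᵒᵖ →ₐ[R] Module.End R M)
    (g : (⨂[R] _ : Fin n, B)ᵐᵒᵖ →ₐ[R] Module.End R N)
    (h : ∀ j b v, S (f (.op (singleAlgHom j b)) v) = g (.op (singleAlgHom j b)) (S v))
    (x : (⨂[R] _ : Fin n, B)ᵐᵒᵖ) (v : M) : S (f x v) = g x (S v) := by
  let U : Subalgebra R (⨂[R] _ : Fin n, B) :=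
    { carrier := {x | ∀ v, S (f (.op x) v) = g (.op x) (S v)}
      mul_mem' := fun {x y} hx hy v => by
        rw [MulOpposite.op_mul, map_mul, map_mul, Module.End.mul_apply, Module.End.mul_apply, hy,
          hx]
      add_mem' := fun {x y} hx hy v => by
        rw [MulOpposite.op_add, map_add, map_add, LinearMap.add_apply, LinearMap.add_apply,
          map_add, hx, hy]
      algebraMap_mem' := fun r v => by
        rw [← MulOpposite.algebraMap_apply, AlgHom.commutes, AlgHom.commutes,
          Module.algebraMap_end_apply, Module.algebraMap_end_apply, map_smul] }
  exact eq_top_of_single_mem U h x.unop v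

end PiTensorProduct

namespace DirectSum

/-- Operators on the summands of a direct sum as an operator on the direct sum. -/
noncomputable def diagonal {R I : Type*} [CommSemiring R] [DecidableEq I] (M : I → Type*)
    [∀ i, AddCommMonoid (M i)] [∀ i, Module R (M i)] :
    (∀ i, Module.End R (M i)) →ₐ[R] Module.End R (⨁ i, M i) :=
  AlgHom.ofLinearMap
    { toFun := fun f => lmap f
      map_add' := fun f g => by
        ext i x : 2
        simp [lmap_lof]
      map_smul' := fun c f => by
        ext i x : 2
        simp [lmap_lof] }
    lmap_id (fun f g => lmap_comp g f)

end DirectSum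

/-! ### The actions of the arc algebra -/

namespace OpenClosedTQFT

variable {k : Type u} [Field k] (Z : OpenClosedTQFT k) (X : Ob) (x : X.ι) (h : X.isArc x = true)

attribute [local instance] ringSingle algebraSingle

theorem map_arcIso_hom (a : Z.val (single true)) (w : Z.val (rest X x)) :
    Z.map (arcIso X x h).hom (Z.mm _ _ a w) = (Split.canonical X x true h).ins Z a w := rfl

theorem map_arcIso_inv (a : Z.val (single true)) (w : Z.val (rest X x)) :
    Z.map (arcIso X x h).inv ((Split.canonical X x true h).ins Z a w) = Z.mm _ _ a w := by
  rw [← map_arcIso_hom, ← map_comp, Iso.hom_inv_id, map_id]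

/-- Connects the action given by the cobordism `mulLeft` with `opAt`: on a product `b ⊗ w` the
cobordism reassociates and multiplies `a` with `b`. -/
theorem actLeft_eq (a : Z.A) : Z.actLeft X x h a = Z.lOp X x h a := by
  refine (Split.canonical X x true h).ext_ins fun b w => ?_
  rw [lOp, Split.opAt_ins]
  change Z.map (mulLeft X x h) (Z.mm _ _ a _) = _
  rw [mulLeft, map_comp, map_comp, map_comp]
  have h₁ := Z.map_tensor (𝟙 (single true)) (arcIso X x h).inv a
    ((Split.canonical X x true h).ins Z b w)
  rw [map_id, map_arcIso_inv] at h₁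
  have h₂ := Z.map_cob_assocInv a b w
  have h₃ := Z.map_tensor (cob (PreCob.mul true)) (𝟙 (rest X x)) (Z.mm _ _ a b) w
  rw [map_id, map_mul_mm] at h₃
  refine (congrArg (Z.map _ <| Z.map _ <| Z.map _ ·) h₁).trans ?_
  refine (congrArg (Z.map _ <| Z.map _ ·) h₂).trans ?_
  exact congrArg (Z.map _) h₃

theorem actRight_eq (a : Z.A) : Z.actRight X x h a = Z.rOp X x h a := by
  refine (Split.canonical X x true h).ext_ins fun b w => ?_
  rw [rOp, Split.opAt_ins]
  change Z.map (mulRight X x h) (Z.mm _ _ _ a) = _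
  rw [mulRight, map_comp, map_comp, map_comp, map_comp, map_comp]
  have h₁ := Z.map_tensor (arcIso X x h).inv (𝟙 (single true))
    ((Split.canonical X x true h).ins Z b w) a
  rw [map_id, map_arcIso_inv] at h₁
  have h₂ := Z.map_cob_assoc b w a
  have h₃ := Z.map_tensor (𝟙 (single true)) (cob (PreCob.flip (rest X x) (single true))) b
    (Z.mm _ _ w a)
  rw [map_id, map_cob_flip] at h₃
  have h₄ := Z.map_cob_assocInv b a w
  have h₅ := Z.map_tensor (cob (PreCob.mul true)) (𝟙 (rest X x)) (Z.mm _ _ b a) w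
  rw [map_id, map_mul_mm] at h₅
  refine (congrArg (Z.map _ <| Z.map _ <| Z.map _ <| Z.map _ <| Z.map _ ·) h₁).trans ?_
  refine (congrArg (Z.map _ <| Z.map _ <| Z.map _ <| Z.map _ ·) h₂).trans ?_
  refine (congrArg (Z.map _ <| Z.map _ <| Z.map _ ·) h₃).trans ?_
  refine (congrArg (Z.map _ <| Z.map _ ·) h₄).trans ?_
  exact congrArg (Z.map _) h₅

/-- Left multiplication on an arc as a homomorphism. -/
noncomputable def lHom : Z.A →ₐ[k] Module.End k (Z.functor.obj X) :=
  AlgHom.ofLinearMap (Z.lLin X x h) (Z.lOp_one X x h) (Z.lOp_mul X x h)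

/-- Right multiplication on an arc as a homomorphism. -/
noncomputable def rHom : Z.A →ₐ[k] (Module.End k (Z.functor.obj X))ᵐᵒᵖ :=
  AlgHom.ofLinearMap ((MulOpposite.opLinearEquiv k).toLinearMap ∘ₗ Z.rLin X x h)
    (congrArg MulOpposite.op (Z.rOp_one X x h))
    (fun a b => congrArg MulOpposite.op (Z.rOp_mul X x h a b))

variable {X} {r : ℕ} (s : Fin r → X.ι) (hs : ∀ j, X.isArc (s j) = true)
  (hinj : Function.Injective s)

/-- The left action of a tensor power of the arc algebra on different arcs. -/
noncomputable def leftAct : (⨂[k] _ : Fin r, Z.A) →ₐ[k] Module.End k (Z.functor.obj X) :=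
  PiTensorProduct.commLift (fun j => Z.lHom X (s j) (hs j))
    fun i j hij => Z.lOp_commute (hinj.ne hij) (hs i) (hs j)

/-- The right action of a tensor power of the arc algebra on different arcs. -/
noncomputable def rightAct : (⨂[k] _ : Fin r, Z.A)ᵐᵒᵖ →ₐ[k] Module.End k (Z.functor.obj X) :=
  AlgHom.opComm (PiTensorProduct.commLift (fun j => Z.rHom X (s j) (hs j))
    fun i j hij a b => (Z.rOp_commute (hinj.ne hij) (hs i) (hs j) a b).op)

theorem leftAct_single (j : Fin r) (a : Z.A) :
    Z.leftAct s hs hinj (PiTensorProduct.singleAlgHom j a) = Z.lOp X (s j) (hs j) a :=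
  PiTensorProduct.commLift_single _ _ _ _

theorem rightAct_single (j : Fin r) (a : Z.A) :
    Z.rightAct s hs hinj (.op (PiTensorProduct.singleAlgHom j a)) = Z.rOp X (s j) (hs j) a :=
  congrArg MulOpposite.unop (PiTensorProduct.commLift_single (fun j => Z.rHom X (s j) (hs j))
    (fun i j hij a b => (Z.rOp_commute (hinj.ne hij) (hs i) (hs j) a b).op) j a)

/-- Intertwining is used once for each tensor power, which reduces the claim to single factors.
There it is `lOp_rOp_commute`, and hence associativity on a common arc. -/
theorem leftAct_rightAct {r' : ℕ} (s' : Fin r' → X.ι) (hs' : ∀ j, X.isArc (s' j) = true)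
    (hinj' : Function.Injective s') (a : ⨂[k] _ : Fin r, Z.A) (b : (⨂[k] _ : Fin r', Z.A)ᵐᵒᵖ)
    (v : Z.functor.obj X) : Z.leftAct s hs hinj a (Z.rightAct s' hs' hinj' b v) =
      Z.rightAct s' hs' hinj' b (Z.leftAct s hs hinj a v) := by
  refine PiTensorProduct.intertwine_op (Z.leftAct s hs hinj a) _ _ (fun j' b v => ?_) b v
  refine (PiTensorProduct.intertwine (Z.rightAct s' hs' hinj' _) _ _ (fun j a v => ?_) a v).symm
  rw [rightAct_single, leftAct_single]
  exact (LinearMap.congr_fun (Z.lOp_rOp_commute (s j) (s' j') (hs j) (hs' j') a b).eq v).symm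

end OpenClosedTQFT

/-! ### The tangle complex -/

namespace TangleDiagram

variable {p q : ℕ} (T : TangleDiagram p q) (ε : ℤˣ)

/-- Any smoothing will do; the empty set of `1`-smoothings is chosen. -/
theorem card_tail_eq_card_head : Nat.card (T.Tail ε) = Nat.card (T.Head ε) :=
  Nat.card_eq_of_bijective (headOf ε (∅ : Finset T.Crossing)) ⟨headOf_injective, fun h => by
    obtain ⟨t, ht⟩ := exists_tail ∅ h
    exact ⟨t, headOf_eq ht⟩⟩

theorem card_tail_add_card_head : Nat.card (T.Tail ε) + Nat.card (T.Head ε) = p + q := by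
  have e : T.Head ε = {b // ¬ T.IsTail ε b} :=
    congrArg Subtype (funext fun b => propext (T.not_isTail (ε := ε) b).symm)
  have h : Nat.card {b // T.IsTail ε b} + Nat.card {b // ¬ T.IsTail ε b} =
      Nat.card (Fin p ⊕ Fin q) := by
    classical
    rw [← Nat.card_sum]
    exact Nat.card_congr (Equiv.sumCompl _)
  rw [e]
  refine h.trans ?_
  rw [Nat.card_sum, Nat.card_fin, Nat.card_fin]

variable {T ε} {k : Type u} [Field k] (Z : OpenClosedTQFT k) (N : T.Numbering)
  {α β β' γ : Finset T.Crossing} {i j : T.Crossing}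

theorem number_position (α : Finset T.Crossing) (b : Fin p ⊕ Fin q) :
    N.number α (position N α b) = T.cls α (T.boundary b) := (N.number α).apply_symm_apply _

theorem position_tail_injective (α : Finset T.Crossing) :
    Function.Injective fun t : T.Tail ε => position N α t.1 := fun _ _ h =>
  tail_eq ((cls_eq_iff ε).1 ((N.number α).symm.injective h))

theorem position_head_injective (α : Finset T.Crossing) :
    Function.Injective fun t : T.Head ε => position N α t.1 := fun _ _ h =>
  head_eq ((cls_eq_iff ε).1 ((N.number α).symm.injective h))

/-- The isomorphism given by a numbering of the components. -/
noncomputable def num (α : Finset T.Crossing) :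
    Z.val (vertex N α) →ₗ[k] Z.val (T.family α) :=
  Z.rel (X := vertex N α) (Y := T.family α) (N.number α) fun _ => rfl

/-- The inverse of `num`. -/
noncomputable def unnum (α : Finset T.Crossing) :
    Z.val (T.family α) →ₗ[k] Z.val (vertex N α) :=
  Z.rel (X := T.family α) (Y := vertex N α) (N.number α).symm
    (OpenClosedTQFT.symm_isArc (X := vertex N α) (Y := T.family α) _ fun _ => rfl)

theorem num_unnum (α : Finset T.Crossing) (v : Z.val (T.family α)) :
    num Z N α (unnum Z N α v) = v :=
  Z.rel_rel_symm (X := vertex N α) (Y := T.family α) _ _ _ v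

open Classical in
/-- The linear map of a saddle between numbered smoothings. -/
noncomputable def edgeMap (ε : ℤˣ) (h : insert j α = γ) :
    Z.functor.obj (vertex N α) →ₗ[k] Z.functor.obj (vertex N γ) :=
  unnum Z N γ ∘ₗ Z.sadTo ε h ∘ₗ num Z N α

open Classical in
theorem map_edge (x : Z.functor.obj (vertex N α)) :
    (Z.functor.map (edge N ε α j)).hom x = edgeMap Z N ε rfl x := by
  refine (Z.map_comp _ _ x).trans ((Z.map_comp _ _ _).trans ?_)
  rfl

open Classical in
theorem edgeMap_comm (hi : i ∉ α) (hj : j ∉ α) (hij : i ≠ j) (h₁ : insert i α = β)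
    (h₂ : insert j β = γ) (h₃ : insert j α = β') (h₄ : insert i β' = γ)
    (x : Z.functor.obj (vertex N α)) :
    edgeMap Z N ε h₂ (edgeMap Z N ε h₁ x) = edgeMap Z N ε h₄ (edgeMap Z N ε h₃ x) := by
  simp only [edgeMap, LinearMap.comp_apply, num_unnum]
  exact congrArg _ (LinearMap.congr_fun
    (OpenClosedTQFT.sadTo_comm hi hj hij h₁ h₂ h₃ h₄) _)

attribute [local instance] OpenClosedTQFT.ringSingle OpenClosedTQFT.algebraSingle

section naturality

variable (s : Bool) (φ : Module.End k (Z.val (single s)))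

theorem num_opAt (α : Finset T.Crossing) (b : Fin p ⊕ Fin q)
    (h : (vertex N α).isArc (position N α b) = s)
    (h' : (T.family α).isArc (T.cls α (T.boundary b)) = s) (v : Z.val (vertex N α)) :
    num Z N α (Z.opAt _ (position N α b) s h φ v) = Z.opAt _ _ s h' φ (num Z N α v) :=
  (Z.opAt_rel s φ (X := vertex N α) (Y := T.family α) _ _ (number_position N α b) h h' v).symm

theorem unnum_opAt (α : Finset T.Crossing) (b : Fin p ⊕ Fin q)
    (h : (vertex N α).isArc (position N α b) = s)
    (h' : (T.family α).isArc (T.cls α (T.boundary b)) = s) (v : Z.val (T.family α)) :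
    unnum Z N α (Z.opAt _ _ s h' φ v) = Z.opAt _ (position N α b) s h φ (unnum Z N α v) :=
  (Z.opAt_rel s φ (X := T.family α) (Y := vertex N α) _ _ rfl h' h v).symm

end naturality

open Classical in
theorem edgeMap_lOp (hj : j ∉ α) (h : insert j α = γ) (t : T.Tail ε) (a : Z.A)
    (x : Z.functor.obj (vertex N α)) :
    edgeMap Z N ε h (Z.lOp _ (position N α t.1) (position_isArc N α t.1) a x) =
      Z.lOp _ (position N γ t.1) (position_isArc N γ t.1) a (edgeMap Z N ε h x) := by
  simp only [edgeMap, LinearMap.comp_apply, OpenClosedTQFT.lOp]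
  rw [num_opAt Z N true _ α t.1 _ (tail_isArc α t)]
  refine (congrArg _ ((Z.sadTo_step hj h).lComm t (tail_isArc α t) (tail_isArc γ t) a _)).trans ?_
  exact unnum_opAt Z N true _ γ t.1 _ (tail_isArc γ t) _

open Classical in
theorem edgeMap_rOp (hj : j ∉ α) (h : insert j α = γ) (t : T.Head ε) (a : Z.A)
    (x : Z.functor.obj (vertex N α)) :
    edgeMap Z N ε h (Z.rOp _ (position N α t.1) (position_isArc N α t.1) a x) =
      Z.rOp _ (position N γ t.1) (position_isArc N γ t.1) a (edgeMap Z N ε h x) := by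
  subst h
  simp only [edgeMap, LinearMap.comp_apply, OpenClosedTQFT.rOp]
  rw [num_opAt Z N true _ α t.1 _ (head_isArc α t)]
  refine (congrArg _ (Z.sadAt_rComm hj t (head_isArc α t) (head_isArc _ t) a _)).trans ?_
  exact unnum_opAt Z N true _ _ t.1 _ (head_isArc _ t) _

variable {n : ℕ} (ν : T.Crossing ≃ Fin n)

/-- The inclusion of a vertex of the cube. -/
noncomputable abbrev incl {m : ℤ} (α : T.Height m) :
    Z.functor.obj (vertex N α.1) →ₗ[k] term N Z m :=
  DirectSum.lof k (T.Height m) (fun β => Z.functor.obj (vertex N β.1)) α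

open Classical in
/-- Add a crossing to a vertex of the cube. -/
def Height.insert {m : ℤ} (α : T.Height m) (j : {j : T.Crossing // j ∉ α.1}) :
    T.Height (m + 1) :=
  ⟨Insert.insert j.1 α.1, by
    have h := α.2
    rw [Finset.card_insert_of_notMem j.2]
    push_cast
    omega⟩

open Classical in
theorem Height.val_insert {m : ℤ} (α : T.Height m) (j : {j : T.Crossing // j ∉ α.1}) :
    Insert.insert j.1 α.1 = (Height.insert α j).1 := rfl

/-- The sign of an edge of the cube. -/
def edgeSign (k : Type u) [Field k] (α : Finset T.Crossing) (j : T.Crossing) : k :=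
  (-1) ^ (α.filter fun l => ν l < ν j).card

open Classical in
theorem d_incl {m : ℤ} (α : T.Height m) (x : Z.functor.obj (vertex N α.1)) :
    d ν N ε Z m (incl Z N α x) = ((-1 : k) ^ T.negatives) •
      ∑ j : {j : T.Crossing // j ∉ α.1}, edgeSign ν k α.1 j.1 •
        incl Z N (Height.insert α j) (edgeMap Z N ε (Height.val_insert α j) x) := by
  rw [d, incl, DirectSum.toModule_lof, LinearMap.smul_apply, LinearMap.sum_apply]
  refine congrArg _ (Finset.sum_congr rfl fun j _ => ?_)
  rw [LinearMap.smul_apply, LinearMap.comp_apply, map_edge]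
  rfl

open Classical in
theorem edgeSign_insert (hj : j ∉ α) :
    edgeSign ν k (insert j α) i = (if ν j < ν i then -1 else 1) * edgeSign ν k α i := by
  rw [edgeSign, edgeSign, Finset.filter_insert]
  split_ifs with h
  · rw [Finset.card_insert_of_notMem fun h' => hj (Finset.mem_filter.1 h').1, pow_succ']
  · rw [one_mul]

-- Inserting one crossing changes the sign at the other if and only if it has the smaller number,
-- which happens for exactly one of two different crossings.
open Classical in
theorem edgeSign_anticomm (hi : i ∉ α) (hj : j ∉ α) (hij : i ≠ j) :
    edgeSign ν k α i * edgeSign ν k (insert i α) j +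
      edgeSign ν k α j * edgeSign ν k (insert j α) i = 0 := by
  rw [edgeSign_insert ν hi, edgeSign_insert ν hj]
  rcases lt_or_gt_of_ne (ν.injective.ne hij) with h | h
  · rw [if_pos h, if_neg h.not_gt]
    ring
  · rw [if_pos h, if_neg h.not_gt]
    ring

-- The two routes end at subsets that are equal only propositionally; after inclusion into the
-- direct sum the values can be compared.
open Classical in
theorem incl_edgeMap_comm {m : ℤ} {γ γ' : T.Height m} (e : γ.1 = γ'.1) (hi : i ∉ α) (hj : j ∉ α)
    (hij : i ≠ j) (h₁ : insert i α = β) (h₂ : insert j β = γ.1) (h₃ : insert j α = β')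
    (h₄ : insert i β' = γ'.1) (x : Z.functor.obj (vertex N α)) :
    incl Z N γ (edgeMap Z N ε h₂ (edgeMap Z N ε h₁ x)) =
      incl Z N γ' (edgeMap Z N ε h₄ (edgeMap Z N ε h₃ x)) := by
  obtain rfl : γ = γ' := Subtype.ext e
  rw [edgeMap_comm Z N hi hj hij h₁ h₂ h₃ h₄]

open Classical in
theorem d_comp_d (m : ℤ) : d ν N ε Z (m + 1) ∘ₗ d ν N ε Z m = 0 := by
  refine DirectSum.linearMap_ext _ fun α => LinearMap.ext fun x => ?_
  change d ν N ε Z (m + 1) (d ν N ε Z m (incl Z N α x)) = 0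
  simp only [d_incl, map_smul, map_sum, Finset.smul_sum, smul_smul]
  rw [Finset.sum_sigma']
  -- The terms are indexed by ordered pairs of crossings outside `α`. Interchanging the pair is an
  -- involution, and paired terms cancel because the saddles commute and the signs anticommute.
  refine Finset.sum_involution (fun a _ => ⟨⟨a.2.1, fun h => a.2.2 (Finset.mem_insert_of_mem h)⟩,
    ⟨a.1.1, fun h => (Finset.mem_insert.1 h).elim
      (fun h => a.2.2 (h ▸ Finset.mem_insert_self _ _)) a.1.2⟩⟩) ?_ ?_ ?_ ?_
  · rintro ⟨⟨i, hi⟩, ⟨j, hj⟩⟩ -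
    have hj' : j ∉ α.1 := fun h => hj (Finset.mem_insert_of_mem h)
    have hij : i ≠ j := fun h => hj (h ▸ Finset.mem_insert_self _ _)
    dsimp only
    have hi' : i ∉ (Height.insert α ⟨j, hj'⟩).1 := fun h => (Finset.mem_insert.1 h).elim hij hi
    have e := incl_edgeMap_comm (ε := ε) Z N (γ := Height.insert (Height.insert α ⟨i, hi⟩) ⟨j, hj⟩)
      (γ' := Height.insert (Height.insert α ⟨j, hj'⟩) ⟨i, hi'⟩) (Finset.insert_comm _ _ _) hi hj'
      hij (Height.val_insert α ⟨i, hi⟩) (Height.val_insert _ ⟨j, hj⟩)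
      (Height.val_insert α ⟨j, hj'⟩) (Height.val_insert _ ⟨i, hi'⟩) x
    refine (congrArg (_ • · + _) e).trans ((add_smul _ _ _).symm.trans ?_)
    refine (congrArg (· • _) ?_).trans (zero_smul k _)
    have hs : edgeSign ν k α.1 i * edgeSign ν k (Height.insert α ⟨i, hi⟩).1 j +
        edgeSign ν k α.1 j * edgeSign ν k (Height.insert α ⟨j, hj'⟩).1 i = 0 :=
      edgeSign_anticomm ν hi hj' hij
    linear_combination ((-1 : k) ^ T.negatives) ^ 2 * hs
  · rintro ⟨⟨i, hi⟩, ⟨j, hj⟩⟩ - - h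
    have hij : i ≠ j := fun h => hj (h ▸ Finset.mem_insert_self _ _)
    exact hij (congrArg (fun a => a.1.1) h).symm
  · exact fun _ _ => Finset.mem_univ _
  · exact fun _ _ => rfl

-- Scalars do not matter here: operators on the summands that are natural for the edges commute with
-- every linear combination of edges. This serves the left and the right action alike.
open Classical in
theorem d_comm {m : ℤ} (F : ∀ α : Finset T.Crossing, Module.End k (Z.functor.obj (vertex N α)))
    (hF : ∀ {α γ : Finset T.Crossing} {j : T.Crossing} (_ : j ∉ α) (h : _ = γ)
      (x : Z.functor.obj (vertex N α)),
      edgeMap Z N ε (j := j) h (F α x) = F γ (edgeMap Z N ε h x)) :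
    d ν N ε Z m ∘ₗ DirectSum.diagonal _ (fun α : T.Height m => F α.1) =
      DirectSum.diagonal _ (fun α : T.Height (m + 1) => F α.1) ∘ₗ d ν N ε Z m := by
  refine DirectSum.linearMap_ext _ fun α => LinearMap.ext fun x => ?_
  have key : ∀ {m : ℤ} (α : T.Height m) (x : Z.functor.obj (vertex N α.1)),
      DirectSum.diagonal _ (fun α : T.Height m => F α.1) (incl Z N α x) = incl Z N α (F α.1 x) :=
    fun α x => DirectSum.lmap_lof _ _ _
  change d ν N ε Z m (DirectSum.diagonal _ (fun α : T.Height m => F α.1) (incl Z N α x)) =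
    DirectSum.diagonal _ (fun α : T.Height (m + 1) => F α.1) (d ν N ε Z m (incl Z N α x))
  rw [key, d_incl, d_incl, map_smul, map_sum]
  refine congrArg _ (Finset.sum_congr rfl fun j _ => ?_)
  rw [map_smul, key]
  exact congrArg _ (congrArg _ (hF j.2 _ x))

end TangleDiagram

theorem mainTheorem9 {k : Type u} [Field k] {p q n : ℕ} (T : TangleDiagram p q) (ε : ℤˣ)
    (ν : T.Crossing ≃ Fin n) (N : T.Numbering) (Z : OpenClosedTQFT k) :
    ∃ r : ℕ, 2 * r = p + q ∧ Nat.card (T.Tail ε) = r ∧ Nat.card (T.Head ε) = r ∧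
      (∀ i : ℤ, TangleDiagram.d ν N ε Z (i + 1) ∘ₗ TangleDiagram.d ν N ε Z i = 0) ∧
      ∀ (s : Fin r ≃ T.Tail ε) (t : Fin r ≃ T.Head ε),
        ∃ (L : ∀ i : ℤ, (⨂[k] _ : Fin r, Z.A) →ₐ[k] Module.End k (TangleDiagram.term N Z i))
          (R : ∀ i : ℤ, (⨂[k] _ : Fin r, Z.A)ᵐᵒᵖ →ₐ[k] Module.End k (TangleDiagram.term N Z i)),
          (∀ (i : ℤ) (j : Fin r) (a : Z.A) (α : T.Height i)
            (x : Z.functor.obj (TangleDiagram.vertex N α.1)),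
            L i (PiTensorProduct.singleAlgHom j a)
                (DirectSum.lof k _ (fun β : T.Height i =>
                  Z.functor.obj (TangleDiagram.vertex N β.1)) α x) =
              DirectSum.lof k _ (fun β : T.Height i =>
                  Z.functor.obj (TangleDiagram.vertex N β.1)) α
                (Z.actLeft (TangleDiagram.vertex N α.1) (TangleDiagram.position N α.1 (s j).1)
                  (TangleDiagram.position_isArc N α.1 (s j).1) a x)) ∧
          (∀ (i : ℤ) (j : Fin r) (a : Z.A) (α : T.Height i)
            (x : Z.functor.obj (TangleDiagram.vertex N α.1)),
            R i (MulOpposite.op (PiTensorProduct.singleAlgHom j a))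
                (DirectSum.lof k _ (fun β : T.Height i =>
                  Z.functor.obj (TangleDiagram.vertex N β.1)) α x) =
              DirectSum.lof k _ (fun β : T.Height i =>
                  Z.functor.obj (TangleDiagram.vertex N β.1)) α
                (Z.actRight (TangleDiagram.vertex N α.1) (TangleDiagram.position N α.1 (t j).1)
                  (TangleDiagram.position_isArc N α.1 (t j).1) a x)) ∧
          (∀ (i : ℤ) (a : ⨂[k] _ : Fin r, Z.A) (b : (⨂[k] _ : Fin r, Z.A)ᵐᵒᵖ),
            L i a ∘ₗ R i b = R i b ∘ₗ L i a) ∧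
          (∀ (i : ℤ) (a : ⨂[k] _ : Fin r, Z.A),
            TangleDiagram.d ν N ε Z i ∘ₗ L i a = L (i + 1) a ∘ₗ TangleDiagram.d ν N ε Z i) ∧
          (∀ (i : ℤ) (b : (⨂[k] _ : Fin r, Z.A)ᵐᵒᵖ),
            TangleDiagram.d ν N ε Z i ∘ₗ R i b = R (i + 1) b ∘ₗ TangleDiagram.d ν N ε Z i) := by
  have h := T.card_tail_eq_card_head ε
  have h' := T.card_tail_add_card_head ε
  refine ⟨Nat.card (T.Tail ε), by omega, rfl, h.symm, TangleDiagram.d_comp_d Z N ν,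
    fun s t => ?_⟩
  let l : ∀ α : Finset T.Crossing, (⨂[k] _ : Fin (Nat.card (T.Tail ε)), Z.A) →ₐ[k]
      Module.End k (Z.functor.obj (TangleDiagram.vertex N α)) := fun α =>
    Z.leftAct (fun j => TangleDiagram.position N α (s j).1)
      (fun j => TangleDiagram.position_isArc N α (s j).1)
      ((TangleDiagram.position_tail_injective N α).comp s.injective)
  let r : ∀ α : Finset T.Crossing, (⨂[k] _ : Fin (Nat.card (T.Tail ε)), Z.A)ᵐᵒᵖ →ₐ[k]
      Module.End k (Z.functor.obj (TangleDiagram.vertex N α)) := fun α =>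
    Z.rightAct (fun j => TangleDiagram.position N α (t j).1)
      (fun j => TangleDiagram.position_isArc N α (t j).1)
      ((TangleDiagram.position_head_injective N α).comp t.injective)
  have hl : ∀ α j a, l α (PiTensorProduct.singleAlgHom j a) =
      Z.actLeft _ _ (TangleDiagram.position_isArc N α (s j).1) a := fun α j a =>
    (Z.leftAct_single _ _ _ j a).trans (Z.actLeft_eq _ _ _ a).symm
  have hr : ∀ α j a, r α (.op (PiTensorProduct.singleAlgHom j a)) =
      Z.actRight _ _ (TangleDiagram.position_isArc N α (t j).1) a := fun α j a =>
    (Z.rightAct_single _ _ _ j a).trans (Z.actRight_eq _ _ _ a).symm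
  -- The actions on the terms are the diagonal sums of the actions `l α` and `r α` on the summands,
  -- so each property is checked at the vertices or along the edges of the cube.
  refine ⟨fun i => (DirectSum.diagonal _).comp (AlgHom.pi fun α : T.Height i => l α.1),
    fun i => (DirectSum.diagonal _).comp (AlgHom.pi fun α : T.Height i => r α.1),
    fun i j a α x => ?_, fun i j a α x => ?_, fun i a b => ?_, fun i a => ?_, fun i b => ?_⟩
  · rw [← hl]
    exact DirectSum.lmap_lof _ _ _
  · rw [← hr]
    exact DirectSum.lmap_lof _ _ _
  · have hc : (fun α : T.Height i => l α.1 a) * (fun α : T.Height i => r α.1 b) =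
        (fun α : T.Height i => r α.1 b) * (fun α : T.Height i => l α.1 a) :=
      funext fun α => LinearMap.ext fun v => Z.leftAct_rightAct _ _ _ _ _ _ a b v
    have := congrArg (DirectSum.diagonal (R := k)
      fun α : T.Height i => (Z.functor.obj (TangleDiagram.vertex N α.1) : Type u)) hc
    rwa [map_mul, map_mul] at this
  · refine TangleDiagram.d_comm Z N ν (fun α => l α a) fun hj e x => ?_
    refine PiTensorProduct.intertwine _ (l _) (l _) (fun j b v => ?_) a x
    rw [hl, hl, Z.actLeft_eq, Z.actLeft_eq]
    exact TangleDiagram.edgeMap_lOp Z N hj e (s j) b v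
  · refine TangleDiagram.d_comm Z N ν (fun α => r α b) fun hj e x => ?_
    refine PiTensorProduct.intertwine_op _ (r _) (r _) (fun j b v => ?_) b x
    rw [hr, hr, Z.actRight_eq, Z.actRight_eq]
    exact TangleDiagram.edgeMap_rOp Z N hj e (t j) b v
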